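/- **Setting.** Let $I\subset\mathbb R$ be an open interval and fix a sign $\pm$. Put $\eta_\pm=\mathrm{diag}(\pm1,1,1)$, $\langle v,w\rangle_\pm=v\cdot(\eta_\pm w)$, $v\wedge_\pm w=\eta_\pm(v\wedge w)$ on $\mathbb R^3$, and let the target be $\mathbb S^2=\{u_0^2+u_1^2+u_2^2=1\}$ (sign $+$) or $\mathbb H^2=\{u_0^2-u_1^2-u_2^2=1\}$ (sign $-$). Consider, for $u(t,x,y)$ with values in the target and real $\phi(t,x,y)$, the system $$u_t=u\wedge_\pm(u_{xx}-u_{yy})+u_y\phi_x-u_x\phi_y,\qquad \phi_{xx}-\phi_{yy}=-2\langle u,u_x\wedge_\pm u_y\rangle_\pm. \tag{1}$$ A pair $(u,\phi)$ is a *weak solution* of (1) on $I\times\mathbb R^2$ if $$u\in\text{target a.e.},\qquad u,\ \nabla u,\ \phi,\ u\wedge_\pm\nabla u,\ \phi\nabla u,\ \langle u,u_x\wedge_\pm u_y\rangle_\pm\in L^1_{loc}(I\times\mathbb R^2) \tag{2}$$ (with $\nabla u=(u_x,u_y)$ the weak gradient) and, for all $\psi\in C_c^\infty(I\times\mathbb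 R^2,\mathbb R^3)$ and $\rho\in C_c^\infty(I\times\mathbb R^2,\mathbb R)$, $$\int\langle u\wedge_\pm u_y,\psi_y\rangle_\pm-\langle u\wedge_\pm u_x,\psi_x\rangle_\pm+\langle u,\psi_t\rangle_\pm-\phi\big(\langle u_y,\psi_x\rangle_\pm-\langle u_x,\psi_y\rangle_\pm\big)\,dt\,dx\,dy=0,$$ $$\int(\rho_{xx}-\rho_{yy})\phi+2\rho\langle u,u_x\wedge_\pm u_y\rangle_\pm\,dt\,dx\,dy=0 .$$ Let $\xi=x+y$, $\eta=x-y$, and let $S=\{|x|=|y|\}=\{\xi\eta=0\}$. The set $S$ separates the plane into the cones $h\pm$: $\pm x>|y|$ and $v\pm$: $\pm y>|x|$; in the signs of $(\xi,\eta)$ these are $h+:(+,+)$, $h-:(-,-)$, $v+:(+,-)$, $v-:(-,+)$. **Assumptions on $(u,\phi)$.** Condition (2) holds; $u$ is continuous on $I\times\mathbb R^2$; away from $S$, $(u,\phi)$ is smooth and satisfies (1) classically; and in each cone (indices $\pm$ and $h,v$) $$\phi=\phi_{1\pm}^{h,v}(t,\xi)\log|\eta|+\phi_{2\pm}^{h,v}(t,\eta)\log|\xi|+\phi_{3\pm}^{h,v}(t,\xi,\eta),$$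 where, for some $\delta\in(0,1]$, some $p>1$ and some sequence $\epsilon_n\to0^+$: * $\phi_1,\phi_2,\phi_3$ are locally bounded, on $I$ times the closed half lines, respectively closed cones, belonging to the cone in question, and $\phi_3$ is continuous on $I$ times the closed cone; * $\phi_{1}(t,z)=\phi_{1}(t,0)+O(|z|^\delta)$ and $\phi_2(t,z)=\phi_2(t,0)+O(|z|^\delta)$ as $z\to0$ within these half lines; * for every bounded interval $I'$, $u_\xi(t,\cdot,0)$ and $u_\eta(t,0,\cdot)$ (the derivatives of the traces of $u$ on $S$) lie in $L^p(I')$ and $$|u_\xi(t,\cdot,\pm\epsilon_n)-u_\xi(t,\cdot,0)|_{L^p(I')}=O(\epsilon_n^\delta)=|u_\eta(t,\pm\epsilon_n,\cdot)-u_\eta(t,0,\cdot)|_{L^p(I')};$$ * the $O(\cdot)$ bounds and the $L^p(I')$ norms of the traces $u_\xi(t,\cdot,0)$, $u_\eta(t,0,\cdot)$ are uniform for $t$ in compact subsets of $I$. **Notation.** Let $$\phi_1^-(t,\xi)=\begin{cases}\phi_{1-}^h(t,\xi)&\xi\le0\\ \phi_{1+}^v(t,\xi)&\xi>0\end{cases}\quad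 \phi_1^+(t,\xi)=\begin{cases}\phi_{1-}^v(t,\xi)&\xi\le0\\ \phi_{1+}^h(t,\xi)&\xi>0\end{cases}$$ $$\phi_2^-(t,\eta)=\begin{cases}\phi_{2-}^h(t,\eta)&\eta\le0\\ \phi_{2-}^v(t,\eta)&\eta>0\end{cases}\quad \phi_2^+(t,\eta)=\begin{cases}\phi_{2+}^v(t,\eta)&\eta\le0\\ \phi_{2+}^h(t,\eta)&\eta>0\end{cases}$$ $[\phi_i]=\phi_i^+-\phi_i^-$ for $i=1,2$, and $$c_1(t,\xi)=(\phi_{3+}^v-\phi_{3+}^h)(t,\xi,0)\ (\xi\ge0),\qquad c_2(t,\eta)=(\phi_{3-}^h-\phi_{3+}^v)(t,0,\eta)\ (\eta\le0),$$ $$c_3(t,\xi)=(\phi_{3-}^v-\phi_{3-}^h)(t,\xi,0)\ (\xi\le0),\qquad c_4(t,\eta)=(\phi_{3+}^h-\phi_{3-}^v)(t,0,\eta)\ (\eta\ge0).$$ **Proposition.** Under these assumptions, $(u,\phi)$ is a weak solution of (1) on $I\times\mathbb R^2$ if and only if, for each $t\in I$: 1. $\phi_1^\pm(t,\cdot)$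 and $\phi_2^\pm(t,\cdot)$ are continuous at $0$, and $[\phi_1]$, $[\phi_2]$, $c_1,c_2,c_3,c_4$ depend only on $t$ (each on its domain); 2. at the origin, $c_2+c_4=0$ or $c_1+c_3=0$, or equivalently $\phi_{3-}^h+\phi_{3+}^h=\phi_{3-}^v+\phi_{3+}^v$ at $(t,0,0)$; 3. $[\phi_1](t)\,u_\xi(t,\xi,0)=0$ for a.e. $\xi$; $c_1(t)\,u_\xi(t,\xi,0)=0$ for a.e. $\xi>0$; $c_3(t)\,u_\xi(t,\xi,0)=0$ for a.e. $\xi<0$; $[\phi_2](t)\,u_\eta(t,0,\eta)=0$ for a.e. $\eta$; $c_2(t)\,u_\eta(t,0,\eta)=0$ for a.e. $\eta<0$; $c_4(t)\,u_\eta(t,0,\eta)=0$ for a.e. $\eta>0$. -/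

import Mathlib

open MeasureTheory Filter Topology Set
open scoped ENNReal ContDiff Matrix

namespace Ishimori

noncomputable section

/-! ### Targets, metric and wedge product -/

/-- The two cases `+` (unit sphere) and `-` (pseudo-sphere) of the system. -/
inductive Target where
  | sphere
  | pseudosphere

/-- The sign in the metric `diag(±1, 1, 1)`. -/
def Target.sign : Target → ℝ
  | .sphere => 1
  | .pseudosphere => -1

/-- Values of the spin.  The norm of `ℝ³` enters only up to equivalence. -/
abbrev V3 : Type := Fin 3 → ℝ

/-- Multiplication by `diag(±1, 1, 1)`. -/
def etaMul (κ : Target) (v : V3) : V3 := ![κ.sign * v 0, v 1, v 2]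

/-- `⟨v, w⟩_± = v · (η_± w)`. -/
def form (κ : Target) (v w : V3) : ℝ := v ⬝ᵥ etaMul κ w

/-- `v ∧_± w = η_± (v ∧ w)`. -/
def wedge (κ : Target) (v w : V3) : V3 := etaMul κ (crossProduct v w)

/-- `𝕊² = {u₀² + u₁² + u₂² = 1}` and `ℍ² = {u₀² - u₁² - u₂² = 1}`. -/
def targetSet : Target → Set V3
  | .sphere => {v | v 0 ^ 2 + v 1 ^ 2 + v 2 ^ 2 = 1}
  | .pseudosphere => {v | v 0 ^ 2 - v 1 ^ 2 - v 2 ^ 2 = 1}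

/-! ### Space-time -/

/-- Points `(t, x, y)`. -/
abbrev ST : Type := ℝ × ℝ × ℝ

def eT : ST := (1, 0, 0)
def eX : ST := (0, 1, 0)
def eY : ST := (0, 0, 1)

/-- `I × ℝ²`. -/
def slab (I : Set ℝ) : Set ST := {q | q.1 ∈ I}

/-- `I × ℝ²` without the cross `|x| = |y|`. -/
def offCross (I : Set ℝ) : Set ST := {q | q.1 ∈ I ∧ |q.2.1| ≠ |q.2.2|}

/-- Classical partial derivative in the direction `e`. -/
def pd {F : Type*} [NormedAddCommGroup F] [NormedSpace ℝ F] (e : ST) (f : ST → F) (q : ST) : F :=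
  fderiv ℝ f q e

/-- `f ∈ C_c^∞(Ω)`. -/
def IsTest {F : Type*} [NormedAddCommGroup F] [NormedSpace ℝ F] (Ω : Set ST) (f : ST → F) : Prop :=
  ContDiff ℝ ∞ f ∧ HasCompactSupport f ∧ tsupport f ⊆ Ω

/-- `g ∈ L¹_loc(Ω)` is the weak partial derivative of `f ∈ L¹_loc(Ω)` in the direction `e`. -/
def IsWeakPartial (Ω : Set ST) (e : ST) (f g : ST → V3) : Prop :=
  LocallyIntegrableOn f Ω ∧ LocallyIntegrableOn g Ω ∧
    ∀ θ : ST → ℝ, IsTest Ω θ → ∫ q in Ω, pd e θ q • f q = -∫ q in Ω, θ q • g q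

/-! ### The system: classical and weak solutions -/

/-- The system holds classically at the point `q`. -/
def SatisfiesSystemAt (κ : Target) (u : ST → V3) (φ : ST → ℝ) (q : ST) : Prop :=
  pd eT u q = wedge κ (u q) (pd eX (pd eX u) q - pd eY (pd eY u) q)
      + pd eX φ q • pd eY u q - pd eY φ q • pd eX u q ∧
  pd eX (pd eX φ) q - pd eY (pd eY φ) q = -2 * form κ (u q) (wedge κ (pd eX u q) (pd eY u q))

/-- The value and integrability requirements on a weak solution; `ux`, `uy` are the weak
derivatives of `u` (unique up to null sets). -/
structure WeakClass (κ : Target) (I : Set ℝ) (u : ST → V3) (φ : ST → ℝ) (ux uy : ST → V3) :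
    Prop where
  mem_target : ∀ᵐ q ∂(volume.restrict (slab I)), u q ∈ targetSet κ
  weak_x : IsWeakPartial (slab I) eX u ux
  weak_y : IsWeakPartial (slab I) eY u uy
  phi_int : LocallyIntegrableOn φ (slab I)
  wedge_x : LocallyIntegrableOn (fun q => wedge κ (u q) (ux q)) (slab I)
  wedge_y : LocallyIntegrableOn (fun q => wedge κ (u q) (uy q)) (slab I)
  phi_x : LocallyIntegrableOn (fun q => φ q • ux q) (slab I)
  phi_y : LocallyIntegrableOn (fun q => φ q • uy q) (slab I)
  source : LocallyIntegrableOn (fun q => form κ (u q) (wedge κ (ux q) (uy q))) (slab I)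

/-- `(u, φ)` is a weak solution on `I × ℝ²`. -/
def IsWeakSolution (κ : Target) (I : Set ℝ) (u : ST → V3) (φ : ST → ℝ) : Prop :=
  ∃ ux uy : ST → V3, WeakClass κ I u φ ux uy ∧
    (∀ ψ : ST → V3, IsTest (slab I) ψ →
      ∫ q in slab I,
        (form κ (wedge κ (u q) (uy q)) (pd eY ψ q) - form κ (wedge κ (u q) (ux q)) (pd eX ψ q)
          + form κ (u q) (pd eT ψ q)
          - φ q * (form κ (uy q) (pd eX ψ q) - form κ (ux q) (pd eY ψ q))) = 0) ∧
    (∀ ρ : ST → ℝ, IsTest (slab I) ρ →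
      ∫ q in slab I,
        ((pd eX (pd eX ρ) q - pd eY (pd eY ρ) q) * φ q
          + 2 * ρ q * form κ (u q) (wedge κ (ux q) (uy q))) = 0)

/-! ### Characteristic coordinates `ξ = x + y`, `η = x - y` and the four cones -/

/-- The point `(t, x, y)` with `x + y = ξ` and `x - y = η`. -/
def charPt (t ξ η : ℝ) : ST := (t, (ξ + η) / 2, (ξ - η) / 2)

/-- `u_ξ(t, ξ, η)`, the pointwise derivative in `ξ`.  For `η = 0` this is the derivative
of the trace `ξ ↦ u(t, ξ, 0)` on the cross. -/
def dXi (u : ST → V3) (t ξ η : ℝ) : V3 := deriv (fun s => u (charPt t s η)) ξ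

/-- `u_η(t, ξ, η)`. -/
def dEta (u : ST → V3) (t ξ η : ℝ) : V3 := deriv (fun s => u (charPt t ξ s)) η

/-- The horizontal cones `±x > |y|` and the vertical cones `±y > |x|`. -/
inductive Cone where
  | hPlus
  | hMinus
  | vPlus
  | vMinus

/-- The sign of `ξ` in a cone. -/
def Cone.sXi : Cone → ℝ
  | .hPlus => 1
  | .hMinus => -1
  | .vPlus => 1
  | .vMinus => -1

/-- The sign of `η` in a cone. -/
def Cone.sEta : Cone → ℝ
  | .hPlus => 1
  | .hMinus => -1
  | .vPlus => -1
  | .vMinus => 1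

/-- Membership of `(x, y)` in an open cone. -/
def Cone.Contains : Cone → ℝ → ℝ → Prop
  | .hPlus, x, y => |y| < x
  | .hMinus, x, y => |y| < -x
  | .vPlus, x, y => |x| < y
  | .vMinus, x, y => |x| < -y

theorem Cone.contains_iff (c : Cone) (x y : ℝ) :
    c.Contains x y ↔ 0 < c.sXi * (x + y) ∧ 0 < c.sEta * (x - y) := by
  cases c <;> simp only [Cone.Contains, Cone.sXi, Cone.sEta, abs_lt] <;>
    constructor <;> rintro ⟨h1, h2⟩ <;> constructor <;> linarith

/-- The logarithmic form of the field: `φ = φ₁(t, ξ) log|η| + φ₂(t, η) log|ξ| + φ₃(t, ξ, η)` in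
each cone.  The coefficients matter only for `t ∈ I` and on the closed half lines resp. closed
cones belonging to `c`.  The `O(|z|^δ)` is locally uniform in `t`. -/
structure LogForm (I : Set ℝ) (φ : ST → ℝ) (φ₁ φ₂ : Cone → ℝ → ℝ → ℝ)
    (φ₃ : Cone → ℝ → ℝ → ℝ → ℝ) (δ : ℝ) : Prop where
  form_eq : ∀ c, ∀ t ∈ I, ∀ ξ η, 0 < c.sXi * ξ → 0 < c.sEta * η →
    φ (charPt t ξ η) = φ₁ c t ξ * Real.log |η| + φ₂ c t η * Real.log |ξ| + φ₃ c t ξ η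
  bdd₁ : ∀ c, ∀ K ⊆ I, IsCompact K → ∀ R : ℝ, ∃ C : ℝ, ∀ t ∈ K, ∀ ξ,
    0 ≤ c.sXi * ξ → |ξ| ≤ R → |φ₁ c t ξ| ≤ C
  bdd₂ : ∀ c, ∀ K ⊆ I, IsCompact K → ∀ R : ℝ, ∃ C : ℝ, ∀ t ∈ K, ∀ η,
    0 ≤ c.sEta * η → |η| ≤ R → |φ₂ c t η| ≤ C
  bdd₃ : ∀ c, ∀ K ⊆ I, IsCompact K → ∀ R : ℝ, ∃ C : ℝ, ∀ t ∈ K, ∀ ξ η,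
    0 ≤ c.sXi * ξ → 0 ≤ c.sEta * η → |ξ| ≤ R → |η| ≤ R → |φ₃ c t ξ η| ≤ C
  cont₃ : ∀ c, ContinuousOn (fun q : ST => φ₃ c q.1 q.2.1 q.2.2)
    {q | q.1 ∈ I ∧ 0 ≤ c.sXi * q.2.1 ∧ 0 ≤ c.sEta * q.2.2}
  hol₁ : ∀ c, ∀ K ⊆ I, IsCompact K → ∃ C : ℝ, ∃ r > 0, ∀ t ∈ K, ∀ ξ,
    0 ≤ c.sXi * ξ → |ξ| ≤ r → |φ₁ c t ξ - φ₁ c t 0| ≤ C * |ξ| ^ δ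
  hol₂ : ∀ c, ∀ K ⊆ I, IsCompact K → ∃ C : ℝ, ∃ r > 0, ∀ t ∈ K, ∀ η,
    0 ≤ c.sEta * η → |η| ≤ r → |φ₂ c t η - φ₂ c t 0| ≤ C * |η| ^ δ

/-- `|f|_{L^p(-R, R)}`. -/
def lpOn (p : ℝ≥0∞) (R : ℝ) (f : ℝ → V3) : ℝ≥0∞ :=
  eLpNorm f p (volume.restrict (Ioo (-R) R))

/-- Along the lines `η = ±ε_n` resp. `ξ = ±ε_n` the tangential derivatives of `u` converge in
`L^p_loc(ℝ)` to those of the traces on the cross, which lie in `L^p_loc(ℝ)`, with error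
`O(ε_n^δ)`; everything is locally uniform in `t`. -/
structure TraceConvergence (I : Set ℝ) (u : ST → V3) (δ : ℝ) (p : ℝ≥0∞) (ε : ℕ → ℝ) : Prop where
  xi : ∀ K ⊆ I, IsCompact K → ∀ R : ℝ, ∃ C : ℝ,
    (∀ t ∈ K, lpOn p R (fun ξ => dXi u t ξ 0) ≤ ENNReal.ofReal C) ∧
    ∀ᶠ n in atTop, ∀ t ∈ K,
      lpOn p R (fun ξ => dXi u t ξ (ε n) - dXi u t ξ 0) ≤ ENNReal.ofReal (C * ε n ^ δ) ∧
      lpOn p R (fun ξ => dXi u t ξ (-ε n) - dXi u t ξ 0) ≤ ENNReal.ofReal (C * ε n ^ δ)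
  eta : ∀ K ⊆ I, IsCompact K → ∀ R : ℝ, ∃ C : ℝ,
    (∀ t ∈ K, lpOn p R (fun η => dEta u t 0 η) ≤ ENNReal.ofReal C) ∧
    ∀ᶠ n in atTop, ∀ t ∈ K,
      lpOn p R (fun η => dEta u t (ε n) η - dEta u t 0 η) ≤ ENNReal.ofReal (C * ε n ^ δ) ∧
      lpOn p R (fun η => dEta u t (-ε n) η - dEta u t 0 η) ≤ ENNReal.ofReal (C * ε n ^ δ)

/-- The standing assumptions on `(u, φ)`: value and integrability requirements, `u` continuous,
`(u, φ)` a smooth classical solution off the cross, `φ` of logarithmic form, and convergence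
of the tangential derivatives of `u` towards the cross. -/
structure StandingAssumptions (κ : Target) (I : Set ℝ) (u : ST → V3) (φ : ST → ℝ)
    (φ₁ φ₂ : Cone → ℝ → ℝ → ℝ) (φ₃ : Cone → ℝ → ℝ → ℝ → ℝ) : Prop where
  weakClass : ∃ ux uy : ST → V3, WeakClass κ I u φ ux uy
  u_cont : ContinuousOn u (slab I)
  u_smooth : ContDiffOn ℝ ∞ u (offCross I)
  phi_smooth : ContDiffOn ℝ ∞ φ (offCross I)
  classical : ∀ q ∈ offCross I, SatisfiesSystemAt κ u φ q
  regular : ∃ δ : ℝ, 0 < δ ∧ δ ≤ 1 ∧ LogForm I φ φ₁ φ₂ φ₃ δ ∧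
    ∃ p : ℝ≥0∞, 1 < p ∧ ∃ ε : ℕ → ℝ, (∀ n, 0 < ε n) ∧ Tendsto ε atTop (𝓝 0) ∧
      TraceConvergence I u δ p ε

/-! ### The compatibility conditions -/

/-- `φ₁⁻`, the coefficient of `log|η|` on the side `η < 0`. -/
def phi1Minus (φ₁ : Cone → ℝ → ℝ → ℝ) (t ξ : ℝ) : ℝ :=
  if ξ ≤ 0 then φ₁ .hMinus t ξ else φ₁ .vPlus t ξ

/-- `φ₁⁺`, the coefficient of `log|η|` on the side `η > 0`. -/
def phi1Plus (φ₁ : Cone → ℝ → ℝ → ℝ) (t ξ : ℝ) : ℝ :=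
  if ξ ≤ 0 then φ₁ .vMinus t ξ else φ₁ .hPlus t ξ

/-- `φ₂⁻`, the coefficient of `log|ξ|` on the side `ξ < 0`. -/
def phi2Minus (φ₂ : Cone → ℝ → ℝ → ℝ) (t η : ℝ) : ℝ :=
  if η ≤ 0 then φ₂ .hMinus t η else φ₂ .vMinus t η

/-- `φ₂⁺`, the coefficient of `log|ξ|` on the side `ξ > 0`. -/
def phi2Plus (φ₂ : Cone → ℝ → ℝ → ℝ) (t η : ℝ) : ℝ :=
  if η ≤ 0 then φ₂ .vPlus t η else φ₂ .hPlus t η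

/-- `[φ₁]`. -/
def jump1 (φ₁ : Cone → ℝ → ℝ → ℝ) (t ξ : ℝ) : ℝ := phi1Plus φ₁ t ξ - phi1Minus φ₁ t ξ

/-- `[φ₂]`. -/
def jump2 (φ₂ : Cone → ℝ → ℝ → ℝ) (t η : ℝ) : ℝ := phi2Plus φ₂ t η - phi2Minus φ₂ t η

/-- `c₁(t, ξ)`, for `ξ ≥ 0`. -/
def c1 (φ₃ : Cone → ℝ → ℝ → ℝ → ℝ) (t ξ : ℝ) : ℝ := φ₃ .vPlus t ξ 0 - φ₃ .hPlus t ξ 0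

/-- `c₂(t, η)`, for `η ≤ 0`. -/
def c2 (φ₃ : Cone → ℝ → ℝ → ℝ → ℝ) (t η : ℝ) : ℝ := φ₃ .hMinus t 0 η - φ₃ .vPlus t 0 η

/-- `c₃(t, ξ)`, for `ξ ≤ 0`. -/
def c3 (φ₃ : Cone → ℝ → ℝ → ℝ → ℝ) (t ξ : ℝ) : ℝ := φ₃ .vMinus t ξ 0 - φ₃ .hMinus t ξ 0

/-- `c₄(t, η)`, for `η ≥ 0`. -/
def c4 (φ₃ : Cone → ℝ → ℝ → ℝ → ℝ) (t η : ℝ) : ℝ := φ₃ .hPlus t 0 η - φ₃ .vMinus t 0 η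

/-- The compatibility conditions at the time `t`. -/
structure CompatibleAt (u : ST → V3) (φ₁ φ₂ : Cone → ℝ → ℝ → ℝ)
    (φ₃ : Cone → ℝ → ℝ → ℝ → ℝ) (t : ℝ) : Prop where
  cont_phi1Minus : ContinuousAt (phi1Minus φ₁ t) 0
  cont_phi1Plus : ContinuousAt (phi1Plus φ₁ t) 0
  cont_phi2Minus : ContinuousAt (phi2Minus φ₂ t) 0
  cont_phi2Plus : ContinuousAt (phi2Plus φ₂ t) 0
  jump1_const : ∀ ξ ξ' : ℝ, jump1 φ₁ t ξ = jump1 φ₁ t ξ'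
  jump2_const : ∀ η η' : ℝ, jump2 φ₂ t η = jump2 φ₂ t η'
  c1_const : ∀ ξ ≥ 0, ∀ ξ' ≥ 0, c1 φ₃ t ξ = c1 φ₃ t ξ'
  c2_const : ∀ η ≤ 0, ∀ η' ≤ 0, c2 φ₃ t η = c2 φ₃ t η'
  c3_const : ∀ ξ ≤ 0, ∀ ξ' ≤ 0, c3 φ₃ t ξ = c3 φ₃ t ξ'
  c4_const : ∀ η ≥ 0, ∀ η' ≥ 0, c4 φ₃ t η = c4 φ₃ t η'
  corner : c2 φ₃ t 0 + c4 φ₃ t 0 = 0 ∨ c1 φ₃ t 0 + c3 φ₃ t 0 = 0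
  corner_phi : φ₃ .hMinus t 0 0 + φ₃ .hPlus t 0 0 = φ₃ .vMinus t 0 0 + φ₃ .vPlus t 0 0
  jump1_uXi : ∀ᵐ ξ : ℝ, jump1 φ₁ t ξ • dXi u t ξ 0 = 0
  c1_uXi : ∀ᵐ ξ : ℝ, 0 < ξ → c1 φ₃ t ξ • dXi u t ξ 0 = 0
  c3_uXi : ∀ᵐ ξ : ℝ, ξ < 0 → c3 φ₃ t ξ • dXi u t ξ 0 = 0
  jump2_uEta : ∀ᵐ η : ℝ, jump2 φ₂ t η • dEta u t 0 η = 0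
  c2_uEta : ∀ᵐ η : ℝ, η < 0 → c2 φ₃ t η • dEta u t 0 η = 0
  c4_uEta : ∀ᵐ η : ℝ, 0 < η → c4 φ₃ t η • dEta u t 0 η = 0

end

end Ishimori

open Ishimori

/-! In characteristic coordinates the system has divergence form off the axes: `u_t = 2 ∂_η(u ∧ u_ξ
+ φ u_ξ) + 2 ∂_ξ(u ∧ u_η - φ u_η)` and `φ_ξη = ⟨u, u_ξ ∧ u_η⟩`. The weak integrands are integrable,
so their integrals are limits of integrals over `|ξ|, |η| > ε_n`. There the classical equations
leave only boundary terms on the lines `η = ±ε_n` and `ξ = ±ε_n`, plus four corner values in the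
wave equation. The theorem says when these terms tend to zero for every test function. After
composition with `charMap` a point of `ST` is read as `(t, ξ, η)`, and `eX`, `eY` are the directions
of `ξ` and `η`.

On the lines `η = ±s`, with `|ξ| ≥ s`, the field is `O(|log s|)`, and its jump is `log s · [φ₁] +
(jump of φ₂(t, 0)) · log|ξ| + (jump of φ₃) + o(1)`, uniformly in `ξ` (`LogForm.line_expansion`). A
factor `1` or `u_ξ` that converges to its trace at the rate `s^δ` in `L¹` may be replaced by the
trace, because `s^δ |log s| → 0` (`LogForm.tendsto_line`). The part `u ∧ u_ξ` of the flux has no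
jump in the limit, since `u` is continuous (`SpinData.tendsto_wedge`). Each axis condition thus has
the form `log ε_n · A + B → 0`, which forces `A = 0` and `B = 0`. The weak equations give this after
integration in time; continuity in time of all coefficients makes it pointwise
(`FieldData.line_vanish`).

For the wave equation the weight is `1` and the tests are `ξ`-derivatives. Hence `[φ₁]` and the
finite part `(jump of φ₂) log|ξ| + (jump of φ₃)` are constant on each half axis. Since `φ₃` is
continuous up to the corner, the coefficient of `log|ξ|` vanishes, which is the matching of `φ₂` at
the origin, and `c₁`, `c₃` are constant (`FieldData.axisCompat`). The reflection `y ↦ -y`, `φ ↦ -φ`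
yields the same along `ξ = 0`, including the matching of `φ₁` that makes `[φ₁]` constant across the
corner. Once all this holds, the lines and the corner together contribute exactly `-(c₁ + c₃)(t)
ρ(t, 0, 0)`, so the remaining condition is `c₁ + c₃ = 0` (`FieldData.integral_waveIntegrand`). As
`c₁ + c₂ + c₃ + c₄ = 0` at the corner, all forms of condition 2 agree.

For the spin equation the weight is `u_ξ`. The divergent part and the finite part give `[φ₁] u_ξ =
0`, `c₁ u_ξ = 0` and `c₃ u_ξ = 0`. Conversely these make the comparison term vanish identically. No
corner term arises, because the equation is a single divergence. -/

namespace Ishimori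

noncomputable section

/-! ### Integration by parts off the axes -/

/-- The real numbers of absolute value greater than `r`. -/
def outer (r : ℝ) : Set ℝ := {x | r < |x|}

/-- Points of space-time off both axes `ξ = 0` and `η = 0`. -/
def offAxes : Set ST := {q | q.2.1 ≠ 0 ∧ q.2.2 ≠ 0}

/-- Points of space-time at distance greater than `r` from both axes. -/
def farAxes (r : ℝ) : Set ST := univ ×ˢ (outer r ×ˢ outer r)

theorem mem_outer {r x : ℝ} : x ∈ outer r ↔ r < |x| := Iff.rfl

theorem mem_farAxes {r : ℝ} {q : ST} : q ∈ farAxes r ↔ r < |q.2.1| ∧ r < |q.2.2| := by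
  simp [farAxes, outer]

theorem isOpen_outer (r : ℝ) : IsOpen (outer r) := isOpen_lt continuous_const continuous_abs

theorem measurableSet_outer (r : ℝ) : MeasurableSet (outer r) := (isOpen_outer r).measurableSet

theorem ne_zero_of_mem_outer {r x : ℝ} (hr : 0 ≤ r) (hx : x ∈ outer r) : x ≠ 0 :=
  abs_pos.1 (hr.trans_lt hx)

theorem isOpen_farAxes (r : ℝ) : IsOpen (farAxes r) :=
  isOpen_univ.prod ((isOpen_outer r).prod (isOpen_outer r))

theorem measurableSet_farAxes (r : ℝ) : MeasurableSet (farAxes r) :=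
  (isOpen_farAxes r).measurableSet

theorem isOpen_offAxes : IsOpen offAxes := by
  rw [offAxes, ofPred_and]
  exact (isOpen_ne_fun (by fun_prop) continuous_const).inter
    (isOpen_ne_fun (by fun_prop) continuous_const)

theorem outer_eq_union (r : ℝ) : outer r = Iio (-r) ∪ Ioi r := by
  ext x
  simp only [mem_outer, lt_abs, mem_union, mem_Iio, mem_Ioi]
  constructor
  · rintro (h | h)
    · exact Or.inr h
    · left; linarith
  · rintro (h | h)
    · right; linarith
    · exact Or.inl h

theorem volume_restrict_farAxes (r : ℝ) :
    (volume : Measure ST).restrict (farAxes r) =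
      (volume : Measure ℝ).prod ((volume.restrict (outer r)).prod (volume.restrict (outer r))) := by
  rw [farAxes, Measure.volume_eq_prod, Measure.volume_eq_prod, ← Measure.prod_restrict,
    ← Measure.prod_restrict, Measure.restrict_univ]

section

variable {E : Type*} [NormedAddCommGroup E] [NormedSpace ℝ E]

theorem hasCompactSupport_pd {f : ST → E} (hf : HasCompactSupport f) (e : ST) :
    HasCompactSupport (pd e f) :=
  (hf.fderiv ℝ).comp_left (g := fun L : ST →L[ℝ] E => L e) (by simp)

theorem tsupport_pd_subset (f : ST → E) (e : ST) : tsupport (pd e f) ⊆ tsupport f := by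
  refine (closure_mono ?_).trans (tsupport_fderiv_subset ℝ (f := f))
  intro q hq h
  exact hq (by simp [pd, h])

/-- A compactly supported function that is continuous at points off the axes is integrable at a
positive distance from the axes. -/
theorem integrableOn_farAxes {f : ST → E} (hf : ContinuousOn f offAxes)
    (hc : HasCompactSupport f) {r : ℝ} (hr : 0 < r) : IntegrableOn f (farAxes r) := by
  set K : Set ST := {q | r ≤ |q.2.1| ∧ r ≤ |q.2.2|} ∩ tsupport f with hK
  have hcl : IsClosed {q : ST | r ≤ |q.2.1| ∧ r ≤ |q.2.2|} := by
    rw [ofPred_and]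
    exact (isClosed_le continuous_const (by fun_prop)).inter
      (isClosed_le continuous_const (by fun_prop))
  have hKc : IsCompact K := hc.isCompact.inter_left hcl
  have hKs : K ⊆ offAxes := fun q hq =>
    ⟨abs_pos.1 (hr.trans_le hq.1.1), abs_pos.1 (hr.trans_le hq.1.2)⟩
  have h1 : IntegrableOn f K := (hf.mono hKs).integrableOn_compact hKc
  refine h1.of_forall_sdiff_eq_zero (measurableSet_farAxes r) fun q hq => ?_
  by_contra h
  rw [Set.mem_sdiff, mem_farAxes] at hq
  exact hq.2 ⟨⟨hq.1.1.le, hq.1.2.le⟩, subset_tsupport f h⟩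

theorem integrableOn_outer {E : Type*} [NormedAddCommGroup E] {f : ℝ → E} (hf : ContinuousOn f {0}ᶜ) (hc : HasCompactSupport f)
    {r : ℝ} (hr : 0 < r) : IntegrableOn f (outer r) := by
  set K : Set ℝ := {x | r ≤ |x|} ∩ tsupport f with hK
  have hcl : IsClosed {x : ℝ | r ≤ |x|} := isClosed_le continuous_const (by fun_prop)
  have hKc : IsCompact K := hc.isCompact.inter_left hcl
  have hKs : K ⊆ {0}ᶜ := fun q hq => abs_pos.1 (hr.trans_le hq.1)
  have h1 : IntegrableOn f K := (hf.mono hKs).integrableOn_compact hKc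
  refine h1.of_forall_sdiff_eq_zero (measurableSet_outer r) fun q hq => ?_
  by_contra h
  exact hq.2 ⟨le_of_lt (mem_outer.1 hq.1), subset_tsupport f h⟩

theorem ContDiffAt.continuousOn_pd {f : ST → E} {s : Set ST}
    (hf : ∀ q ∈ s, ContDiffAt ℝ 1 f q) (e : ST) : ContinuousOn (pd e f) s := fun q hq =>
  (((hf q hq).fderiv_right (m := 0) (by norm_num)).continuousAt.clm_apply
    continuousAt_const).continuousWithinAt

variable [CompleteSpace E]

/-- The fundamental theorem of calculus on the complement of an interval. -/
theorem integral_outer_deriv {f f' : ℝ → E} (hf : ∀ x ≠ 0, HasDerivAt f (f' x) x)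
    (hf' : ContinuousOn f' {0}ᶜ) (hc : HasCompactSupport f) (hc' : HasCompactSupport f')
    {r : ℝ} (hr : 0 < r) : ∫ x in outer r, f' x = f (-r) - f r := by
  have hint := integrableOn_outer hf' hc' hr
  have heq := outer_eq_union r
  rw [heq] at hint ⊢
  have htop : Tendsto f atTop (𝓝 0) :=
    (hc.is_zero_at_infty).mono_left atTop_le_cocompact
  have hbot : Tendsto f atBot (𝓝 0) :=
    (hc.is_zero_at_infty).mono_left atBot_le_cocompact
  have hd : Disjoint (Iio (-r)) (Ioi r) := by
    rw [Set.disjoint_left]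
    intro x hx hx'
    simp only [mem_Iio, mem_Ioi] at hx hx'
    linarith
  rw [setIntegral_union hd measurableSet_Ioi hint.left_of_union hint.right_of_union,
    ← integral_Iic_eq_integral_Iio]
  rw [integral_Ioi_of_hasDerivAt_of_tendsto' (fun x hx => hf x (hr.trans_le hx).ne')
    hint.right_of_union htop]
  rw [integral_Iic_of_hasDerivAt_of_tendsto'
    (fun x hx => hf x (by rintro rfl; simp only [mem_Iic] at hx; linarith))
    (by rw [integrableOn_Iic_iff_integrableOn_Iio]; exact hint.left_of_union) hbot]
  simp [sub_eq_add_neg]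

/-- The left inverse `p` of the slice map confines the support of the slice to the image of a
compact set. -/
theorem hasCompactSupport_slice {X Y F : Type*} [TopologicalSpace X] [TopologicalSpace Y] [T2Space X] [Zero F]
    {f : Y → F} (hf : HasCompactSupport f) {ι : X → Y} (p : Y → X) (hp : Continuous p)
    (h : ∀ x, p (ι x) = x) : HasCompactSupport fun x => f (ι x) := by
  refine HasCompactSupport.intro (hf.isCompact.image hp) fun x hx => ?_
  by_contra h'
  exact hx ⟨ι x, subset_tsupport f h', h x⟩

/-- Integration of an `η`-derivative at a positive distance from the axes. -/
theorem integral_farAxes_pd_eY {G : ST → E} (hG : ∀ q ∈ offAxes, ContDiffAt ℝ 1 G q)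
    (hc : HasCompactSupport G) {r : ℝ} (hr : 0 < r) :
    ∫ q in farAxes r, pd eY G q = ∫ t, ∫ ξ in outer r, (G (t, ξ, -r) - G (t, ξ, r)) := by
  have hcont := ContDiffAt.continuousOn_pd hG eY
  have hi := integrableOn_farAxes hcont (hasCompactSupport_pd hc eY) hr
  rw [IntegrableOn, volume_restrict_farAxes] at hi
  rw [volume_restrict_farAxes, integral_prod _ hi]
  have hi' := hi.prod_right_ae
  refine integral_congr_ae ?_
  filter_upwards [hi'] with t ht
  rw [integral_prod _ ht]
  refine setIntegral_congr_fun (measurableSet_outer r) fun ξ hξ => ?_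
  have hξ0 := ne_zero_of_mem_outer hr.le hξ
  refine integral_outer_deriv (f := fun η => G (t, ξ, η)) (fun η hη => ?_) ?_ ?_ ?_ hr
  · have h1 := ((hG (t, ξ, η) ⟨hξ0, hη⟩).differentiableAt (by norm_num)).hasFDerivAt
    have h2 : HasDerivAt (fun η : ℝ => ((t, ξ, η) : ST)) eY η :=
      (hasDerivAt_const η t).prodMk ((hasDerivAt_const η ξ).prodMk (hasDerivAt_id η))
    exact h1.comp_hasDerivAt η h2
  · exact hcont.comp (by fun_prop) fun η hη => ⟨hξ0, hη⟩
  · exact hasCompactSupport_slice hc (fun q => q.2.2) (by fun_prop) fun _ => rfl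
  · exact hasCompactSupport_slice (hasCompactSupport_pd hc eY) (fun q => q.2.2) (by fun_prop)
      fun _ => rfl

/-- Integration of a `ξ`-derivative at a positive distance from the axes. -/
theorem integral_farAxes_pd_eX {G : ST → E} (hG : ∀ q ∈ offAxes, ContDiffAt ℝ 1 G q)
    (hc : HasCompactSupport G) {r : ℝ} (hr : 0 < r) :
    ∫ q in farAxes r, pd eX G q = ∫ t, ∫ η in outer r, (G (t, -r, η) - G (t, r, η)) := by
  have hcont := ContDiffAt.continuousOn_pd hG eX
  have hi := integrableOn_farAxes hcont (hasCompactSupport_pd hc eX) hr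
  rw [IntegrableOn, volume_restrict_farAxes] at hi
  rw [volume_restrict_farAxes, integral_prod _ hi]
  have hi' := hi.prod_right_ae
  refine integral_congr_ae ?_
  filter_upwards [hi'] with t ht
  rw [integral_prod_symm _ ht]
  refine setIntegral_congr_fun (measurableSet_outer r) fun η hη => ?_
  have hη0 := ne_zero_of_mem_outer hr.le hη
  refine integral_outer_deriv (f := fun ξ => G (t, ξ, η)) (fun ξ hξ => ?_) ?_ ?_ ?_ hr
  · have h1 := ((hG (t, ξ, η) ⟨hξ, hη0⟩).differentiableAt (by norm_num)).hasFDerivAt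
    have h2 : HasDerivAt (fun ξ : ℝ => ((t, ξ, η) : ST)) eX ξ :=
      (hasDerivAt_const ξ t).prodMk ((hasDerivAt_id ξ).prodMk (hasDerivAt_const ξ η))
    exact h1.comp_hasDerivAt ξ h2
  · exact hcont.comp (by fun_prop) fun ξ hξ => ⟨hξ, hη0⟩
  · exact hasCompactSupport_slice hc (fun q => q.2.1) (by fun_prop) fun _ => rfl
  · exact hasCompactSupport_slice (hasCompactSupport_pd hc eX) (fun q => q.2.1) (by fun_prop)
      fun _ => rfl

/-- The integral of a `t`-derivative at a positive distance from the axes vanishes. -/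
theorem integral_farAxes_pd_eT {G : ST → E} (hG : ∀ q ∈ offAxes, ContDiffAt ℝ 1 G q)
    (hc : HasCompactSupport G) {r : ℝ} (hr : 0 < r) :
    ∫ q in farAxes r, pd eT G q = 0 := by
  have hcont := ContDiffAt.continuousOn_pd hG eT
  have hi := integrableOn_farAxes hcont (hasCompactSupport_pd hc eT) hr
  rw [IntegrableOn, volume_restrict_farAxes] at hi
  rw [volume_restrict_farAxes, integral_prod_symm _ hi, Measure.prod_restrict,
    ← Measure.volume_eq_prod]
  rw [setIntegral_congr_fun (g := fun _ => (0 : E))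
    ((measurableSet_outer r).prod (measurableSet_outer r)), integral_zero]
  rintro ⟨ξ, η⟩ ⟨hξ, hη⟩
  have hξ0 := ne_zero_of_mem_outer hr.le hξ
  have hη0 := ne_zero_of_mem_outer hr.le hη
  have hd : ∀ t, HasDerivAt (fun t => G (t, ξ, η)) (pd eT G (t, ξ, η)) t := fun t => by
    have h1 := ((hG (t, ξ, η) ⟨hξ0, hη0⟩).differentiableAt (by norm_num)).hasFDerivAt
    have h2 : HasDerivAt (fun t : ℝ => ((t, ξ, η) : ST)) eT t :=
      (hasDerivAt_id t).prodMk (hasDerivAt_const t (ξ, η))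
    exact h1.comp_hasDerivAt t h2
  have hcs : HasCompactSupport fun t => G (t, ξ, η) :=
    hasCompactSupport_slice hc (fun q => q.1) (by fun_prop) fun _ => rfl
  have hcs' : HasCompactSupport fun t => pd eT G (t, ξ, η) :=
    hasCompactSupport_slice (hasCompactSupport_pd hc eT) (fun q => q.1) (by fun_prop)
      fun _ => rfl
  have hcont' : Continuous fun t => pd eT G (t, ξ, η) := by
    rw [← continuousOn_univ]
    exact hcont.comp (by fun_prop) fun t _ => ⟨hξ0, hη0⟩
  have := integral_of_hasDerivAt_of_tendsto hd (hcont'.integrable_of_hasCompactSupport hcs')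
    ((hcs.is_zero_at_infty).mono_left atBot_le_cocompact)
    ((hcs.is_zero_at_infty).mono_left atTop_le_cocompact)
  simpa using this

/-- Integration of a mixed derivative at a positive distance from the axes. -/
theorem integral_farAxes_pd_eX_pd_eY {G : ST → E} (hG : ∀ q ∈ offAxes, ContDiffAt ℝ 2 G q)
    (hc : HasCompactSupport G) {r : ℝ} (hr : 0 < r) :
    ∫ q in farAxes r, pd eX (pd eY G) q =
      ∫ t, (G (t, r, r) + G (t, -r, -r) - G (t, r, -r) - G (t, -r, r)) := by
  have hG1 : ∀ q ∈ offAxes, ContDiffAt ℝ 1 (pd eY G) q := fun q hq =>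
    ((hG q hq).fderiv_right (m := 1) (by norm_num)).clm_apply contDiffAt_const
  have hcY := hasCompactSupport_pd hc eY
  rw [integral_farAxes_pd_eX hG1 hcY hr]
  have hcont := ContDiffAt.continuousOn_pd (fun q hq => (hG q hq).of_le (by norm_num)) eY
  have key : ∀ t, ∀ ξ ≠ 0, IntegrableOn (fun η => pd eY G (t, ξ, η)) (outer r) ∧
      ∫ η in outer r, pd eY G (t, ξ, η) = G (t, ξ, -r) - G (t, ξ, r) := by
    intro t ξ hξ
    have hc1 : ContinuousOn (fun η => pd eY G (t, ξ, η)) {0}ᶜ :=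
      hcont.comp (by fun_prop) fun η hη => ⟨hξ, hη⟩
    have hc2 : HasCompactSupport fun η => pd eY G (t, ξ, η) :=
      hasCompactSupport_slice hcY (fun q => q.2.2) (by fun_prop) fun _ => rfl
    refine ⟨integrableOn_outer hc1 hc2 hr, ?_⟩
    refine integral_outer_deriv (f := fun η => G (t, ξ, η)) (fun η hη => ?_) hc1 ?_ hc2 hr
    · have h1 := ((hG (t, ξ, η) ⟨hξ, hη⟩).differentiableAt (by norm_num)).hasFDerivAt
      have h2 : HasDerivAt (fun η : ℝ => ((t, ξ, η) : ST)) eY η :=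
        (hasDerivAt_const η t).prodMk ((hasDerivAt_const η ξ).prodMk (hasDerivAt_id η))
      exact h1.comp_hasDerivAt η h2
    · exact hasCompactSupport_slice hc (fun q => q.2.2) (by fun_prop) fun _ => rfl
  refine integral_congr_ae (Eventually.of_forall fun t => ?_)
  have h1 := key t r hr.ne'
  have h2 := key t (-r) (neg_ne_zero.2 hr.ne')
  simp only
  rw [integral_sub h2.1 h1.1, h1.2, h2.2]
  abel

end

/-! ### Weak derivatives away from the cross -/

/-- Translation invariance is what makes proper subspaces null and lets linear changes of variables
only rescale the measure. It is assembled through the two nested products of `ST`. -/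
instance isAddHaarMeasure_volume : (volume : Measure ST).IsAddHaarMeasure :=
  haveI : ((volume : Measure ℝ).prod (volume : Measure ℝ)).IsAddHaarMeasure :=
    Measure.prod.instIsAddHaarMeasure _ _
  Measure.prod.instIsAddHaarMeasure _ _

theorem isOpen_slab {I : Set ℝ} (hI : IsOpen I) : IsOpen (slab I) :=
  hI.preimage continuous_fst

theorem isOpen_offCross {I : Set ℝ} (hI : IsOpen I) : IsOpen (offCross I) := by
  rw [offCross, ofPred_and]
  exact (hI.preimage continuous_fst).inter (isOpen_ne_fun (by fun_prop) (by fun_prop))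

theorem offCross_subset_slab (I : Set ℝ) : offCross I ⊆ slab I := fun _ h => h.1

theorem volume_ker_eq_zero (L : ST →L[ℝ] ℝ) {e : ST} (he : L e ≠ 0) :
    volume {q | L q = 0} = 0 := by
  refine Measure.addHaar_submodule volume (LinearMap.ker (L : ST →ₗ[ℝ] ℝ)) fun h => ?_
  have : e ∈ LinearMap.ker (L : ST →ₗ[ℝ] ℝ) := h ▸ Submodule.mem_top
  exact he (by simpa using this)

theorem ae_mem_offAxes : ∀ᵐ q : ST, q ∈ offAxes := by
  have h1 := volume_ker_eq_zero ((ContinuousLinearMap.fst ℝ ℝ ℝ).comp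
    (ContinuousLinearMap.snd ℝ ℝ (ℝ × ℝ))) (e := (0, 1, 0)) (by simp)
  have h2 := volume_ker_eq_zero ((ContinuousLinearMap.snd ℝ ℝ ℝ).comp
    (ContinuousLinearMap.snd ℝ ℝ (ℝ × ℝ))) (e := (0, 0, 1)) (by simp)
  have h1' : ∀ᵐ q : ST, ¬ q.2.1 = 0 := by rw [ae_iff]; simpa using h1
  have h2' : ∀ᵐ q : ST, ¬ q.2.2 = 0 := by rw [ae_iff]; simpa using h2
  filter_upwards [h1', h2'] with q a b using ⟨a, b⟩

theorem ae_abs_ne : ∀ᵐ q : ST, |q.2.1| ≠ |q.2.2| := by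
  have h1 := volume_ker_eq_zero ((ContinuousLinearMap.fst ℝ ℝ ℝ - ContinuousLinearMap.snd ℝ ℝ ℝ).comp
    (ContinuousLinearMap.snd ℝ ℝ (ℝ × ℝ))) (e := (0, 1, 0)) (by simp)
  have h2 := volume_ker_eq_zero ((ContinuousLinearMap.fst ℝ ℝ ℝ + ContinuousLinearMap.snd ℝ ℝ ℝ).comp
    (ContinuousLinearMap.snd ℝ ℝ (ℝ × ℝ))) (e := (0, 0, 1)) (by simp)
  have h1' : ∀ᵐ q : ST, ¬ q.2.1 - q.2.2 = 0 := by rw [ae_iff]; simpa using h1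
  have h2' : ∀ᵐ q : ST, ¬ q.2.1 + q.2.2 = 0 := by rw [ae_iff]; simpa using h2
  filter_upwards [h1', h2'] with q a b h
  rcases abs_eq_abs.1 h with h | h
  · exact a (by linarith)
  · exact b (by linarith)

section

variable {E : Type*} [NormedAddCommGroup E] [NormedSpace ℝ E]

/-- The product of a locally integrable function and a continuous compactly supported function is
integrable. -/
theorem integrable_smul_of_locallyIntegrableOn {Ω : Set ST} {g : ST → ℝ} {f : ST → E}
    (hf : LocallyIntegrableOn f Ω) (hg : Continuous g) (hc : HasCompactSupport g)
    (hs : tsupport g ⊆ Ω) : Integrable fun q => g q • f q := by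
  have h1 := (hf.integrableOn_compact_subset hs hc.isCompact).continuousOn_smul
    (hg.continuousOn) hc.isCompact
  rwa [integrableOn_iff_integrable_of_support_subset] at h1
  exact (Function.support_smul_subset_left g f).trans (subset_tsupport g)

theorem IsTest.pd {Ω : Set ST} {f : ST → E} (hf : IsTest Ω f) (e : ST) : IsTest Ω (pd e f) :=
  ⟨(hf.1.fderiv_right (m := ∞) (by simp)).clm_apply contDiff_const, hasCompactSupport_pd hf.2.1 e,
    (tsupport_pd_subset f e).trans hf.2.2⟩

theorem setIntegral_slab_eq {I : Set ℝ} {F : Type*} [Zero F] {g : ST → F} {f : ST → E}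
    (hs : tsupport g ⊆ slab I) (h : ∀ q, q ∉ tsupport g → f q = 0) :
    ∫ q in slab I, f q = ∫ q, f q :=
  setIntegral_eq_integral_of_forall_compl_eq_zero fun q hq => h q fun h' => hq (hs h')

end

/-- Off the cross, a weak derivative is the classical derivative. -/
theorem IsWeakPartial.ae_eq_pd {I : Set ℝ} (hI : IsOpen I) {u : ST → V3}
    (hu : ContDiffOn ℝ ∞ u (offCross I)) {e : ST} {g : ST → V3}
    (h : IsWeakPartial (slab I) e u g) : g =ᵐ[volume.restrict (slab I)] pd e u := by
  obtain ⟨hul, hgl, h⟩ := h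
  have ho := isOpen_offCross hI
  have hcont : ContinuousOn (pd e u) (offCross I) := ContDiffAt.continuousOn_pd (fun q hq =>
    (hu.contDiffAt (ho.mem_nhds hq)).of_le (by exact_mod_cast le_top)) e
  have hpl : LocallyIntegrableOn (pd e u) (offCross I) :=
    hcont.locallyIntegrableOn ho.measurableSet
  have hgl' := hgl.mono_set (offCross_subset_slab I)
  -- The fundamental lemma is applied on the complement of the cross only: test functions supported
  -- there permit classical integration by parts, and the cross is a null set.
  have key := ho.ae_eq_zero_of_integral_contDiff_smul_eq_zero (f := fun q => g q - pd e u q)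
    (hgl'.sub hpl) ?_
  · rw [EventuallyEq, ae_restrict_iff' (isOpen_slab hI).measurableSet]
    filter_upwards [key, ae_abs_ne] with q h1 h2 h3
    exact sub_eq_zero.1 (h1 ⟨h3, h2⟩)
  · intro θ hθ hθc hθs
    have hts : tsupport θ ⊆ slab I := hθs.trans (offCross_subset_slab I)
    have i1 := integrable_smul_of_locallyIntegrableOn hgl' hθ.continuous hθc hθs
    have i2 := integrable_smul_of_locallyIntegrableOn hpl hθ.continuous hθc hθs
    have hT : IsTest (slab I) θ := ⟨hθ, hθc, hts⟩
    have hT' := hT.pd e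
    have i3 := integrable_smul_of_locallyIntegrableOn hul hT'.1.continuous hT'.2.1 hT'.2.2
    have i4 := integrable_smul_of_locallyIntegrableOn hul hθ.continuous hθc hts
    have h0 := h θ hT
    rw [setIntegral_slab_eq hts, setIntegral_slab_eq hts] at h0
    · have h1 := integral_smul_fderiv_eq_neg_fderiv_smul_of_integrable (μ := volume) i3 i2 i4
        (fun x _ => (hθ.differentiable (by simp)) x)
        (fun x hx => ((hu.contDiffAt (ho.mem_nhds (hθs hx))).differentiableAt (by simp)))
      simp only [smul_sub]
      rw [integral_sub i1 i2]
      change _ - ∫ x, θ x • fderiv ℝ u x e = 0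
      rw [h1]
      change _ - -∫ x, Ishimori.pd e θ x • u x = 0
      rw [h0]
      simp
    · intro q hq
      simp [image_eq_zero_of_notMem_tsupport hq]
    · intro q hq
      have : q ∉ tsupport (Ishimori.pd e θ) := fun h' => hq (tsupport_pd_subset θ e h')
      simp [image_eq_zero_of_notMem_tsupport this]

/-- Weak derivatives enter only up to null sets, so the unspecified ones can be replaced by `pd eX
u`, `pd eY u`, whose values on the cross are irrelevant. -/
theorem WeakClass.of_smooth {κ : Target} {I : Set ℝ} (hI : IsOpen I) {u : ST → V3} {φ : ST → ℝ}
    (hu : ContDiffOn ℝ ∞ u (offCross I)) {ux uy : ST → V3} (h : WeakClass κ I u φ ux uy) :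
    WeakClass κ I u φ (pd eX u) (pd eY u) := by
  have hx := h.weak_x.ae_eq_pd hI hu
  have hy := h.weak_y.ae_eq_pd hI hu
  refine ⟨h.mem_target, ⟨h.weak_x.1, h.weak_x.2.1.congr hx, fun θ hθ => ?_⟩,
    ⟨h.weak_y.1, h.weak_y.2.1.congr hy, fun θ hθ => ?_⟩, h.phi_int, h.wedge_x.congr ?_,
    h.wedge_y.congr ?_, h.phi_x.congr ?_, h.phi_y.congr ?_, h.source.congr ?_⟩
  · rw [h.weak_x.2.2 θ hθ, integral_congr_ae]
    filter_upwards [hx] with q hq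
    rw [hq]
  · rw [h.weak_y.2.2 θ hθ, integral_congr_ae]
    filter_upwards [hy] with q hq
    rw [hq]
  all_goals
    filter_upwards [hx, hy] with q hq hq'
    simp only [hq, hq']

/-- In the definition of a weak solution the weak derivatives may be taken to be the classical
derivatives off the cross. -/
theorem isWeakSolution_iff_pd {κ : Target} {I : Set ℝ} (hI : IsOpen I) {u : ST → V3} {φ : ST → ℝ}
    (hu : ContDiffOn ℝ ∞ u (offCross I)) (hw : WeakClass κ I u φ (pd eX u) (pd eY u)) :
    IsWeakSolution κ I u φ ↔
    (∀ ψ : ST → V3, IsTest (slab I) ψ →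
      ∫ q in slab I,
        (form κ (wedge κ (u q) (pd eY u q)) (pd eY ψ q)
          - form κ (wedge κ (u q) (pd eX u q)) (pd eX ψ q)
          + form κ (u q) (pd eT ψ q)
          - φ q * (form κ (pd eY u q) (pd eX ψ q) - form κ (pd eX u q) (pd eY ψ q))) = 0) ∧
    (∀ ρ : ST → ℝ, IsTest (slab I) ρ →
      ∫ q in slab I,
        ((pd eX (pd eX ρ) q - pd eY (pd eY ρ) q) * φ q
          + 2 * ρ q * form κ (u q) (wedge κ (pd eX u q) (pd eY u q))) = 0) := by
  refine ⟨fun ⟨ux, uy, h, h1, h2⟩ => ?_, fun h => ⟨_, _, hw, h⟩⟩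
  have hx := h.weak_x.ae_eq_pd hI hu
  have hy := h.weak_y.ae_eq_pd hI hu
  refine ⟨fun ψ hψ => ?_, fun ρ hρ => ?_⟩
  · rw [← h1 ψ hψ]
    refine integral_congr_ae ?_
    filter_upwards [hx, hy] with q hq hq'
    rw [hq, hq']
  · rw [← h2 ρ hρ]
    refine integral_congr_ae ?_
    filter_upwards [hx, hy] with q hq hq'
    rw [hq, hq']

/-! ### The weak formulation in characteristic coordinates -/

/-- The passage from characteristic to Cartesian coordinates. -/
def charMap : ST ≃L[ℝ] ST where
  toFun q := charPt q.1 q.2.1 q.2.2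
  invFun q := (q.1, q.2.1 + q.2.2, q.2.1 - q.2.2)
  map_add' p q := by simp only [charPt, Prod.fst_add, Prod.snd_add, Prod.mk_add_mk]; ring_nf
  map_smul' c q := by
    simp only [charPt, Prod.smul_fst, Prod.smul_snd, smul_eq_mul, Prod.smul_mk, RingHom.id_apply]
    ring_nf
  left_inv q := by simp only [charPt]; ring_nf
  right_inv q := by simp only [charPt]; ring_nf
  continuous_toFun := by unfold charPt; fun_prop
  continuous_invFun := by fun_prop

theorem charMap_apply (q : ST) : charMap q = charPt q.1 q.2.1 q.2.2 := rfl

theorem charMap_mk (t ξ η : ℝ) : charMap (t, ξ, η) = charPt t ξ η := rfl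

theorem charMap_fst (q : ST) : (charMap q).1 = q.1 := rfl

theorem charMap_symm_fst (q : ST) : (charMap.symm q).1 = q.1 := rfl

theorem charMap_mem_offCross {I : Set ℝ} {q : ST} :
    charMap q ∈ offCross I ↔ q ∈ slab I ∩ offAxes := by
  have h : |(q.2.1 + q.2.2) / 2| ≠ |(q.2.1 - q.2.2) / 2| ↔ q.2.1 ≠ 0 ∧ q.2.2 ≠ 0 := by
    rw [Ne, abs_eq_abs, ← not_or]
    refine not_congr ⟨?_, ?_⟩
    · rintro (h | h)
      · right; linarith
      · left; linarith
    · rintro (h | h)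
      · right; linarith
      · left; linarith
  exact and_congr Iff.rfl h

section

variable {E : Type*} [NormedAddCommGroup E] [NormedSpace ℝ E]

/-- No differentiability is needed: an isomorphism preserves failure of differentiability, in which
case both sides are zero. The formulas for `charMap` below therefore hold at every point, also on
the cross. -/
theorem pd_comp (L : ST ≃L[ℝ] ST) (f : ST → E) (e q : ST) :
    pd e (f ∘ L) q = pd (L e) f (L q) := by
  simp [pd, L.comp_right_fderiv]

theorem pd_add_dir (e e' : ST) (f : ST → E) : pd (e + e') f = pd e f + pd e' f := by
  ext q; simp [pd]

theorem pd_sub_dir (e e' : ST) (f : ST → E) : pd (e - e') f = pd e f - pd e' f := by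
  ext q; simp [pd]

theorem charMap_eT : charMap eT = eT := by simp [charMap_apply, charPt, eT]

theorem charMap_eX : charMap eX = (1 / 2 : ℝ) • (eX + eY) := by
  simp [charMap_apply, charPt, eX, eY]

theorem charMap_eY : charMap eY = (1 / 2 : ℝ) • (eX - eY) := by
  simp [charMap_apply, charPt, eX, eY]; norm_num

theorem charMap_eX_add : charMap (eX + eY) = eX := by
  rw [map_add, charMap_eX, charMap_eY]; module

theorem charMap_eX_sub : charMap (eX - eY) = eY := by
  rw [map_sub, charMap_eX, charMap_eY]; module

theorem pd_eT_charMap (f : ST → E) (q : ST) : pd eT f (charMap q) = pd eT (f ∘ charMap) q := by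
  rw [pd_comp, charMap_eT]

theorem pd_eX_charMap (f : ST → E) (q : ST) :
    pd eX f (charMap q) = pd eX (f ∘ charMap) q + pd eY (f ∘ charMap) q := by
  rw [← Pi.add_apply, ← pd_add_dir, pd_comp, charMap_eX_add]

theorem pd_eY_charMap (f : ST → E) (q : ST) :
    pd eY f (charMap q) = pd eX (f ∘ charMap) q - pd eY (f ∘ charMap) q := by
  rw [← Pi.sub_apply, ← pd_sub_dir, pd_comp, charMap_eX_sub]

theorem pd_add {e : ST} {f g : ST → E} {q : ST} (hf : DifferentiableAt ℝ f q)
    (hg : DifferentiableAt ℝ g q) : pd e (f + g) q = pd e f q + pd e g q := by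
  simp [pd, fderiv_add hf hg]

theorem pd_sub {e : ST} {f g : ST → E} {q : ST} (hf : DifferentiableAt ℝ f q)
    (hg : DifferentiableAt ℝ g q) : pd e (f - g) q = pd e f q - pd e g q := by
  simp [pd, fderiv_sub hf hg]

theorem pd_smul {e : ST} {f : ST → ℝ} {g : ST → E} {q : ST} (hf : DifferentiableAt ℝ f q)
    (hg : DifferentiableAt ℝ g q) :
    pd e (fun q => f q • g q) q = pd e f q • g q + f q • pd e g q := by
  have := fderiv_fun_smul hf hg
  simp only [pd, this]
  simp [add_comm]

theorem pd_congr {e : ST} {f g : ST → E} {q : ST} (h : f =ᶠ[𝓝 q] g) : pd e f q = pd e g q := by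
  simp [pd, h.fderiv_eq]

theorem ContDiffAt.pd {f : ST → E} {q : ST} (hf : ContDiffAt ℝ ∞ f q) (e : ST) :
    ContDiffAt ℝ ∞ (Ishimori.pd e f) q :=
  (hf.fderiv_right (m := ∞) (by simp)).clm_apply contDiffAt_const

theorem pd_comm {f : ST → E} {q : ST} (hf : ContDiffAt ℝ ∞ f q) (e e' : ST) :
    pd e (pd e' f) q = pd e' (pd e f) q := by
  have hs : IsSymmSndFDerivAt ℝ f q :=
    hf.isSymmSndFDerivAt (by rw [minSmoothness_of_isRCLikeNormedField]; exact ENat.LEInfty.out)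
  have hd : DifferentiableAt ℝ (fderiv ℝ f) q :=
    (hf.fderiv_right (m := ∞) (by simp)).differentiableAt (by simp)
  have h : ∀ a b : ST, Ishimori.pd a (Ishimori.pd b f) q = fderiv ℝ (fderiv ℝ f) q a b := by
    intro a b
    have : Ishimori.pd b f = fun y => (fderiv ℝ f y) b := rfl
    rw [Ishimori.pd, this, fderiv_clm_apply hd (differentiableAt_const b)]
    simp
  rw [h, h, hs.eq]

/-- The wave operator in characteristic coordinates. -/
theorem wave_charMap {f : ST → E} {q : ST} (hf : ContDiffAt ℝ ∞ f (charMap q)) :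
    pd eX (pd eX f) (charMap q) - pd eY (pd eY f) (charMap q) =
      (4 : ℝ) • pd eX (pd eY (f ∘ charMap)) q := by
  have hF : ContDiffAt ℝ ∞ (f ∘ charMap) q := hf.comp q charMap.contDiff.contDiffAt
  have h1 : pd eX f ∘ charMap = pd eX (f ∘ charMap) + pd eY (f ∘ charMap) := by
    ext q; exact pd_eX_charMap f q
  have h2 : pd eY f ∘ charMap = pd eX (f ∘ charMap) - pd eY (f ∘ charMap) := by
    ext q; exact pd_eY_charMap f q
  have dX := (ContDiffAt.pd hF eX).differentiableAt (by simp)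
  have dY := (ContDiffAt.pd hF eY).differentiableAt (by simp)
  rw [pd_eX_charMap, pd_eY_charMap, h1, h2, pd_add dX dY, pd_add dX dY, pd_sub dX dY,
    pd_sub dX dY, pd_comm hF eY eX]
  module

theorem IsTest.comp {I : Set ℝ} {f : ST → E} (hf : IsTest (slab I) f) {L : ST ≃L[ℝ] ST}
    (hL : ∀ q, (L q).1 = q.1) : IsTest (slab I) (f ∘ L) := by
  refine ⟨hf.1.comp L.contDiff, hf.2.1.comp_homeomorph L.toHomeomorph, ?_⟩
  have : tsupport (f ∘ L) ⊆ L ⁻¹' tsupport f :=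
    closure_minimal (fun q hq => subset_tsupport f hq)
      ((isClosed_tsupport f).preimage L.continuous)
  intro q hq
  have := hf.2.2 (this hq)
  simpa [slab, hL] using this

/-- Change of variables for a linear isomorphism. -/
theorem exists_integral_comp_eq (L : ST ≃L[ℝ] ST) : ∃ c : ℝ≥0∞, c ≠ 0 ∧ c ≠ ⊤ ∧
    Measure.map L volume = c • (volume : Measure ST) := by
  have hdet : LinearMap.det (L : ST →ₗ[ℝ] ST) ≠ 0 :=
    (LinearEquiv.isUnit_det' L.toLinearEquiv).ne_zero
  refine ⟨_, ?_, ?_, Measure.map_linearMap_addHaar_eq_smul_addHaar volume hdet⟩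
  · simpa using hdet
  · simp

/-- The weak equations only ask whether an integral vanishes, so the Jacobian matters only through
being neither zero nor infinite. -/
theorem integral_comp_eq_zero_iff (L : ST ≃L[ℝ] ST) (F : ST → E) :
    ∫ q, F (L q) = 0 ↔ ∫ q, F q = 0 := by
  obtain ⟨c, h0, hi, hc⟩ := exists_integral_comp_eq L
  have h := integral_map_equiv (μ := volume) L.toHomeomorph.toMeasurableEquiv F
  change ∫ q, F q ∂(Measure.map L volume) = ∫ q, F (L q) at h
  rw [hc, integral_smul_measure] at h
  rw [← h, smul_eq_zero]
  simp [ENNReal.toReal_eq_zero_iff, h0, hi]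

theorem integrable_comp {E : Type*} [NormedAddCommGroup E] (L : ST ≃L[ℝ] ST) {F : ST → E} (hF : Integrable F) :
    Integrable fun q => F (L q) := by
  obtain ⟨c, h0, hi, hc⟩ := exists_integral_comp_eq L
  have h := integrable_map_equiv (μ := volume) L.toHomeomorph.toMeasurableEquiv F
  change Integrable F (Measure.map L volume) ↔ Integrable (fun q => F (L q)) volume at h
  rw [← h, hc]
  exact hF.smul_measure hi

end

/-! ### Fluxes, and the scalar form of the weak equations -/

/-- The weights of the metric. -/
def etaWeight (κ : Target) : Fin 3 → ℝ := ![κ.sign, 1, 1]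

theorem etaWeight_ne_zero (κ : Target) (i : Fin 3) : etaWeight κ i ≠ 0 := by
  fin_cases i <;> cases κ <;> simp [etaWeight, Target.sign]

theorem form_eq_sum (κ : Target) (v w : V3) :
    form κ v w = ∑ i, etaWeight κ i * (v i * w i) := by
  simp [form, etaMul, dotProduct, Fin.sum_univ_three, etaWeight]
  ring

/-- `wedge` as a continuous bilinear map. -/
def wedgeL (κ : Target) : V3 →L[ℝ] V3 →L[ℝ] V3 :=
  (LinearMap.mk₂ ℝ (wedge κ)
    (fun a b c => by ext i; fin_cases i <;> simp [wedge, etaMul, crossProduct] <;> ring)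
    (fun a b c => by ext i; fin_cases i <;> simp [wedge, etaMul, crossProduct] <;> ring)
    (fun a b c => by ext i; fin_cases i <;> simp [wedge, etaMul, crossProduct] <;> ring)
    (fun a b c => by
      ext i; fin_cases i <;> simp [wedge, etaMul, crossProduct] <;> ring)).toContinuousBilinearMap

theorem wedgeL_apply (κ : Target) (v w : V3) : wedgeL κ v w = wedge κ v w := rfl

theorem wedge_swap (κ : Target) (v w : V3) : wedge κ w v = -wedge κ v w := by
  ext i; fin_cases i <;> simp [wedge, etaMul, crossProduct] <;> ring

/-- With `u_x = u_ξ + u_η` and `u_y = u_ξ - u_η` this computes `u_x ∧ u_y`, the source of the wave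
equation. -/
theorem wedge_add_sub (κ : Target) (v w : V3) :
    wedge κ (v + w) (v - w) = (-2 : ℝ) • wedge κ v w := by
  ext i; fin_cases i <;> simp [wedge, etaMul, crossProduct] <;> ring

theorem form_smul_right (κ : Target) (c : ℝ) (v w : V3) : form κ v (c • w) = c * form κ v w := by
  simp only [form_eq_sum, Finset.mul_sum, Pi.smul_apply, smul_eq_mul]
  exact Finset.sum_congr rfl fun i _ => by ring

/-- The flux through the lines `η = const`. -/
def fluxEta (κ : Target) (U : ST → V3) (P : ST → ℝ) (q : ST) : V3 :=
  wedge κ (U q) (pd eX U q) + P q • pd eX U q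

/-- The flux through the lines `ξ = const`. -/
def fluxXi (κ : Target) (U : ST → V3) (P : ST → ℝ) (q : ST) : V3 :=
  wedge κ (U q) (pd eY U q) - P q • pd eY U q

/-- The source term of the wave equation in characteristic coordinates. -/
def waveSource (κ : Target) (U : ST → V3) (q : ST) : ℝ :=
  form κ (U q) (wedge κ (pd eX U q) (pd eY U q))

/-- The integrand of the weak spin equation for a scalar test function. -/
def spinIntegrand (κ : Target) (U : ST → V3) (P : ST → ℝ) (ρ : ST → ℝ) (q : ST) : V3 :=
  pd eT ρ q • U q - (2 * pd eY ρ q) • fluxEta κ U P q - (2 * pd eX ρ q) • fluxXi κ U P q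

/-- The integrand of the weak wave equation. -/
def waveIntegrand (κ : Target) (U : ST → V3) (P : ST → ℝ) (ρ : ST → ℝ) (q : ST) : ℝ :=
  pd eX (pd eY ρ) q * P q - ρ q * waveSource κ U q

/-- The integrand of the weak spin equation in Cartesian coordinates. -/
def cartIntegrand (κ : Target) (u : ST → V3) (φ : ST → ℝ) (ρ : ST → ℝ) (q : ST) : V3 :=
  pd eY ρ q • (wedge κ (u q) (pd eY u q) + φ q • pd eX u q)
    - pd eX ρ q • (wedge κ (u q) (pd eX u q) + φ q • pd eY u q) + pd eT ρ q • u q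

/-- The mixed terms cancel: `ρ_η` meets only `u_ξ`, and `ρ_ξ` only `u_η`. The flux across a
characteristic line therefore contains only the tangential derivative of `u`, the one whose
convergence at the cross is assumed. -/
theorem cartIntegrand_charMap (κ : Target) (u : ST → V3) (φ : ST → ℝ) (ρ : ST → ℝ) (q : ST) :
    cartIntegrand κ u φ ρ (charMap q) =
      spinIntegrand κ (u ∘ charMap) (φ ∘ charMap) (ρ ∘ charMap) q := by
  simp only [cartIntegrand, spinIntegrand, fluxEta, fluxXi, pd_eX_charMap, pd_eY_charMap,
    pd_eT_charMap, ← wedgeL_apply, map_add, map_sub, Function.comp_apply]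
  module

theorem cartWave_charMap (κ : Target) (u : ST → V3) (φ : ST → ℝ) {ρ : ST → ℝ}
    (hρ : ContDiff ℝ ∞ ρ) (q : ST) :
    (pd eX (pd eX ρ) (charMap q) - pd eY (pd eY ρ) (charMap q)) * φ (charMap q)
      + 2 * ρ (charMap q) * form κ (u (charMap q))
        (wedge κ (pd eX u (charMap q)) (pd eY u (charMap q))) =
      4 * waveIntegrand κ (u ∘ charMap) (φ ∘ charMap) (ρ ∘ charMap) q := by
  rw [wave_charMap hρ.contDiffAt, pd_eX_charMap, pd_eY_charMap, wedge_add_sub, form_smul_right]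
  simp only [waveIntegrand, waveSource, Function.comp_apply, smul_eq_mul]
  ring

section

variable {κ : Target} {I : Set ℝ} {u : ST → V3} {φ : ST → ℝ}

theorem integrable_cartIntegrand (hw : WeakClass κ I u φ (pd eX u) (pd eY u)) {ρ : ST → ℝ}
    (hρ : IsTest (slab I) ρ) : Integrable (cartIntegrand κ u φ ρ) := by
  have aux : ∀ (e : ST) {f : ST → V3}, LocallyIntegrableOn f (slab I) →
      Integrable fun q => pd e ρ q • f q := fun e f hf =>
    integrable_smul_of_locallyIntegrableOn hf (hρ.pd e).1.continuous (hρ.pd e).2.1 (hρ.pd e).2.2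
  exact ((aux eY (hw.wedge_y.add hw.phi_x)).sub (aux eX (hw.wedge_x.add hw.phi_y))).add
    (aux eT hw.weak_x.1)

theorem integrable_cartWave (hw : WeakClass κ I u φ (pd eX u) (pd eY u)) {ρ : ST → ℝ}
    (hρ : IsTest (slab I) ρ) : Integrable fun q =>
      (pd eX (pd eX ρ) q - pd eY (pd eY ρ) q) * φ q
      + 2 * ρ q * form κ (u q) (wedge κ (pd eX u q) (pd eY u q)) := by
  have aux : ∀ {g : ST → ℝ} {f : ST → ℝ}, IsTest (slab I) g → LocallyIntegrableOn f (slab I) →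
      Integrable fun q => g q * f q := fun {g f} hg hf =>
    integrable_smul_of_locallyIntegrableOn hf hg.1.continuous hg.2.1 hg.2.2
  refine (((aux ((hρ.pd eX).pd eX) hw.phi_int).sub (aux ((hρ.pd eY).pd eY) hw.phi_int)).add
    ((aux hρ hw.source).const_mul 2)).congr (Eventually.of_forall fun q => ?_)
  simp only [Pi.add_apply, Pi.sub_apply]
  ring

/-- The test function is carried back by `charMap.symm`, so that the integrability assumptions apply
in Cartesian coordinates as they stand. -/
theorem integrable_spinIntegrand (hw : WeakClass κ I u φ (pd eX u) (pd eY u)) {ρ : ST → ℝ}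
    (hρ : IsTest (slab I) ρ) :
    Integrable (spinIntegrand κ (u ∘ charMap) (φ ∘ charMap) ρ) := by
  have h := integrable_comp charMap (integrable_cartIntegrand hw (hρ.comp charMap_symm_fst))
  refine h.congr (Eventually.of_forall fun q => ?_)
  simp only [cartIntegrand_charMap]
  congr 1
  ext q; simp

theorem integrable_waveIntegrand (hw : WeakClass κ I u φ (pd eX u) (pd eY u)) {ρ : ST → ℝ}
    (hρ : IsTest (slab I) ρ) :
    Integrable (waveIntegrand κ (u ∘ charMap) (φ ∘ charMap) ρ) := by
  have hρ' := hρ.comp charMap_symm_fst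
  have h := (integrable_comp charMap (integrable_cartWave hw hρ')).const_mul (1 / 4)
  refine h.congr (Eventually.of_forall fun q => ?_)
  have hc : (ρ ∘ charMap.symm) ∘ charMap = ρ := by ext q; simp
  have := cartWave_charMap κ u φ hρ'.1 q
  rw [hc] at this
  simp only [this]
  ring

/-- The vector-valued form of the weak spin equation is equivalent to the scalar one. -/
theorem weak_spin_iff_scalar (hw : WeakClass κ I u φ (pd eX u) (pd eY u)) :
    (∀ ψ : ST → V3, IsTest (slab I) ψ →
      ∫ q in slab I,
        (form κ (wedge κ (u q) (pd eY u q)) (pd eY ψ q)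
          - form κ (wedge κ (u q) (pd eX u q)) (pd eX ψ q)
          + form κ (u q) (pd eT ψ q)
          - φ q * (form κ (pd eY u q) (pd eX ψ q) - form κ (pd eX u q) (pd eY ψ q))) = 0) ↔
    ∀ ρ : ST → ℝ, IsTest (slab I) ρ → ∫ q, cartIntegrand κ u φ ρ q = 0 := by
  -- The form is diagonal with nonzero weights, so the `i`-th component of `ψ` meets only the `i`-th
  -- component of the scalar integrand, and the three components decouple.
  have key : ∀ ψ : ST → V3, IsTest (slab I) ψ →
      ∫ q in slab I,
        (form κ (wedge κ (u q) (pd eY u q)) (pd eY ψ q)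
          - form κ (wedge κ (u q) (pd eX u q)) (pd eX ψ q)
          + form κ (u q) (pd eT ψ q)
          - φ q * (form κ (pd eY u q) (pd eX ψ q) - form κ (pd eX u q) (pd eY ψ q))) =
      ∑ i, etaWeight κ i * (∫ q, cartIntegrand κ u φ (fun q => ψ q i) q) i ∧
      ∀ i, IsTest (slab I) fun q => ψ q i := by
    intro ψ hψ
    have hcomp : ∀ i, IsTest (slab I) fun q => ψ q i := fun i =>
      ⟨contDiff_pi.1 hψ.1 i, hψ.2.1.comp_left (g := fun v : V3 => v i) rfl,
        (closure_mono (s := Function.support fun q => ψ q i) (t := Function.support ψ)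
          fun q (hq : ψ q i ≠ 0) (h : ψ q = 0) => hq (by simp [h])).trans hψ.2.2⟩
    refine ⟨?_, hcomp⟩
    have hpd : ∀ e q i, pd e ψ q i = pd e (fun q => ψ q i) q := fun e q i => by
      have := fderiv_apply (hψ.1.differentiable (by simp) q) i
      simp [pd, this]
    have hint : ∀ i, Integrable fun q => cartIntegrand κ u φ (fun q => ψ q i) q := fun i =>
      integrable_cartIntegrand hw (hcomp i)
    have hint' : ∀ i j, Integrable fun q => cartIntegrand κ u φ (fun q => ψ q i) q j := fun i j =>
      (hint i).eval j
    rw [setIntegral_slab_eq hψ.2.2]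
    · have : ∀ i, (∫ q, cartIntegrand κ u φ (fun q => ψ q i) q) i =
          ∫ q, cartIntegrand κ u φ (fun q => ψ q i) q i := fun i => eval_integral (hint' i) i
      simp only [this]
      simp only [← integral_const_mul]
      rw [← integral_finsetSum _ fun i _ => (hint' i i).const_mul _]
      refine integral_congr_ae (Eventually.of_forall fun q => ?_)
      simp only [form_eq_sum, cartIntegrand, hpd, Finset.mul_sum, ← Finset.sum_sub_distrib,
        ← Finset.sum_add_distrib, Pi.add_apply, Pi.sub_apply, Pi.smul_apply, smul_eq_mul]
      exact Finset.sum_congr rfl fun i _ => by ring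
    · intro q hq
      have : ∀ e, pd e ψ q = 0 := fun e =>
        image_eq_zero_of_notMem_tsupport fun h' => hq (tsupport_pd_subset ψ e h')
      simp [this, form_eq_sum]
  refine ⟨fun h ρ hρ => ?_, fun h ψ hψ => ?_⟩
  · ext i
    have hψ : IsTest (slab I) fun q => ρ q • (Pi.single i 1 : V3) :=
      ⟨hρ.1.smul contDiff_const, hρ.2.1.smul_right, (tsupport_smul_subset_left _ _).trans hρ.2.2⟩
    have h1 := h _ hψ
    rw [(key _ hψ).1, Finset.sum_eq_single i] at h1
    · simpa [etaWeight_ne_zero] using h1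
    · intro j _ hj
      have hz : (fun q => (ρ q • (Pi.single i 1 : V3)) j) = fun _ => 0 := by
        ext q; simp [hj]
      rw [hz]
      simp [cartIntegrand, pd]
    · simp
  · rw [(key ψ hψ).1]
    refine Finset.sum_eq_zero fun i _ => ?_
    rw [h _ ((key ψ hψ).2 i)]
    simp

/-- The weak formulation in characteristic coordinates, for scalar test functions. -/
theorem isWeakSolution_iff_char (hI : IsOpen I) (hu : ContDiffOn ℝ ∞ u (offCross I))
    (hw : WeakClass κ I u φ (pd eX u) (pd eY u)) :
    IsWeakSolution κ I u φ ↔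
    (∀ ρ, IsTest (slab I) ρ → ∫ q, spinIntegrand κ (u ∘ charMap) (φ ∘ charMap) ρ q = 0) ∧
    (∀ ρ, IsTest (slab I) ρ → ∫ q, waveIntegrand κ (u ∘ charMap) (φ ∘ charMap) ρ q = 0) := by
  rw [isWeakSolution_iff_pd hI hu hw, weak_spin_iff_scalar hw]
  have hback : ∀ ρ : ST → ℝ, (ρ ∘ charMap.symm) ∘ charMap = ρ := fun ρ => by ext q; simp
  have e1 : ∀ ρ : ST → ℝ, ∫ q, cartIntegrand κ u φ ρ q = 0 ↔
      ∫ q, spinIntegrand κ (u ∘ charMap) (φ ∘ charMap) (ρ ∘ charMap) q = 0 := fun ρ => by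
    rw [← integral_comp_eq_zero_iff charMap]
    simp only [cartIntegrand_charMap]
  have e2 : ∀ ρ : ST → ℝ, IsTest (slab I) ρ → (∫ q in slab I,
        ((pd eX (pd eX ρ) q - pd eY (pd eY ρ) q) * φ q
          + 2 * ρ q * form κ (u q) (wedge κ (pd eX u q) (pd eY u q))) = 0 ↔
      ∫ q, waveIntegrand κ (u ∘ charMap) (φ ∘ charMap) (ρ ∘ charMap) q = 0) := fun ρ hρ => by
    rw [setIntegral_slab_eq hρ.2.2, ← integral_comp_eq_zero_iff charMap]
    · simp only [cartWave_charMap κ u φ hρ.1]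
      rw [integral_const_mul]
      simp
    · intro q hq
      have h1 : ∀ e e', pd e (pd e' ρ) q = 0 := fun e e' =>
        image_eq_zero_of_notMem_tsupport fun h' => hq
          (tsupport_pd_subset ρ e' (tsupport_pd_subset _ e h'))
      simp [h1, image_eq_zero_of_notMem_tsupport hq]
  refine and_congr ⟨fun h ρ hρ => ?_, fun h ρ hρ => ?_⟩ ⟨fun h ρ hρ => ?_, fun h ρ hρ => ?_⟩
  · have := (e1 _).1 (h _ (hρ.comp charMap_symm_fst))
    rwa [hback] at this
  · exact (e1 ρ).2 (h _ (hρ.comp charMap_fst))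
  · have := (e2 _ (hρ.comp charMap_symm_fst)).1 (h _ (hρ.comp charMap_symm_fst))
    rwa [hback] at this
  · exact (e2 ρ hρ).2 (h _ (hρ.comp charMap_fst))

end

/-! ### The classical equations in characteristic coordinates, and boundary terms -/

theorem pd_wedge {κ : Target} {e : ST} {f g : ST → V3} {q : ST} (hf : DifferentiableAt ℝ f q)
    (hg : DifferentiableAt ℝ g q) :
    pd e (fun q => wedge κ (f q) (g q)) q = wedge κ (pd e f q) (g q) + wedge κ (f q) (pd e g q) := by
  have h := (wedgeL κ).fderiv_of_bilinear hf hg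
  simp only [wedgeL_apply] at h
  simp only [pd, h]
  simp [wedgeL_apply, ContinuousLinearMap.precompR, ContinuousLinearMap.precompL, add_comm]

/-- `(U, P)` is a smooth classical solution off the axes, in characteristic coordinates. -/
structure CharSolution (κ : Target) (I : Set ℝ) (U : ST → V3) (P : ST → ℝ) : Prop where
  isOpen : IsOpen I
  smooth_U : ∀ q ∈ slab I ∩ offAxes, ContDiffAt ℝ ∞ U q
  smooth_P : ∀ q ∈ slab I ∩ offAxes, ContDiffAt ℝ ∞ P q
  spin : ∀ q ∈ slab I ∩ offAxes,
    pd eT U q = (2 : ℝ) • (pd eY (fluxEta κ U P) q + pd eX (fluxXi κ U P) q)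
  wave : ∀ q ∈ slab I ∩ offAxes, pd eX (pd eY P) q = waveSource κ U q

theorem contDiffAt_wedge {κ : Target} {f g : ST → V3} {q : ST} (hf : ContDiffAt ℝ ∞ f q)
    (hg : ContDiffAt ℝ ∞ g q) : ContDiffAt ℝ ∞ (fun q => wedge κ (f q) (g q)) q :=
  ((wedgeL κ).isBoundedBilinearMap.contDiff.contDiffAt).comp q (hf.prodMk hg)

theorem contDiffAt_fluxEta {κ : Target} {U : ST → V3} {P : ST → ℝ} {q : ST}
    (hU : ContDiffAt ℝ ∞ U q) (hP : ContDiffAt ℝ ∞ P q) : ContDiffAt ℝ ∞ (fluxEta κ U P) q :=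
  (contDiffAt_wedge hU (ContDiffAt.pd hU eX)).add (hP.smul (ContDiffAt.pd hU eX))

theorem contDiffAt_fluxXi {κ : Target} {U : ST → V3} {P : ST → ℝ} {q : ST}
    (hU : ContDiffAt ℝ ∞ U q) (hP : ContDiffAt ℝ ∞ P q) : ContDiffAt ℝ ∞ (fluxXi κ U P) q :=
  (contDiffAt_wedge hU (ContDiffAt.pd hU eY)).sub (hP.smul (ContDiffAt.pd hU eY))

/-- Expanding the divergence, the terms `u_η ∧ u_ξ` and `u_ξ ∧ u_η` cancel by antisymmetry and the
two terms `φ u_ξη` cancel by sign. What remains is `4 u ∧ u_ξη + 2 (φ_η u_ξ - φ_ξ u_η)`, the right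
side of the classical equation. -/
theorem CharSolution.of_classical {κ : Target} {I : Set ℝ} (hI : IsOpen I) {u : ST → V3}
    {φ : ST → ℝ} (hu : ContDiffOn ℝ ∞ u (offCross I)) (hφ : ContDiffOn ℝ ∞ φ (offCross I))
    (hc : ∀ q ∈ offCross I, SatisfiesSystemAt κ u φ q) :
    CharSolution κ I (u ∘ charMap) (φ ∘ charMap) := by
  have ho := isOpen_offCross hI
  have su : ∀ q ∈ slab I ∩ offAxes, ContDiffAt ℝ ∞ u (charMap q) := fun q hq =>
    hu.contDiffAt (ho.mem_nhds (charMap_mem_offCross.2 hq))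
  have sφ : ∀ q ∈ slab I ∩ offAxes, ContDiffAt ℝ ∞ φ (charMap q) := fun q hq =>
    hφ.contDiffAt (ho.mem_nhds (charMap_mem_offCross.2 hq))
  have sU : ∀ q ∈ slab I ∩ offAxes, ContDiffAt ℝ ∞ (u ∘ charMap) q := fun q hq =>
    (su q hq).comp q charMap.contDiff.contDiffAt
  have sP : ∀ q ∈ slab I ∩ offAxes, ContDiffAt ℝ ∞ (φ ∘ charMap) q := fun q hq =>
    (sφ q hq).comp q charMap.contDiff.contDiffAt
  refine ⟨hI, sU, sP, fun q hq => ?_, fun q hq => ?_⟩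
  · have h := (hc _ (charMap_mem_offCross.2 hq)).1
    rw [wave_charMap (su q hq)] at h
    simp only [pd_eX_charMap, pd_eY_charMap, pd_eT_charMap] at h
    rw [h]
    have dU := (sU q hq).differentiableAt (by simp)
    have dP := (sP q hq).differentiableAt (by simp)
    have dX := (ContDiffAt.pd (sU q hq) eX).differentiableAt (by simp)
    have dY := (ContDiffAt.pd (sU q hq) eY).differentiableAt (by simp)
    have e1 : pd eY (fluxEta κ (u ∘ charMap) (φ ∘ charMap)) q = _ :=
      pd_add (((contDiffAt_wedge (sU q hq) (ContDiffAt.pd (sU q hq) eX))).differentiableAt (by simp))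
        (((sP q hq).smul (ContDiffAt.pd (sU q hq) eX)).differentiableAt (by simp))
    have e2 : pd eX (fluxXi κ (u ∘ charMap) (φ ∘ charMap)) q = _ :=
      pd_sub (((contDiffAt_wedge (sU q hq) (ContDiffAt.pd (sU q hq) eY))).differentiableAt (by simp))
        (((sP q hq).smul (ContDiffAt.pd (sU q hq) eY)).differentiableAt (by simp))
    rw [e1, e2, pd_wedge dU dX, pd_wedge dU dY]
    have e3 := pd_smul (e := eY) dP dX
    have e4 := pd_smul (e := eX) dP dY
    change _ = (2 : ℝ) • (_ + pd eY (fun q => (φ ∘ charMap) q • pd eX (u ∘ charMap) q) q + (_ -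
      pd eX (fun q => (φ ∘ charMap) q • pd eY (u ∘ charMap) q) q))
    rw [e3, e4, pd_comm (sU q hq) eY eX,
      wedge_swap κ (pd eX (u ∘ charMap) q) (pd eY (u ∘ charMap) q)]
    simp only [← wedgeL_apply, map_smul, Function.comp_apply]
    module
  · have h := (hc _ (charMap_mem_offCross.2 hq)).2
    rw [wave_charMap (sφ q hq), pd_eX_charMap, pd_eY_charMap, wedge_add_sub, form_smul_right] at h
    simp only [smul_eq_mul] at h
    simp only [waveSource, Function.comp_apply]
    linarith

section

variable {E : Type*} [NormedAddCommGroup E] [NormedSpace ℝ E]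

theorem integral_sub_smul_sub_smul {μ : Measure ST} {f g h : ST → E} (hf : Integrable f μ)
    (hg : Integrable g μ) (hh : Integrable h μ) (c : ℝ) :
    ∫ q, (f q - c • g q - c • h q) ∂μ = ∫ q, f q ∂μ - c • ∫ q, g q ∂μ - c • ∫ q, h q ∂μ := by
  rw [integral_sub (f := fun q => f q - c • g q) (g := fun q => c • h q) (hf.sub (hg.smul c))
    (hh.smul c), integral_sub (g := fun q => c • g q) hf (hg.smul c), integral_smul, integral_smul]

theorem integral_add_sub {μ : Measure ST} {f g h : ST → E} (hf : Integrable f μ)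
    (hg : Integrable g μ) (hh : Integrable h μ) :
    ∫ q, (f q + g q - h q) ∂μ = ∫ q, f q ∂μ + ∫ q, g q ∂μ - ∫ q, h q ∂μ := by
  rw [integral_sub (f := fun q => f q + g q) (hf.add hg) hh, integral_add hf hg]

/-- The product of a test function on the slab with a function that is smooth off the axes is
smooth at all points off the axes. -/
theorem contDiffAt_test_smul {I : Set ℝ} {ρ : ST → ℝ} (hρ : IsTest (slab I) ρ) {F : ST → E}
    (hF : ∀ q ∈ slab I ∩ offAxes, ContDiffAt ℝ ∞ F q) {q : ST} (hq : q ∈ offAxes) :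
    ContDiffAt ℝ ∞ (fun q => ρ q • F q) q := by
  by_cases hs : q ∈ slab I
  · exact hρ.1.contDiffAt.smul (hF q ⟨hs, hq⟩)
  · have h0 : ρ =ᶠ[𝓝 q] 0 := notMem_tsupport_iff_eventuallyEq.1 fun h => hs (hρ.2.2 h)
    refine (contDiffAt_const (c := (0 : E))).congr_of_eventuallyEq ?_
    filter_upwards [h0] with y hy
    simp [hy]

theorem pd_test_eq_zero {I : Set ℝ} {ρ : ST → ℝ} (hρ : IsTest (slab I) ρ) {q : ST}
    (hs : q ∉ slab I) (e : ST) (F : ST → E) : pd e (fun q => ρ q • F q) q = 0 :=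
  image_eq_zero_of_notMem_tsupport fun h => hs <| hρ.2.2 <|
    (tsupport_smul_subset_left ρ F) (tsupport_pd_subset _ e h)

end

section

variable {κ : Target} {I : Set ℝ} {U : ST → V3} {P : ST → ℝ}

/-- The integral of the spin equation at a positive distance from the axes consists of boundary
terms. -/
theorem CharSolution.integral_spinIntegrand (h : CharSolution κ I U P) {ρ : ST → ℝ}
    (hρ : IsTest (slab I) ρ) {r : ℝ} (hr : 0 < r) :
    ∫ q in farAxes r, spinIntegrand κ U P ρ q =
      (2 : ℝ) • (∫ t, ∫ ξ in outer r,
        (ρ (t, ξ, r) • fluxEta κ U P (t, ξ, r) - ρ (t, ξ, -r) • fluxEta κ U P (t, ξ, -r))) +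
      (2 : ℝ) • (∫ t, ∫ η in outer r,
        (ρ (t, r, η) • fluxXi κ U P (t, r, η) - ρ (t, -r, η) • fluxXi κ U P (t, -r, η))) := by
  have sN : ∀ q ∈ slab I ∩ offAxes, ContDiffAt ℝ ∞ (fluxEta κ U P) q := fun q hq =>
    contDiffAt_fluxEta (h.smooth_U q hq) (h.smooth_P q hq)
  have sM : ∀ q ∈ slab I ∩ offAxes, ContDiffAt ℝ ∞ (fluxXi κ U P) q := fun q hq =>
    contDiffAt_fluxXi (h.smooth_U q hq) (h.smooth_P q hq)
  have tU : ∀ q ∈ offAxes, ContDiffAt ℝ 1 (fun q => ρ q • U q) q := fun q hq =>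
    (contDiffAt_test_smul hρ h.smooth_U hq).of_le (by simp)
  have tN : ∀ q ∈ offAxes, ContDiffAt ℝ 1 (fun q => ρ q • fluxEta κ U P q) q := fun q hq =>
    (contDiffAt_test_smul hρ sN hq).of_le (by simp)
  have tM : ∀ q ∈ offAxes, ContDiffAt ℝ 1 (fun q => ρ q • fluxXi κ U P q) q := fun q hq =>
    (contDiffAt_test_smul hρ sM hq).of_le (by simp)
  have cU : HasCompactSupport fun q => ρ q • U q := hρ.2.1.smul_right
  have cN : HasCompactSupport fun q => ρ q • fluxEta κ U P q := hρ.2.1.smul_right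
  have cM : HasCompactSupport fun q => ρ q • fluxXi κ U P q := hρ.2.1.smul_right
  have iU := integrableOn_farAxes (ContDiffAt.continuousOn_pd tU eT) (hasCompactSupport_pd cU eT) hr
  have iN := integrableOn_farAxes (ContDiffAt.continuousOn_pd tN eY) (hasCompactSupport_pd cN eY) hr
  have iM := integrableOn_farAxes (ContDiffAt.continuousOn_pd tM eX) (hasCompactSupport_pd cM eX) hr
  -- By the Leibniz rule the integrand differs from this divergence by `ρ` times the spin equation,
  -- which is zero.
  have hpt : ∀ q ∈ farAxes r, spinIntegrand κ U P ρ q =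
      pd eT (fun q => ρ q • U q) q - (2 : ℝ) • pd eY (fun q => ρ q • fluxEta κ U P q) q -
        (2 : ℝ) • pd eX (fun q => ρ q • fluxXi κ U P q) q := by
    intro q hq
    rw [mem_farAxes] at hq
    have hq' : q ∈ offAxes := ⟨abs_pos.1 (hr.trans hq.1), abs_pos.1 (hr.trans hq.2)⟩
    by_cases hs : q ∈ slab I
    · have dρ : DifferentiableAt ℝ ρ q := hρ.1.differentiable (by simp) q
      rw [pd_smul dρ ((h.smooth_U q ⟨hs, hq'⟩).differentiableAt (by simp)),
        pd_smul dρ ((sN q ⟨hs, hq'⟩).differentiableAt (by simp)),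
        pd_smul dρ ((sM q ⟨hs, hq'⟩).differentiableAt (by simp)), h.spin q ⟨hs, hq'⟩,
        spinIntegrand]
      module
    · rw [pd_test_eq_zero hρ hs, pd_test_eq_zero hρ hs, pd_test_eq_zero hρ hs]
      have h0 : ∀ e, pd e ρ q = 0 := fun e =>
        image_eq_zero_of_notMem_tsupport fun h' => hs (hρ.2.2 (tsupport_pd_subset ρ e h'))
      simp [spinIntegrand, h0]
  rw [setIntegral_congr_fun (measurableSet_farAxes r) hpt, integral_sub_smul_sub_smul iU iN iM,
    integral_farAxes_pd_eT tU cU hr, integral_farAxes_pd_eY tN cN hr,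
    integral_farAxes_pd_eX tM cM hr, zero_sub, ← smul_neg, sub_eq_add_neg, ← smul_neg]
  simp only [← integral_neg, neg_sub]

/-- The integral of the wave equation at a positive distance from the axes consists of boundary
terms. -/
theorem CharSolution.integral_waveIntegrand (h : CharSolution κ I U P) {ρ : ST → ℝ}
    (hρ : IsTest (slab I) ρ) {r : ℝ} (hr : 0 < r) :
    ∫ q in farAxes r, waveIntegrand κ U P ρ q =
      -(∫ t, ∫ ξ in outer r, (pd eX ρ (t, ξ, r) * P (t, ξ, r) - pd eX ρ (t, ξ, -r) * P (t, ξ, -r)))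
      - (∫ t, ∫ η in outer r,
        (pd eY ρ (t, r, η) * P (t, r, η) - pd eY ρ (t, -r, η) * P (t, -r, η)))
      - ∫ t, (ρ (t, r, r) * P (t, r, r) + ρ (t, -r, -r) * P (t, -r, -r)
        - ρ (t, r, -r) * P (t, r, -r) - ρ (t, -r, r) * P (t, -r, r)) := by
  have sX := fun q (hq : q ∈ offAxes) => contDiffAt_test_smul (hρ.pd eX) h.smooth_P hq
  have sY := fun q (hq : q ∈ offAxes) => contDiffAt_test_smul (hρ.pd eY) h.smooth_P hq
  have s0 := fun q (hq : q ∈ offAxes) => contDiffAt_test_smul hρ h.smooth_P hq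
  have tX : ∀ q ∈ offAxes, ContDiffAt ℝ 1 (fun q => pd eX ρ q • P q) q := fun q hq =>
    (sX q hq).of_le (by simp)
  have tY : ∀ q ∈ offAxes, ContDiffAt ℝ 1 (fun q => pd eY ρ q • P q) q := fun q hq =>
    (sY q hq).of_le (by simp)
  have t0 : ∀ q ∈ offAxes, ContDiffAt ℝ 2 (fun q => ρ q • P q) q := fun q hq =>
    (s0 q hq).of_le (by exact ENat.LEInfty.out)
  have t0' : ∀ q ∈ offAxes, ContDiffAt ℝ 1 (pd eY fun q => ρ q • P q) q := fun q hq =>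
    (ContDiffAt.pd (s0 q hq) eY).of_le (by simp)
  have cX : HasCompactSupport fun q => pd eX ρ q • P q := (hρ.pd eX).2.1.smul_right
  have cY : HasCompactSupport fun q => pd eY ρ q • P q := (hρ.pd eY).2.1.smul_right
  have c0 : HasCompactSupport fun q => ρ q • P q := hρ.2.1.smul_right
  have iX := integrableOn_farAxes (ContDiffAt.continuousOn_pd tX eY) (hasCompactSupport_pd cX eY) hr
  have iY := integrableOn_farAxes (ContDiffAt.continuousOn_pd tY eX) (hasCompactSupport_pd cY eX) hr
  have i0 := integrableOn_farAxes (ContDiffAt.continuousOn_pd t0' eX)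
    (hasCompactSupport_pd (hasCompactSupport_pd c0 eY) eX) hr
  -- Green's identity in the form `ρ_ξη P - ρ P_ξη = ∂_η(ρ_ξ P) + ∂_ξ(ρ_η P) - ∂_ξ ∂_η(ρ P)`. It
  -- leaves no derivative of `P` on the boundary, where none is controlled; the price is the corner
  -- values of `ρ P`.
  have hpt : ∀ q ∈ farAxes r, waveIntegrand κ U P ρ q =
      pd eY (fun q => pd eX ρ q • P q) q + pd eX (fun q => pd eY ρ q • P q) q -
        pd eX (pd eY fun q => ρ q • P q) q := by
    intro q hq
    rw [mem_farAxes] at hq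
    have hq' : q ∈ offAxes := ⟨abs_pos.1 (hr.trans hq.1), abs_pos.1 (hr.trans hq.2)⟩
    by_cases hs : q ∈ slab I
    · have dρ : DifferentiableAt ℝ ρ q := hρ.1.differentiable (by simp) q
      have dX : DifferentiableAt ℝ (pd eX ρ) q := (hρ.pd eX).1.differentiable (by simp) q
      have dY : DifferentiableAt ℝ (pd eY ρ) q := (hρ.pd eY).1.differentiable (by simp) q
      have hP := h.smooth_P q ⟨hs, hq'⟩
      have dP := hP.differentiableAt (by simp)
      have hnear : (pd eY fun q => ρ q • P q) =ᶠ[𝓝 q]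
          (fun q => pd eY ρ q • P q) + fun q => ρ q • pd eY P q := by
        have ho : IsOpen (slab I ∩ offAxes) := (isOpen_slab h.isOpen).inter isOpen_offAxes
        filter_upwards [ho.mem_nhds ⟨hs, hq'⟩] with y hy
        exact pd_smul (hρ.1.differentiable (by simp) y)
          ((h.smooth_P y hy).differentiableAt (by simp))
      have dPY := (ContDiffAt.pd hP eY).differentiableAt (by simp)
      rw [pd_congr hnear, pd_add (f := fun q => pd eY ρ q • P q) (g := fun q => ρ q • pd eY P q) (dY.smul dP)
        (dρ.smul dPY), pd_smul dX dP, pd_smul dY dP,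
        pd_smul dρ dPY, h.wave q ⟨hs, hq'⟩, pd_comm hρ.1.contDiffAt eY eX, waveIntegrand]
      simp only [smul_eq_mul]
      ring
    · have h1 : pd eX (pd eY fun q => ρ q • P q) q = 0 :=
        image_eq_zero_of_notMem_tsupport fun h' => hs <| hρ.2.2 <|
          (tsupport_smul_subset_left ρ P) (tsupport_pd_subset _ eY (tsupport_pd_subset _ eX h'))
      have h2 : pd eX (pd eY ρ) q = 0 := image_eq_zero_of_notMem_tsupport fun h' =>
        hs (((hρ.pd eY).pd eX).2.2 h')
      have h3 : ρ q = 0 := image_eq_zero_of_notMem_tsupport fun h' => hs (hρ.2.2 h')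
      rw [pd_test_eq_zero (hρ.pd eX) hs, pd_test_eq_zero (hρ.pd eY) hs, h1]
      simp [waveIntegrand, h2, h3]
  rw [setIntegral_congr_fun (measurableSet_farAxes r) hpt, integral_add_sub iX iY i0,
    integral_farAxes_pd_eY tX cX hr, integral_farAxes_pd_eX tY cY hr,
    integral_farAxes_pd_eX_pd_eY t0 c0 hr, ← integral_neg]
  simp only [smul_eq_mul, ← integral_neg, sub_eq_add_neg, neg_add, neg_neg]
  simp only [add_comm]

end

/-! ### Asymptotics of the field near the axis `η = 0` -/

/-- For small `s` the points of a bounded interval at distance at least `s` from the origin satisfy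
`s ≤ |ξ| ≤ s⁻¹`. There the second logarithm `log|ξ|` costs no more than `log s`, however close `ξ`
is to the corner. -/
theorem abs_log_le_of_mem {s x : ℝ} (hs : 0 < s) (hx : s ≤ x) (hx' : x ≤ s⁻¹) :
    |Real.log x| ≤ |Real.log s| := by
  have h1 := Real.log_le_log hs hx
  have h2 := Real.log_le_log (hs.trans_le hx) hx'
  rw [Real.log_inv] at h2
  rw [abs_le]
  constructor
  · linarith [neg_abs_le (Real.log s)]
  · linarith [neg_le_abs (Real.log s)]

theorem tendsto_rpow_mul_abs_log {δ : ℝ} (hδ : 0 < δ) :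
    Tendsto (fun s : ℝ => s ^ δ * |Real.log s|) (𝓝[>] 0) (𝓝 0) := by
  have h := (tendsto_log_mul_rpow_nhdsGT_zero hδ).abs
  rw [abs_zero] at h
  refine h.congr' ?_
  filter_upwards [self_mem_nhdsWithin] with s hs
  rw [abs_mul, abs_of_nonneg (Real.rpow_nonneg (le_of_lt hs) δ), mul_comm]

theorem eventually_one_le_abs_log : ∀ᶠ s : ℝ in 𝓝[>] 0, 1 ≤ |Real.log s| :=
  (tendsto_abs_atBot_atTop.comp Real.tendsto_log_nhdsGT_zero).eventually_ge_atTop 1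

theorem eventually_mem_Ioo {a : ℝ} (ha : 0 < a) : ∀ᶠ s : ℝ in 𝓝[>] 0, s ∈ Ioo 0 a :=
  Ioo_mem_nhdsGT ha

theorem eventually_le_inv (R : ℝ) : ∀ᶠ s : ℝ in 𝓝[>] 0, R ≤ s⁻¹ :=
  tendsto_inv_nhdsGT_zero.eventually_ge_atTop R

theorem Cone.sEta_eq (c : Cone) : c.sEta = 1 ∨ c.sEta = -1 := by
  cases c <;> simp [Cone.sEta]

theorem Cone.abs_sEta (c : Cone) : |c.sEta| = 1 := by
  cases c <;> simp [Cone.sEta]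

theorem Cone.sEta_mul_self (c : Cone) : c.sEta * c.sEta = 1 := by
  cases c <;> simp [Cone.sEta]

theorem Cone.abs_sXi (c : Cone) : |c.sXi| = 1 := by
  cases c <;> simp [Cone.sXi]

theorem Cone.sXi_mul_self (c : Cone) : c.sXi * c.sXi = 1 := by
  cases c <;> simp [Cone.sXi]

section

variable {I : Set ℝ} {φ : ST → ℝ} {φ₁ φ₂ : Cone → ℝ → ℝ → ℝ} {φ₃ : Cone → ℝ → ℝ → ℝ → ℝ} {δ : ℝ}

/-- On a line at distance `s` from an axis the field is `O(|log s|)`, at distance at least `s` from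
the other axis. -/
theorem LogForm.cone_bound (h : LogForm I φ φ₁ φ₂ φ₃ δ) (c : Cone) {K : Set ℝ} (hKI : K ⊆ I)
    (hK : IsCompact K) (R : ℝ) : ∃ C : ℝ, 0 ≤ C ∧ ∀ᶠ s in 𝓝[>] (0 : ℝ), ∀ t ∈ K, ∀ ξ,
      0 < c.sXi * ξ → s ≤ |ξ| → |ξ| ≤ R → |φ (charPt t ξ (c.sEta * s))| ≤ C * |Real.log s| := by
  obtain ⟨C₁, h₁⟩ := h.bdd₁ c K hKI hK R
  obtain ⟨C₂, h₂⟩ := h.bdd₂ c K hKI hK 1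
  obtain ⟨C₃, h₃⟩ := h.bdd₃ c K hKI hK (max R 1)
  refine ⟨|C₁| + |C₂| + |C₃|, by positivity, ?_⟩
  filter_upwards [eventually_one_le_abs_log, eventually_mem_Ioo one_pos, eventually_le_inv R]
    with s hs1 hs hsR t ht ξ hξ hsξ hξR
  have hη : 0 < c.sEta * (c.sEta * s) := by
    rw [← mul_assoc, c.sEta_mul_self, one_mul]; exact hs.1
  have habs : |c.sEta * s| = s := by rw [abs_mul, c.abs_sEta, one_mul, abs_of_pos hs.1]
  rw [h.form_eq c t (hKI ht) ξ _ hξ hη, habs]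
  have e1 := (h₁ t ht ξ hξ.le hξR).trans (le_abs_self C₁)
  have e2 := (h₂ t ht (c.sEta * s) hη.le (habs.trans_le hs.2.le)).trans (le_abs_self C₂)
  have e3 := (h₃ t ht ξ (c.sEta * s) hξ.le hη.le (hξR.trans (le_max_left _ _))
    (habs.trans_le (hs.2.le.trans (le_max_right _ _)))).trans (le_abs_self C₃)
  have e4 := abs_log_le_of_mem hs.1 hsξ (hξR.trans hsR)
  calc _ ≤ |φ₁ c t ξ| * |Real.log s| + |φ₂ c t (c.sEta * s)| * |Real.log (|ξ|)|
        + |φ₃ c t ξ (c.sEta * s)| := by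
        rw [← abs_mul, ← abs_mul]
        exact (abs_add_le _ _).trans (add_le_add_left (abs_add_le _ _) _)
    _ ≤ |C₁| * |Real.log s| + |C₂| * |Real.log s| + |C₃| * |Real.log s| := by
        gcongr
        exact e3.trans (le_mul_of_one_le_right (abs_nonneg _) hs1)
    _ = _ := by ring

/-- The expansion of the field on a line close to the axis `η = 0`. -/
theorem LogForm.cone_expansion (h : LogForm I φ φ₁ φ₂ φ₃ δ) (hδ : 0 < δ) (c : Cone) {K : Set ℝ}
    (hKI : K ⊆ I) (hK : IsCompact K) (R : ℝ) {e : ℝ} (he : 0 < e) :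
    ∀ᶠ s in 𝓝[>] (0 : ℝ), ∀ t ∈ K, ∀ ξ, 0 < c.sXi * ξ → s ≤ |ξ| → |ξ| ≤ R →
      |φ (charPt t ξ (c.sEta * s)) -
        (Real.log s * φ₁ c t ξ + φ₂ c t 0 * Real.log |ξ| + φ₃ c t ξ 0)| ≤ e := by
  obtain ⟨C, r, hr, hC⟩ := h.hol₂ c K hKI hK
  set Q : Set ST := K ×ˢ ({ξ | 0 ≤ c.sXi * ξ} ∩ Icc (-R) R) ×ˢ ({η | 0 ≤ c.sEta * η} ∩ Icc (-1) 1)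
  have hQ : IsCompact Q := hK.prod
    ((isCompact_Icc.inter_left (isClosed_le continuous_const (by fun_prop))).prod
      (isCompact_Icc.inter_left (isClosed_le continuous_const (by fun_prop))))
  have hQs : Q ⊆ {q | q.1 ∈ I ∧ 0 ≤ c.sXi * q.2.1 ∧ 0 ≤ c.sEta * q.2.2} :=
    fun q hq => ⟨hKI hq.1, hq.2.1.1, hq.2.2.1⟩
  have huc := hQ.uniformContinuousOn_of_continuous ((h.cont₃ c).mono hQs)
  rw [Metric.uniformContinuousOn_iff] at huc
  obtain ⟨d, hd, hd'⟩ := huc (e / 2) (half_pos he)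
  have hsmall : ∀ᶠ s in 𝓝[>] (0 : ℝ), |C| * (s ^ δ * |Real.log s|) < e / 2 := by
    have := (tendsto_rpow_mul_abs_log hδ).const_mul |C|
    rw [mul_zero] at this
    exact this.eventually_lt_const (half_pos he)
  filter_upwards [hsmall, eventually_mem_Ioo one_pos, eventually_mem_Ioo hd, eventually_mem_Ioo hr,
    eventually_le_inv R] with s hs2 hs hsd hsr hsR t ht ξ hξ hsξ hξR
  have hη : 0 < c.sEta * (c.sEta * s) := by
    rw [← mul_assoc, c.sEta_mul_self, one_mul]; exact hs.1
  have habs : |c.sEta * s| = s := by rw [abs_mul, c.abs_sEta, one_mul, abs_of_pos hs.1]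
  rw [h.form_eq c t (hKI ht) ξ _ hξ hη, habs]
  have e1 := hC t ht (c.sEta * s) hη.le (by rw [habs]; exact hsr.2.le)
  rw [habs] at e1
  have e2 : |φ₃ c t ξ (c.sEta * s) - φ₃ c t ξ 0| < e / 2 := by
    refine hd' (t, ξ, c.sEta * s) ⟨ht, ⟨hξ.le, abs_le.1 hξR⟩, hη.le,
      abs_le.1 (habs.trans_le hs.2.le)⟩ (t, ξ, 0) ⟨ht, ⟨hξ.le, abs_le.1 hξR⟩, ?_, ?_⟩ ?_
    · simp
    · simp
    · simp only [Prod.dist_eq, dist_self, Real.dist_eq, sub_zero, habs]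
      simpa [hs.1.le] using hsd.2
  have e4 := abs_log_le_of_mem hs.1 hsξ (hξR.trans hsR)
  -- The Hölder bound on `φ₂` at the origin is what pays for `log|ξ|`, which is as large as `|log
  -- s|` near the corner.
  have e5 : |φ₂ c t (c.sEta * s) - φ₂ c t 0| * |Real.log (|ξ|)| ≤
      |C| * (s ^ δ * |Real.log s|) := by
    rw [← mul_assoc]
    have : 0 ≤ s ^ δ := Real.rpow_nonneg hs.1.le δ
    exact mul_le_mul (e1.trans (mul_le_mul_of_nonneg_right (le_abs_self C) this)) e4
      (abs_nonneg _) (by positivity)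
  rw [← abs_mul] at e5
  calc _ = |(φ₂ c t (c.sEta * s) - φ₂ c t 0) * Real.log (|ξ|)
        + (φ₃ c t ξ (c.sEta * s) - φ₃ c t ξ 0)| := by congr 1; ring
    _ ≤ _ := (abs_add_le _ _).trans (by linarith)

/-- The jump of `φ₂` across the axis `η = 0`. -/
def axisJump2 (φ₂ : Cone → ℝ → ℝ → ℝ) (t ξ : ℝ) : ℝ :=
  if ξ ≤ 0 then φ₂ .vMinus t 0 - φ₂ .hMinus t 0 else φ₂ .hPlus t 0 - φ₂ .vPlus t 0

/-- The jump of `φ₃` across the axis `η = 0`. -/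
def axisJump3 (φ₃ : Cone → ℝ → ℝ → ℝ → ℝ) (t ξ : ℝ) : ℝ :=
  if ξ ≤ 0 then c3 φ₃ t ξ else -c1 φ₃ t ξ

/-- The leading part of the jump of the field between the lines `η = s` and `η = -s`. -/
def jumpCoeff (φ₁ φ₂ : Cone → ℝ → ℝ → ℝ) (φ₃ : Cone → ℝ → ℝ → ℝ → ℝ) (s t ξ : ℝ) : ℝ :=
  Real.log s * jump1 φ₁ t ξ + axisJump2 φ₂ t ξ * Real.log |ξ| + axisJump3 φ₃ t ξ

theorem LogForm.line_bound (h : LogForm I φ φ₁ φ₂ φ₃ δ) {K : Set ℝ} (hKI : K ⊆ I)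
    (hK : IsCompact K) (R : ℝ) : ∃ C : ℝ, 0 ≤ C ∧ ∀ᶠ s in 𝓝[>] (0 : ℝ), ∀ t ∈ K, ∀ ξ,
      s ≤ |ξ| → |ξ| ≤ R → |φ (charPt t ξ s)| ≤ C * |Real.log s| ∧
        |φ (charPt t ξ (-s))| ≤ C * |Real.log s| := by
  obtain ⟨C₁, p₁, h₁⟩ := h.cone_bound .hPlus hKI hK R
  obtain ⟨C₂, p₂, h₂⟩ := h.cone_bound .hMinus hKI hK R
  obtain ⟨C₃, p₃, h₃⟩ := h.cone_bound .vPlus hKI hK R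
  obtain ⟨C₄, p₄, h₄⟩ := h.cone_bound .vMinus hKI hK R
  refine ⟨C₁ + C₂ + C₃ + C₄, by positivity, ?_⟩
  filter_upwards [h₁, h₂, h₃, h₄, self_mem_nhdsWithin] with s h₁ h₂ h₃ h₄ hs t ht ξ hsξ hξR
  have hξ0 : ξ ≠ 0 := abs_pos.1 (lt_of_lt_of_le hs hsξ)
  have hl := abs_nonneg (Real.log s)
  rcases lt_or_gt_of_ne hξ0 with hξ | hξ
  · have a := h₂ t ht ξ (by simp [Cone.sXi, hξ]) hsξ hξR
    have b := h₄ t ht ξ (by simp [Cone.sXi, hξ]) hsξ hξR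
    simp only [Cone.sEta, one_mul, neg_one_mul] at a b
    exact ⟨b.trans (by gcongr; linarith), a.trans (by gcongr; linarith)⟩
  · have a := h₁ t ht ξ (by simp [Cone.sXi, hξ]) hsξ hξR
    have b := h₃ t ht ξ (by simp [Cone.sXi, hξ]) hsξ hξR
    simp only [Cone.sEta, one_mul, neg_one_mul] at a b
    exact ⟨a.trans (by gcongr; linarith), b.trans (by gcongr; linarith)⟩

/-- On each half of the axis the lines `η = s` and `η = -s` run in two neighbouring cones: `vMinus`
and `hMinus` for `ξ < 0`, `hPlus` and `vPlus` for `ξ > 0`. The expansions of the two cones are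
subtracted. -/
theorem LogForm.line_expansion (h : LogForm I φ φ₁ φ₂ φ₃ δ) (hδ : 0 < δ) {K : Set ℝ}
    (hKI : K ⊆ I) (hK : IsCompact K) (R : ℝ) {e : ℝ} (he : 0 < e) :
    ∀ᶠ s in 𝓝[>] (0 : ℝ), ∀ t ∈ K, ∀ ξ, s ≤ |ξ| → |ξ| ≤ R →
      |φ (charPt t ξ s) - φ (charPt t ξ (-s)) - jumpCoeff φ₁ φ₂ φ₃ s t ξ| ≤ e := by
  filter_upwards [h.cone_expansion hδ .hPlus hKI hK R (half_pos he),
    h.cone_expansion hδ .hMinus hKI hK R (half_pos he),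
    h.cone_expansion hδ .vPlus hKI hK R (half_pos he),
    h.cone_expansion hδ .vMinus hKI hK R (half_pos he), self_mem_nhdsWithin]
    with s h₁ h₂ h₃ h₄ hs t ht ξ hsξ hξR
  have hξ0 : ξ ≠ 0 := abs_pos.1 (lt_of_lt_of_le hs hsξ)
  rcases lt_or_gt_of_ne hξ0 with hξ | hξ
  · have a := h₂ t ht ξ (by simp [Cone.sXi, hξ]) hsξ hξR
    have b := h₄ t ht ξ (by simp [Cone.sXi, hξ]) hsξ hξR
    simp only [Cone.sEta, one_mul, neg_one_mul] at a b
    simp only [jumpCoeff, jump1, phi1Plus, phi1Minus, axisJump2, axisJump3, if_pos hξ.le, c3]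
    rw [abs_le] at a b ⊢
    constructor <;> linarith [a.1, a.2, b.1, b.2]
  · have a := h₁ t ht ξ (by simp [Cone.sXi, hξ]) hsξ hξR
    have b := h₃ t ht ξ (by simp [Cone.sXi, hξ]) hsξ hξR
    simp only [Cone.sEta, one_mul, neg_one_mul] at a b
    simp only [jumpCoeff, jump1, phi1Plus, phi1Minus, axisJump2, axisJump3, if_neg hξ.not_ge, c1]
    rw [abs_le] at a b ⊢
    constructor <;> linarith [a.1, a.2, b.1, b.2]

end

/-! ### Weights on the axis `η = 0` and the limit of boundary integrals. -/

/-- A weight `w(t, ξ, η)` that converges in `L¹_loc` to its trace on the axis `η = 0` along the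
lines `η = ±ε_n`, with a rate that is locally uniform in `t`. -/
structure LineWeight {E : Type*} [NormedAddCommGroup E] (I : Set ℝ) (δ : ℝ) (ε : ℕ → ℝ)
    (w : ℝ → ℝ → ℝ → E) : Prop where
  meas : ∀ t ∈ I, ∀ η, AEStronglyMeasurable fun ξ => w t ξ η
  conv : ∀ K ⊆ I, IsCompact K → ∀ R : ℝ, ∃ C : ℝ, 0 ≤ C ∧
    (∀ t ∈ K, ∫⁻ ξ in Ioo (-R) R, ‖w t ξ 0‖ₑ ≤ ENNReal.ofReal C) ∧
    ∀ᶠ n in atTop, ∀ t ∈ K,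
      ∫⁻ ξ in Ioo (-R) R, ‖w t ξ (ε n) - w t ξ 0‖ₑ ≤ ENNReal.ofReal (C * ε n ^ δ) ∧
      ∫⁻ ξ in Ioo (-R) R, ‖w t ξ (-ε n) - w t ξ 0‖ₑ ≤ ENNReal.ofReal (C * ε n ^ δ)
  -- Continuity is asked on the approximating lines only. The trace is merely locally integrable,
  -- and its integrals become continuous in time through the uniform limit.
  cont : ∀ n, ContinuousOn (fun q : ℝ × ℝ => w q.1 q.2 (ε n)) (I ×ˢ {0}ᶜ) ∧
    ContinuousOn (fun q : ℝ × ℝ => w q.1 q.2 (-ε n)) (I ×ˢ {0}ᶜ)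

/-- Bounds on a coefficient `g(t, ξ, η)`, uniform for `t ∈ K`, and its support in `ξ`. -/
structure LineTest (K : Set ℝ) (R G : ℝ) (g : ℝ → ℝ → ℝ → ℝ) : Prop where
  bound : ∀ t ∈ K, ∀ ξ, |g t ξ 0| ≤ G
  lip : ∀ t ∈ K, ∀ ξ η, |g t ξ η - g t ξ 0| ≤ G * |η|
  supp : ∀ t ∈ K, ∀ ξ, R ≤ |ξ| → ∀ η, g t ξ η = 0

/-- An `L¹` bound for an integral over the complement of an interval. -/
theorem norm_integral_outer_le {E F : Type*} [NormedAddCommGroup E] [NormedAddCommGroup F]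
    [NormedSpace ℝ F] {w₀ wp wm : ℝ → E} {f : ℝ → F} {R s a b D d : ℝ} (ha : 0 ≤ a) (hb : 0 ≤ b)
    (hD : 0 ≤ D) (hd : 0 ≤ d) (m0 : AEStronglyMeasurable w₀) (mp : AEStronglyMeasurable wp)
    (mm : AEStronglyMeasurable wm) (h0 : ∫⁻ ξ in Ioo (-R) R, ‖w₀ ξ‖ₑ ≤ ENNReal.ofReal D)
    (hp : ∫⁻ ξ in Ioo (-R) R, ‖wp ξ - w₀ ξ‖ₑ ≤ ENNReal.ofReal d)
    (hm : ∫⁻ ξ in Ioo (-R) R, ‖wm ξ - w₀ ξ‖ₑ ≤ ENNReal.ofReal d)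
    (hf : ∀ ξ ∈ outer s, |ξ| < R →
      ‖f ξ‖ ≤ a * ‖w₀ ξ‖ + b * (‖wp ξ - w₀ ξ‖ + ‖wm ξ - w₀ ξ‖))
    (hz : ∀ ξ, R ≤ |ξ| → f ξ = 0) : ‖∫ ξ in outer s, f ξ‖ ≤ a * D + b * (2 * d) := by
  have m0' : AEMeasurable (fun ξ => ‖w₀ ξ‖ₑ) (volume.restrict (Ioo (-R) R)) := m0.enorm.restrict
  have mp' : AEMeasurable (fun ξ => ‖wp ξ - w₀ ξ‖ₑ) (volume.restrict (Ioo (-R) R)) :=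
    (mp.sub m0).enorm.restrict
  have mm' : AEMeasurable (fun ξ => ‖wm ξ - w₀ ξ‖ₑ) (volume.restrict (Ioo (-R) R)) :=
    (mm.sub m0).enorm.restrict
  set F : ℝ → ℝ≥0∞ := fun ξ => ENNReal.ofReal a * ‖w₀ ξ‖ₑ +
    ENNReal.ofReal b * (‖wp ξ - w₀ ξ‖ₑ + ‖wm ξ - w₀ ξ‖ₑ) with hF
  have hpt : ∀ ξ ∈ outer s, ‖f ξ‖ₑ ≤ (Ioo (-R) R).indicator F ξ := by
    intro ξ hξ
    by_cases hξR : |ξ| < R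
    · rw [indicator_of_mem (show ξ ∈ Ioo (-R) R from abs_lt.1 hξR), ← ofReal_norm]
      refine (ENNReal.ofReal_le_ofReal (hf ξ hξ hξR)).trans (le_of_eq ?_)
      rw [ENNReal.ofReal_add (mul_nonneg ha (norm_nonneg _)) (by positivity),
        ENNReal.ofReal_mul ha, ENNReal.ofReal_mul hb,
        ENNReal.ofReal_add (norm_nonneg _) (norm_nonneg _)]
      simp only [hF, ofReal_norm]
    · simp [hz ξ (not_lt.1 hξR)]
  have hle : ∫⁻ ξ in outer s, ‖f ξ‖ₑ ≤ ENNReal.ofReal (a * D + b * (2 * d)) := by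
    calc _ ≤ ∫⁻ ξ in outer s, (Ioo (-R) R).indicator F ξ :=
          setLIntegral_mono' (measurableSet_outer s) hpt
      _ ≤ ∫⁻ ξ, (Ioo (-R) R).indicator F ξ := setLIntegral_le_lintegral _ _
      _ = ∫⁻ ξ in Ioo (-R) R, F ξ := lintegral_indicator measurableSet_Ioo _
      _ = ENNReal.ofReal a * (∫⁻ ξ in Ioo (-R) R, ‖w₀ ξ‖ₑ) +
          ENNReal.ofReal b * ((∫⁻ ξ in Ioo (-R) R, ‖wp ξ - w₀ ξ‖ₑ) +
            ∫⁻ ξ in Ioo (-R) R, ‖wm ξ - w₀ ξ‖ₑ) := by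
          rw [hF, lintegral_add_left' (m0'.const_mul _), lintegral_const_mul'' _ m0',
            lintegral_const_mul'' (f := fun ξ => ‖wp ξ - w₀ ξ‖ₑ + ‖wm ξ - w₀ ξ‖ₑ)
              _ (mp'.add mm'), lintegral_add_left' mp']
      _ ≤ ENNReal.ofReal a * ENNReal.ofReal D +
          ENNReal.ofReal b * (ENNReal.ofReal d + ENNReal.ofReal d) := by gcongr
      _ = _ := by
          rw [← ENNReal.ofReal_add hd hd, ← ENNReal.ofReal_mul ha,
            ← ENNReal.ofReal_mul hb, ← ENNReal.ofReal_add (by positivity) (by positivity), two_mul]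
  have hfin := (enorm_integral_le_lintegral_enorm f).trans hle
  rw [← ofReal_norm] at hfin
  exact (ENNReal.ofReal_le_ofReal_iff (by positivity)).1 hfin

/-- Boundary integrals along the axis `η = 0` converge, uniformly in time. -/
theorem LogForm.tendsto_line {E : Type*} [NormedAddCommGroup E] [NormedSpace ℝ E]
    {I : Set ℝ} {φ : ST → ℝ} {φ₁ φ₂ : Cone → ℝ → ℝ → ℝ} {φ₃ : Cone → ℝ → ℝ → ℝ → ℝ} {δ : ℝ}
    (h : LogForm I φ φ₁ φ₂ φ₃ δ) (hδ : 0 < δ) {ε : ℕ → ℝ} (hε : Tendsto ε atTop (𝓝[>] 0))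
    {w : ℝ → ℝ → ℝ → E} (hw : LineWeight I δ ε w) {K : Set ℝ} (hKI : K ⊆ I) (hK : IsCompact K)
    {R G : ℝ} {g : ℝ → ℝ → ℝ → ℝ} (hg : LineTest K R G g) :
    TendstoUniformlyOn (fun n t => ∫ ξ in outer (ε n),
      ((g t ξ (ε n) * φ (charPt t ξ (ε n))) • w t ξ (ε n)
        - (g t ξ (-ε n) * φ (charPt t ξ (-ε n))) • w t ξ (-ε n)
        - (g t ξ 0 * jumpCoeff φ₁ φ₂ φ₃ (ε n) t ξ) • w t ξ 0)) 0 atTop K := by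
  obtain ⟨C, hC, hφb⟩ := h.line_bound hKI hK R
  obtain ⟨D, hD, hw0, hw1⟩ := hw.conv K hKI hK R
  rcases K.eq_empty_or_nonempty with rfl | ⟨t₀, ht₀⟩
  · exact tendstoUniformlyOn_empty
  have hG : 0 ≤ G := (abs_nonneg _).trans (hg.bound t₀ ht₀ 0)
  rw [Metric.tendstoUniformlyOn_iff]
  intro e he
  -- The error `e'` of the field expansion enters with factor `G` and the `L¹` bound `D` of the
  -- trace, so it contributes at most `e / 2`; the `+ 1` keeps the denominator positive.
  set e' : ℝ := e / (2 * (G * D + 1)) with he'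
  have he'0 : 0 < e' := by positivity
  have hGe : G * e' * D ≤ e / 2 := by
    have : e' * (2 * (G * D + 1)) = e := by rw [he']; field_simp
    nlinarith [he'0]
  have hφe := h.line_expansion hδ hKI hK R he'0
  -- `A` is the cost of moving the coefficient `g` from the two lines to the axis, at most `G s`
  -- each against `|φ| ≤ C |log s|`. `B` is the factor in front of the `L¹` distance of the weight
  -- from its trace, where `G s + G` bounds `g` on the lines.
  set A : ℝ → ℝ := fun s => 2 * (C * |Real.log s| * (G * s))
  set B : ℝ → ℝ := fun s => C * |Real.log s| * (G * s + G)
  have hlim : Tendsto (fun s => A s * D + B s * (2 * (D * s ^ δ))) (𝓝[>] 0) (𝓝 0) := by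
    have l1 := tendsto_rpow_mul_abs_log one_pos
    have l2 := tendsto_rpow_mul_abs_log hδ
    have l3 : Tendsto (fun s : ℝ => s) (𝓝[>] 0) (𝓝 0) := tendsto_nhdsWithin_of_tendsto_nhds tendsto_id
    have := (l1.const_mul (2 * C * G * D)).add
      (((l3.const_mul G).add_const G).mul (l2.const_mul (2 * C * D)))
    simp only [mul_zero, add_zero] at this
    refine this.congr fun s => ?_
    simp only [A, B, Real.rpow_one]
    ring
  filter_upwards [hε.eventually hφb, hε.eventually hφe, hw1,
    hε.eventually (hlim.eventually_lt_const (half_pos he)), hε.eventually self_mem_nhdsWithin]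
    with n hb hx hw1 hl hs t ht
  set s := ε n with hsdef
  have hs0 : 0 < s := hs
  have hA : 0 ≤ A s := by positivity
  have hB : 0 ≤ B s := by positivity
  obtain ⟨hw1p, hw1m⟩ := hw1 t ht
  have hDs : 0 ≤ D * s ^ δ := mul_nonneg hD (Real.rpow_nonneg hs0.le δ)
  simp only [Pi.zero_apply, dist_zero_left]
  refine lt_of_le_of_lt (norm_integral_outer_le (a := A s + G * e') (b := B s) (by positivity) hB hD
    hDs (hw.meas t (hKI ht) 0) (hw.meas t (hKI ht) s) (hw.meas t (hKI ht) (-s)) (hw0 t ht) hw1p hw1m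
    (fun ξ hξ hξR => ?_) fun ξ hξ => by simp [hg.supp t ht ξ hξ]) (by linarith)
  obtain ⟨b1, b2⟩ := hb t ht ξ (le_of_lt hξ) hξR.le
  have b3 := hx t ht ξ (le_of_lt hξ) hξR.le
  have g0 := hg.bound t ht ξ
  have g1 := hg.lip t ht ξ s
  have g2 := hg.lip t ht ξ (-s)
  rw [abs_neg] at g2
  rw [abs_of_pos hs0] at g1 g2
  -- On each line `g` and `w` are moved to the axis while the value of `φ` is kept. Only afterwards
  -- are the two values of `φ` subtracted, so that the jump expansion multiplies the trace alone.
  have aux : ∀ {a f : ℝ} {v : E}, |f| ≤ C * |Real.log s| → |a - g t ξ 0| ≤ G * s →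
      ‖(a * f) • v - (g t ξ 0 * f) • w t ξ 0‖ ≤
        C * |Real.log s| * (G * s) * ‖w t ξ 0‖ + B s * ‖v - w t ξ 0‖ := by
    intro a f v hf ha
    have : (a * f) • v - (g t ξ 0 * f) • w t ξ 0 =
        f • ((a - g t ξ 0) • w t ξ 0 + a • (v - w t ξ 0)) := by module
    rw [this, norm_smul, Real.norm_eq_abs]
    have ha' : |a| ≤ G * s + G := by
      have := abs_add_le (a - g t ξ 0) (g t ξ 0)
      rw [sub_add_cancel] at this
      linarith
    calc |f| * ‖(a - g t ξ 0) • w t ξ 0 + a • (v - w t ξ 0)‖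
        ≤ C * |Real.log s| * (G * s * ‖w t ξ 0‖ + (G * s + G) * ‖v - w t ξ 0‖) := by
          refine mul_le_mul hf ((norm_add_le _ _).trans ?_) (norm_nonneg _) (by positivity)
          rw [norm_smul, norm_smul, Real.norm_eq_abs, Real.norm_eq_abs]
          gcongr
      _ = _ := by simp only [B]; ring
  have key : ‖(g t ξ s * φ (charPt t ξ s)) • w t ξ s
      - (g t ξ (-s) * φ (charPt t ξ (-s))) • w t ξ (-s)
      - (g t ξ 0 * jumpCoeff φ₁ φ₂ φ₃ s t ξ) • w t ξ 0‖ ≤ (A s + G * e') * ‖w t ξ 0‖ +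
      B s * (‖w t ξ s - w t ξ 0‖ + ‖w t ξ (-s) - w t ξ 0‖) := by
    have e1 := aux (v := w t ξ s) b1 g1
    have e2 := aux (v := w t ξ (-s)) b2 g2
    have e3 : ‖(g t ξ 0 * (φ (charPt t ξ s) - φ (charPt t ξ (-s))
        - jumpCoeff φ₁ φ₂ φ₃ s t ξ)) • w t ξ 0‖ ≤ G * e' * ‖w t ξ 0‖ := by
      rw [norm_smul, Real.norm_eq_abs, abs_mul]
      gcongr
    have : (g t ξ s * φ (charPt t ξ s)) • w t ξ s
      - (g t ξ (-s) * φ (charPt t ξ (-s))) • w t ξ (-s)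
      - (g t ξ 0 * jumpCoeff φ₁ φ₂ φ₃ s t ξ) • w t ξ 0 =
      (((g t ξ s * φ (charPt t ξ s)) • w t ξ s - (g t ξ 0 * φ (charPt t ξ s)) • w t ξ 0)
      - ((g t ξ (-s) * φ (charPt t ξ (-s))) • w t ξ (-s)
        - (g t ξ 0 * φ (charPt t ξ (-s))) • w t ξ 0))
      + (g t ξ 0 * (φ (charPt t ξ s) - φ (charPt t ξ (-s))
        - jumpCoeff φ₁ φ₂ φ₃ s t ξ)) • w t ξ 0 := by module
    rw [this]
    refine (norm_add_le _ _).trans ((add_le_add (norm_sub_le _ _) le_rfl).trans ?_)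
    simp only [A]
    linarith
  exact key

/-! ### The reflection that exchanges the two axes -/

/-- The reflection `y ↦ -y`, which exchanges `ξ` and `η`. -/
def reflectY (q : ST) : ST := (q.1, q.2.1, -q.2.2)

theorem reflectY_charPt (t ξ η : ℝ) : reflectY (charPt t ξ η) = charPt t η ξ := by
  simp only [reflectY, charPt]
  ring_nf

theorem contDiff_reflectY : ContDiff ℝ ∞ reflectY := by unfold reflectY; fun_prop

theorem reflectY_mem_offCross {I : Set ℝ} {q : ST} (hq : q ∈ offCross I) :
    reflectY q ∈ offCross I := ⟨hq.1, by simpa [reflectY] using hq.2⟩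

/-- The cone that corresponds to `c` under the reflection. -/
def Cone.swap : Cone → Cone
  | .hPlus => .hPlus
  | .hMinus => .hMinus
  | .vPlus => .vMinus
  | .vMinus => .vPlus

theorem Cone.sXi_swap (c : Cone) : c.swap.sXi = c.sEta := by cases c <;> rfl

theorem Cone.sEta_swap (c : Cone) : c.swap.sEta = c.sXi := by cases c <;> rfl

theorem Cone.swap_swap (c : Cone) : c.swap.swap = c := by cases c <;> rfl

/-- The reflected coefficients of one logarithm. -/
def swapCoeff (a : Cone → ℝ → ℝ → ℝ) (c : Cone) (t z : ℝ) : ℝ := -a c.swap t z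

/-- The reflected regular part. -/
def swapCoeff₃ (a : Cone → ℝ → ℝ → ℝ → ℝ) (c : Cone) (t ξ η : ℝ) : ℝ := -a c.swap t η ξ

theorem charPt_mem_offCross {I : Set ℝ} {t ξ η : ℝ} (ht : t ∈ I) (hξ : ξ ≠ 0) (hη : η ≠ 0) :
    charPt t ξ η ∈ offCross I :=
  charMap_mem_offCross.2 (show ((t, ξ, η) : ST) ∈ slab I ∩ offAxes from ⟨ht, hξ, hη⟩)

/-- A field that is continuous off the cross and has the logarithmic form. -/
structure FieldData (I : Set ℝ) (φ : ST → ℝ) (φ₁ φ₂ : Cone → ℝ → ℝ → ℝ)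
    (φ₃ : Cone → ℝ → ℝ → ℝ → ℝ) (δ : ℝ) : Prop where
  isOpen : IsOpen I
  pos : 0 < δ
  log : LogForm I φ φ₁ φ₂ φ₃ δ
  cont : ContinuousOn φ (offCross I)

section

variable {I : Set ℝ} {φ : ST → ℝ} {φ₁ φ₂ : Cone → ℝ → ℝ → ℝ} {φ₃ : Cone → ℝ → ℝ → ℝ → ℝ} {δ : ℝ}

/-- Exchanging `ξ` and `η` turns `fluxXi` for `φ` into `fluxEta` for `-φ`, hence the sign. It also
exchanges the two logarithms, and with them `φ₁` and `φ₂`. Every result along `η = 0` thus transfers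
to `ξ = 0`. -/
theorem LogForm.swap (h : LogForm I φ φ₁ φ₂ φ₃ δ) :
    LogForm I (fun q => -φ (reflectY q)) (swapCoeff φ₂) (swapCoeff φ₁) (swapCoeff₃ φ₃) δ where
  form_eq c t ht ξ η hξ hη := by
    rw [reflectY_charPt, h.form_eq c.swap t ht η ξ (by rwa [c.sXi_swap]) (by rwa [c.sEta_swap])]
    simp only [swapCoeff, swapCoeff₃]
    ring
  bdd₁ c K hKI hK R := by
    obtain ⟨C, hC⟩ := h.bdd₂ c.swap K hKI hK R
    refine ⟨C, fun t ht ξ hξ hR => ?_⟩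
    rw [swapCoeff, abs_neg]
    exact hC t ht ξ (by rwa [c.sEta_swap]) hR
  bdd₂ c K hKI hK R := by
    obtain ⟨C, hC⟩ := h.bdd₁ c.swap K hKI hK R
    refine ⟨C, fun t ht ξ hξ hR => ?_⟩
    rw [swapCoeff, abs_neg]
    exact hC t ht ξ (by rwa [c.sXi_swap]) hR
  bdd₃ c K hKI hK R := by
    obtain ⟨C, hC⟩ := h.bdd₃ c.swap K hKI hK R
    refine ⟨C, fun t ht ξ η hξ hη hR hR' => ?_⟩
    rw [swapCoeff₃, abs_neg]
    exact hC t ht η ξ (by rwa [c.sXi_swap]) (by rwa [c.sEta_swap]) hR' hR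
  cont₃ c := by
    refine ((h.cont₃ c.swap).comp (f := fun q : ST => ((q.1, q.2.2, q.2.1) : ST)) (by fun_prop)
      fun q hq => ?_).neg
    refine ⟨hq.1, ?_, ?_⟩
    · rw [c.sXi_swap]; exact hq.2.2
    · rw [c.sEta_swap]; exact hq.2.1
  hol₁ c K hKI hK := by
    obtain ⟨C, r, hr, hC⟩ := h.hol₂ c.swap K hKI hK
    refine ⟨C, r, hr, fun t ht ξ hξ hR => ?_⟩
    rw [swapCoeff, swapCoeff, ← neg_sub', abs_neg]
    exact hC t ht ξ (by rwa [c.sEta_swap]) hR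
  hol₂ c K hKI hK := by
    obtain ⟨C, r, hr, hC⟩ := h.hol₁ c.swap K hKI hK
    refine ⟨C, r, hr, fun t ht ξ hξ hR => ?_⟩
    rw [swapCoeff, swapCoeff, ← neg_sub', abs_neg]
    exact hC t ht ξ (by rwa [c.sXi_swap]) hR

theorem FieldData.swap (h : FieldData I φ φ₁ φ₂ φ₃ δ) :
    FieldData I (fun q => -φ (reflectY q)) (swapCoeff φ₂) (swapCoeff φ₁) (swapCoeff₃ φ₃) δ :=
  ⟨h.isOpen, h.pos, h.log.swap, (h.cont.comp contDiff_reflectY.continuous.continuousOn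
    fun _ hq => reflectY_mem_offCross hq).neg⟩

theorem jump1_swap (t ξ : ℝ) : jump1 (swapCoeff φ₂) t ξ = -jump2 φ₂ t ξ := by
  simp only [jump1, jump2, phi1Plus, phi1Minus, phi2Plus, phi2Minus, swapCoeff, Cone.swap]
  split_ifs <;> ring

/-- The cyclic orientation of `c₁, …, c₄` around the corner absorbs the sign of `-φ`, whereas `[φ₁]`
turns into `-[φ₂]`. -/
theorem c1_swap (t ξ : ℝ) : c1 (swapCoeff₃ φ₃) t ξ = c4 φ₃ t ξ := by
  simp only [c1, c4, swapCoeff₃, Cone.swap]; ring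

theorem c3_swap (t ξ : ℝ) : c3 (swapCoeff₃ φ₃) t ξ = c2 φ₃ t ξ := by
  simp only [c3, c2, swapCoeff₃, Cone.swap]; ring

/-! ### Continuity of the coefficients -/

/-- The coefficient of a logarithm is jointly continuous in time and position, up to the corner. -/
theorem FieldData.continuousOn_coeff₁ (h : FieldData I φ φ₁ φ₂ φ₃ δ) (c : Cone) :
    ContinuousOn (fun q : ℝ × ℝ => φ₁ c q.1 q.2) (I ×ˢ {ξ | 0 ≤ c.sXi * ξ}) := by
  have hloc : ∀ K ⊆ I, IsCompact K → ∀ R : ℝ, ContinuousOn (fun q : ℝ × ℝ => φ₁ c q.1 q.2)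
      (K ×ˢ ({ξ | 0 ≤ c.sXi * ξ} ∩ Icc (-R) R)) := by
    intro K hKI hK R
    obtain ⟨C₂, h₂⟩ := h.log.bdd₂ c K hKI hK 1
    obtain ⟨C₃, h₃⟩ := h.log.bdd₃ c K hKI hK (max R 1)
    obtain ⟨C, r, hr, hC⟩ := h.log.hol₁ c K hKI hK
    -- The point `ξ` is pushed along its half line to distance at least `s` from the corner, so that
    -- `φ` is evaluated off the cross even when `ξ = 0`.
    set m : ℝ → ℝ → ℝ := fun s ξ => c.sXi * max (c.sXi * ξ) s with hm
    -- With `|η| = exp(-1/s)` one has `log|η| = -1/s`, and the factor `-s` normalises the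
    -- coefficient of `φ₁` to one. The exponential choice makes `log|η|` dominate `log|ξ|` even at
    -- `|ξ| = s`: the other two terms become `O(s |log s|)` and `O(s)`.
    set F : ℝ → ℝ × ℝ → ℝ := fun s q =>
      φ (charPt q.1 (m s q.2) (c.sEta * Real.exp (-s⁻¹))) * (-s) with hF
    have hcone : ∀ s ξ, c.sXi * m s ξ = max (c.sXi * ξ) s := fun s ξ => by
      rw [hm, ← mul_assoc, c.sXi_mul_self, one_mul]
    have hlim : TendstoUniformlyOn F (fun q : ℝ × ℝ => φ₁ c q.1 q.2) (𝓝[>] 0)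
        (K ×ˢ ({ξ | 0 ≤ c.sXi * ξ} ∩ Icc (-R) R)) := by
      rw [Metric.tendstoUniformlyOn_iff]
      intro e he
      have hl : Tendsto (fun s : ℝ => 2 * |C| * s ^ δ + |C₂| * (s ^ (1 : ℝ) * |Real.log s|)
          + |C₃| * s) (𝓝[>] 0) (𝓝 0) := by
        have l0 : Tendsto (fun s : ℝ => s ^ δ) (𝓝[>] 0) (𝓝 0) := by
          have := (Real.continuousAt_rpow_const (0 : ℝ) δ (Or.inr h.pos.le)).tendsto
          rw [Real.zero_rpow h.pos.ne'] at this
          exact this.mono_left nhdsWithin_le_nhds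
        have l1 := tendsto_rpow_mul_abs_log one_pos
        have l3 : Tendsto (fun s : ℝ => s) (𝓝[>] 0) (𝓝 0) :=
          tendsto_nhdsWithin_of_tendsto_nhds tendsto_id
        have := ((l0.const_mul (2 * |C|)).add (l1.const_mul |C₂|)).add (l3.const_mul |C₃|)
        simpa using this
      filter_upwards [hl.eventually_lt_const he, eventually_mem_Ioo one_pos,
        eventually_mem_Ioo hr, eventually_le_inv (max R 1)] with s hse hs hsr hsR q hq
      obtain ⟨ht, hξ, hξR⟩ := hq
      have hξR' : |q.2| ≤ R := abs_le.2 hξR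
      have hσ : |c.sXi * q.2| = |q.2| := by rw [abs_mul, c.abs_sXi, one_mul]
      have hξ' : c.sXi * q.2 = |q.2| := by rw [← hσ, abs_of_nonneg hξ]
      set η : ℝ := c.sEta * Real.exp (-s⁻¹) with hη
      have hηp : 0 < c.sEta * η := by
        rw [hη, ← mul_assoc, c.sEta_mul_self, one_mul]; exact Real.exp_pos _
      have hηa : |η| = Real.exp (-s⁻¹) := by
        rw [hη, abs_mul, c.abs_sEta, one_mul, abs_of_pos (Real.exp_pos _)]
      have hη1 : |η| ≤ 1 := by
        rw [hηa]; exact Real.exp_le_one_iff.2 (neg_nonpos.2 (inv_nonneg.2 hs.1.le))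
      have hmp : 0 < c.sXi * m s q.2 := by rw [hcone]; exact lt_max_of_lt_right hs.1
      have hma : |m s q.2| = max |q.2| s := by
        rw [hm]
        simp only [hξ', abs_mul, c.abs_sXi, one_mul]
        exact abs_of_nonneg (le_max_of_le_left (abs_nonneg _))
      have hmR : |m s q.2| ≤ max R 1 := by
        rw [hma]; exact max_le_max hξR' hs.2.le
      have hlogη : Real.log |η| = -s⁻¹ := by rw [hηa, Real.log_exp]
      -- Either `ξ` has not moved, or both `ξ` and its new position lie within `s` of the corner. In
      -- the second case the Hölder bound is used at both points, hence the factor `2`.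
      have e1 : |φ₁ c q.1 (m s q.2) - φ₁ c q.1 q.2| ≤ 2 * |C| * s ^ δ := by
        rcases le_or_gt s |q.2| with hsq | hsq
        · have : m s q.2 = q.2 := by
            rw [hm]
            simp only [hξ', max_eq_left hsq]
            rw [← hξ', ← mul_assoc, c.sXi_mul_self, one_mul]
          rw [this]
          have : 0 ≤ s ^ δ := Real.rpow_nonneg hs.1.le δ
          simp only [sub_self, abs_zero]
          positivity
        · have a1 := hC q.1 ht (m s q.2) hmp.le (by rw [hma, max_eq_right hsq.le]; exact hsr.2.le)
          have a2 := hC q.1 ht q.2 hξ (hsq.le.trans hsr.2.le)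
          rw [hma, max_eq_right hsq.le] at a1
          have b1 : C * s ^ δ ≤ |C| * s ^ δ :=
            mul_le_mul_of_nonneg_right (le_abs_self C) (Real.rpow_nonneg hs.1.le δ)
          have b2 : C * |q.2| ^ δ ≤ |C| * s ^ δ :=
            mul_le_mul (le_abs_self C) (Real.rpow_le_rpow (abs_nonneg _) hsq.le h.pos.le)
              (Real.rpow_nonneg (abs_nonneg _) δ) (abs_nonneg C)
          rw [abs_le] at a1 a2 ⊢
          constructor <;> linarith [a1.1, a1.2, a2.1, a2.2]
      have e2 := (h₂ q.1 ht η hηp.le hη1).trans (le_abs_self C₂)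
      have e3 := (h₃ q.1 ht (m s q.2) η hmp.le hηp.le hmR (hη1.trans (le_max_right _ _))).trans
        (le_abs_self C₃)
      have e4 : |Real.log (|m s q.2|)| ≤ |Real.log s| :=
        abs_log_le_of_mem hs.1 (by rw [hma]; exact le_max_right _ _) (hmR.trans hsR)
      have heq : F s q - φ₁ c q.1 q.2 = (φ₁ c q.1 (m s q.2) - φ₁ c q.1 q.2)
          - s * (φ₂ c q.1 η * Real.log (|m s q.2|)) - s * φ₃ c q.1 (m s q.2) η := by
        simp only [hF]
        rw [h.log.form_eq c q.1 (hKI ht) _ _ hmp hηp, hlogη]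
        field_simp [hs.1.ne']
        ring
      rw [dist_comm, Real.dist_eq, heq]
      have e5 : |s * (φ₂ c q.1 η * Real.log (|m s q.2|))| ≤ |C₂| * (s ^ (1 : ℝ) * |Real.log s|) := by
        rw [abs_mul, abs_mul, abs_of_pos hs.1, Real.rpow_one]
        calc s * (|φ₂ c q.1 η| * |Real.log (|m s q.2|)|) ≤ s * (|C₂| * |Real.log s|) := by
              have := hs.1.le
              gcongr
          _ = _ := by ring
      have e6 : |s * φ₃ c q.1 (m s q.2) η| ≤ |C₃| * s := by
        rw [abs_mul, abs_of_pos hs.1, mul_comm]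
        exact mul_le_mul_of_nonneg_right e3 hs.1.le
      refine ((abs_sub _ _).trans (add_le_add (abs_sub _ _) le_rfl)).trans_lt ?_
      linarith
    -- `φ₁` is a uniform limit of continuous functions, because `φ` is continuous off the cross.
    refine hlim.continuousOn (Eventually.frequently ?_)
    filter_upwards [self_mem_nhdsWithin] with s hs
    refine (h.cont.comp ?_ ?_).mul_const _
    · refine Continuous.continuousOn ?_
      unfold charPt
      fun_prop
    · intro q hq
      have hmp : 0 < c.sXi * m s q.2 := by rw [hcone]; exact lt_max_of_lt_right hs
      refine charPt_mem_offCross (hKI hq.1) (right_ne_zero_of_mul hmp.ne') ?_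
      have : c.sEta ≠ 0 := by rcases c.sEta_eq with h | h <;> rw [h] <;> norm_num
      exact mul_ne_zero this (Real.exp_pos _).ne'
  rintro ⟨t, ξ⟩ ⟨ht, hξ⟩
  obtain ⟨K, hK, htK, hKI⟩ := exists_compact_subset h.isOpen ht
  refine (hloc K hKI hK (|ξ| + 1) (t, ξ) ⟨interior_subset htK, hξ, ?_⟩).mono_of_mem_nhdsWithin ?_
  · exact abs_le.1 (by linarith)
  · have h1 : K ×ˢ Icc (-(|ξ| + 1)) (|ξ| + 1) ∈ 𝓝 (t, ξ) :=
      prod_mem_nhds (mem_interior_iff_mem_nhds.1 htK)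
        (Icc_mem_nhds (by linarith [neg_abs_le ξ]) (by linarith [le_abs_self ξ]))
    filter_upwards [self_mem_nhdsWithin, mem_nhdsWithin_of_mem_nhds h1] with q hq hq'
    exact ⟨hq'.1, hq.2, hq'.2⟩

theorem FieldData.continuousOn_coeff₂ (h : FieldData I φ φ₁ φ₂ φ₃ δ) (c : Cone) :
    ContinuousOn (fun q : ℝ × ℝ => φ₂ c q.1 q.2) (I ×ˢ {η | 0 ≤ c.sEta * η}) := by
  have := (h.swap.continuousOn_coeff₁ c.swap).neg
  rw [Cone.sXi_swap] at this
  exact this.congr fun q _ => by simp [swapCoeff, Cone.swap_swap]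

theorem continuousOn_of_half_lines {I : Set ℝ} {f fp fm : ℝ × ℝ → ℝ}
    (hp : ContinuousOn fp (I ×ˢ Ioi 0)) (hm : ContinuousOn fm (I ×ˢ Iio 0))
    (hfp : ∀ q, 0 < q.2 → f q = fp q) (hfm : ∀ q, q.2 < 0 → f q = fm q) :
    ContinuousOn f (I ×ˢ {0}ᶜ) := by
  rintro ⟨t, ξ⟩ ⟨ht, hξ⟩
  rcases lt_or_gt_of_ne (show ξ ≠ 0 from hξ) with h | h
  · have hn : univ ×ˢ Iio (0 : ℝ) ∈ 𝓝 (t, ξ) := prod_mem_nhds univ_mem (Iio_mem_nhds h)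
    refine (((hm.congr fun q hq => hfm q hq.2) (t, ξ) ⟨ht, h⟩)).mono_of_mem_nhdsWithin ?_
    filter_upwards [self_mem_nhdsWithin, mem_nhdsWithin_of_mem_nhds hn] with q hq hq'
    exact ⟨hq.1, hq'.2⟩
  · have hn : univ ×ˢ Ioi (0 : ℝ) ∈ 𝓝 (t, ξ) := prod_mem_nhds univ_mem (Ioi_mem_nhds h)
    refine (((hp.congr fun q hq => hfp q hq.2) (t, ξ) ⟨ht, h⟩)).mono_of_mem_nhdsWithin ?_
    filter_upwards [self_mem_nhdsWithin, mem_nhdsWithin_of_mem_nhds hn] with q hq hq'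
    exact ⟨hq.1, hq'.2⟩

theorem FieldData.continuousOn_jump1 (h : FieldData I φ φ₁ φ₂ φ₃ δ) :
    ContinuousOn (fun q : ℝ × ℝ => jump1 φ₁ q.1 q.2) (I ×ˢ {0}ᶜ) := by
  refine continuousOn_of_half_lines
    (fp := fun q => φ₁ .hPlus q.1 q.2 - φ₁ .vPlus q.1 q.2)
    (fm := fun q => φ₁ .vMinus q.1 q.2 - φ₁ .hMinus q.1 q.2) ?_ ?_ ?_ ?_
  · exact ((h.continuousOn_coeff₁ .hPlus).mono (prod_mono_right fun x hx => by
      simpa [Cone.sXi] using le_of_lt hx)).sub ((h.continuousOn_coeff₁ .vPlus).mono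
      (prod_mono_right fun x hx => by simpa [Cone.sXi] using le_of_lt hx))
  · exact ((h.continuousOn_coeff₁ .vMinus).mono (prod_mono_right fun x hx => by
      simpa [Cone.sXi] using le_of_lt hx)).sub ((h.continuousOn_coeff₁ .hMinus).mono
      (prod_mono_right fun x hx => by simpa [Cone.sXi] using le_of_lt hx))
  · intro q hq
    simp [jump1, phi1Plus, phi1Minus, hq.not_ge]
  · intro q hq
    simp [jump1, phi1Plus, phi1Minus, hq.le]

theorem FieldData.continuousOn_coeff₂_zero (h : FieldData I φ φ₁ φ₂ φ₃ δ) (c : Cone)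
    (S : Set ℝ) : ContinuousOn (fun q : ℝ × ℝ => φ₂ c q.1 0) (I ×ˢ S) :=
  (h.continuousOn_coeff₂ c).comp (f := fun q : ℝ × ℝ => ((q.1, 0) : ℝ × ℝ)) (by fun_prop)
    fun q hq => ⟨hq.1, by simp⟩

theorem FieldData.continuousOn_axisJump2 (h : FieldData I φ φ₁ φ₂ φ₃ δ) :
    ContinuousOn (fun q : ℝ × ℝ => axisJump2 φ₂ q.1 q.2) (I ×ˢ {0}ᶜ) := by
  refine continuousOn_of_half_lines
    ((h.continuousOn_coeff₂_zero .hPlus _).sub (h.continuousOn_coeff₂_zero .vPlus _))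
    ((h.continuousOn_coeff₂_zero .vMinus _).sub (h.continuousOn_coeff₂_zero .hMinus _)) ?_ ?_
  · intro q hq
    simp [axisJump2, hq.not_ge]
  · intro q hq
    simp [axisJump2, hq.le]

theorem LogForm.continuousOn_trace₃ (h : LogForm I φ φ₁ φ₂ φ₃ δ) (c : Cone) :
    ContinuousOn (fun q : ℝ × ℝ => φ₃ c q.1 q.2 0) (I ×ˢ {ξ | 0 ≤ c.sXi * ξ}) :=
  (h.cont₃ c).comp (f := fun q : ℝ × ℝ => ((q.1, q.2, 0) : ST)) (by fun_prop)
    fun q hq => ⟨hq.1, hq.2, by simp⟩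

theorem FieldData.continuousOn_axisJump3 (h : FieldData I φ φ₁ φ₂ φ₃ δ) :
    ContinuousOn (fun q : ℝ × ℝ => axisJump3 φ₃ q.1 q.2) (I ×ˢ {0}ᶜ) := by
  refine continuousOn_of_half_lines
    (fp := fun q => -c1 φ₃ q.1 q.2) (fm := fun q => c3 φ₃ q.1 q.2) ?_ ?_ ?_ ?_
  · exact (((h.log.continuousOn_trace₃ .vPlus).mono (prod_mono_right fun x hx => by
      simpa [Cone.sXi] using le_of_lt hx)).sub ((h.log.continuousOn_trace₃ .hPlus).mono
      (prod_mono_right fun x hx => by simpa [Cone.sXi] using le_of_lt hx))).neg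
  · exact ((h.log.continuousOn_trace₃ .vMinus).mono (prod_mono_right fun x hx => by
      simpa [Cone.sXi] using le_of_lt hx)).sub ((h.log.continuousOn_trace₃ .hMinus).mono
      (prod_mono_right fun x hx => by simpa [Cone.sXi] using le_of_lt hx))
  · intro q hq
    simp [axisJump3, hq.not_ge]
  · intro q hq
    simp [axisJump3, hq.le]

end

/-! ### Testing in time: vanishing of the leading coefficients -/

/-- `θ ∈ C_c^∞(J)` on the line. -/
def IsTest₁ (J : Set ℝ) (θ : ℝ → ℝ) : Prop :=
  ContDiff ℝ ∞ θ ∧ HasCompactSupport θ ∧ tsupport θ ⊆ J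

section

variable {E : Type*} [NormedAddCommGroup E] [NormedSpace ℝ E]

theorem integrable_smul_of_continuousOn {J : Set ℝ} (hJ : IsOpen J) {k : ℝ → ℝ}
    (hk : ContinuousOn k J) (hc : HasCompactSupport k) (hs : tsupport k ⊆ J) {a : ℝ → E}
    (ha : ContinuousOn a J) : Integrable fun x => k x • a x :=
  (ContinuousOn.continuous_of_tsupport_subset (hk.smul ha) hJ
    ((tsupport_smul_subset_left k a).trans hs)).integrable_of_hasCompactSupport hc.smul_right

/-- A continuous function that vanishes against all test functions is zero. -/
theorem eq_zero_of_forall_isTest₁ {J : Set ℝ} (hJ : IsOpen J) [CompleteSpace E] {a : ℝ → E}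
    (ha : ContinuousOn a J)
    (h : ∀ θ, IsTest₁ J θ → ∫ t, θ t • a t = 0) : ∀ t ∈ J, a t = 0 := by
  have h1 := hJ.ae_eq_zero_of_integral_contDiff_smul_eq_zero (μ := volume)
    (ha.locallyIntegrableOn hJ.measurableSet) fun g h1 h2 h3 => h g ⟨h1, h2, h3⟩
  have h2 : a =ᵐ[volume.restrict J] fun _ => 0 := by
    rw [EventuallyEq, ae_restrict_iff' hJ.measurableSet]
    exact h1
  exact Measure.eqOn_open_of_ae_eq h2 hJ ha continuousOn_const

theorem exists_pos_le_abs_of_tsupport {χ : ℝ → ℝ} (hs : tsupport χ ⊆ {0}ᶜ) :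
    ∃ r > 0, ∀ x, |x| ≤ r → χ x = 0 := by
  have h0 : (tsupport χ)ᶜ ∈ 𝓝 (0 : ℝ) :=
    (isClosed_tsupport χ).isOpen_compl.mem_nhds fun h => hs h rfl
  obtain ⟨r, hr, hr'⟩ := Metric.nhds_basis_closedBall.mem_iff.1 h0
  refine ⟨r, hr, fun x hx => image_eq_zero_of_notMem_tsupport (hr' ?_)⟩
  simpa using hx

theorem exists_bound_of_hasCompactSupport {χ : ℝ → ℝ} (hχ : Continuous χ)
    (hc : HasCompactSupport χ) : ∃ R G : ℝ, 0 ≤ G ∧ (∀ x, R ≤ |x| → χ x = 0) ∧ ∀ x, |χ x| ≤ G := by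
  obtain ⟨R, hR⟩ := hc.isCompact.isBounded.subset_closedBall 0
  obtain ⟨G, hG⟩ := hχ.bounded_above_of_compact_support hc
  refine ⟨R + 1, G, (norm_nonneg _).trans (hG 0), fun x hx => ?_, fun x => hG x⟩
  refine image_eq_zero_of_notMem_tsupport fun h => ?_
  have := hR h
  simp only [Metric.mem_closedBall, dist_zero_right, Real.norm_eq_abs] at this
  linarith

variable {I : Set ℝ} {δ : ℝ} {ε : ℕ → ℝ} {w : ℝ → ℝ → ℝ → E}

theorem LineWeight.integrable_smul (hw : LineWeight I δ ε w) {t : ℝ} (ht : t ∈ I) {k : ℝ → ℝ}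
    {s : Set ℝ} (hk : AEStronglyMeasurable k (volume.restrict s)) {R M : ℝ}
    (hR : ∀ x ∈ s, R ≤ |x| → k x = 0) (hs : MeasurableSet s)
    (hM : ∀ x ∈ s, |k x| ≤ M) : IntegrableOn (fun ξ => k ξ • w t ξ 0) s := by
  obtain ⟨C, -, hC, -⟩ := hw.conv {t} (singleton_subset_iff.2 ht) isCompact_singleton R
  have h1 : IntegrableOn (fun ξ => w t ξ 0) (Ioo (-R) R) :=
    ⟨(hw.meas t ht 0).restrict, (hC t rfl).trans_lt ENNReal.ofReal_lt_top⟩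
  have h2 : IntegrableOn (fun ξ => k ξ • w t ξ 0) (s ∩ Ioo (-R) R) := by
    refine Integrable.bdd_smul (h1.mono_set inter_subset_right) M
      (hk.mono_measure (Measure.restrict_mono inter_subset_left le_rfl)) ?_
    exact (ae_restrict_iff' (hs.inter measurableSet_Ioo)).2
      (Eventually.of_forall fun x hx => hM x hx.1)
  refine h2.of_forall_sdiff_eq_zero hs fun x hx => ?_
  rw [hR x hx.1, zero_smul]
  by_contra h
  exact hx.2 ⟨hx.1, abs_lt.1 (not_le.1 h)⟩

/-- A test function supported off the origin vanishes near it, which hides any discontinuity at the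
corner. -/
theorem continuousOn_univ_of_support {E : Type*} [NormedAddCommGroup E] {I : Set ℝ} {χ : ℝ → ℝ} (hs : tsupport χ ⊆ {0}ᶜ) {F : ℝ × ℝ → E}
    (hF : ContinuousOn F (I ×ˢ {0}ᶜ)) (h0 : ∀ q, χ q.2 = 0 → F q = 0) :
    ContinuousOn F (I ×ˢ univ) := by
  obtain ⟨r, hr, hr0⟩ := exists_pos_le_abs_of_tsupport hs
  rintro ⟨t, ξ⟩ ⟨ht, -⟩
  by_cases hξ : ξ = 0
  · subst hξ
    have hn : univ ×ˢ Icc (-r) r ∈ 𝓝 (t, (0 : ℝ)) :=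
      prod_mem_nhds univ_mem (Icc_mem_nhds (by linarith) hr)
    refine (continuousWithinAt_const (b := (0 : E))).congr_of_eventuallyEq ?_
      (h0 _ (hr0 0 (by simpa using hr.le)))
    filter_upwards [mem_nhdsWithin_of_mem_nhds hn] with q hq
    exact h0 q (hr0 _ (abs_le.2 hq.2))
  · have hn : univ ×ˢ ({0}ᶜ : Set ℝ) ∈ 𝓝 (t, ξ) :=
      prod_mem_nhds univ_mem (isOpen_compl_singleton.mem_nhds hξ)
    refine (hF (t, ξ) ⟨ht, hξ⟩).mono_of_mem_nhdsWithin ?_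
    filter_upwards [self_mem_nhdsWithin, mem_nhdsWithin_of_mem_nhds hn] with q hq hq'
    exact ⟨hq.1, hq'.2⟩

theorem continuousOn_integral_of_test {χ : ℝ → ℝ}
    (hc : HasCompactSupport χ) (hs : tsupport χ ⊆ {0}ᶜ) {F : ℝ → ℝ → E}
    (hF : ContinuousOn (fun q : ℝ × ℝ => F q.1 q.2) (I ×ˢ {0}ᶜ))
    (h0 : ∀ t x, χ x = 0 → F t x = 0) : ContinuousOn (fun t => ∫ x, F t x) I :=
  continuousOn_integral_of_compact_support hc.isCompact
    (continuousOn_univ_of_support hs hF fun q hq => h0 q.1 q.2 hq)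
    fun t x _ hx => h0 t x (image_eq_zero_of_notMem_tsupport hx)

theorem integrable_of_test {E : Type*} [NormedAddCommGroup E] {I : Set ℝ} {χ : ℝ → ℝ}
    (hc : HasCompactSupport χ) (hs : tsupport χ ⊆ {0}ᶜ) {F : ℝ → ℝ → E}
    (hF : ContinuousOn (fun q : ℝ × ℝ => F q.1 q.2) (I ×ˢ {0}ᶜ))
    (h0 : ∀ t x, χ x = 0 → F t x = 0) {t : ℝ} (ht : t ∈ I) : Integrable (F t) := by
  have h1 := continuousOn_univ_of_support hs hF fun q hq => h0 q.1 q.2 hq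
  have h2 : Continuous (F t) := by
    rw [← continuousOn_univ]
    exact h1.comp (f := fun x => (t, x)) (by fun_prop) fun x hx => ⟨ht, hx⟩
  refine h2.integrable_of_hasCompactSupport (HasCompactSupport.intro hc.isCompact fun x hx => ?_)
  exact h0 t x (image_eq_zero_of_notMem_tsupport hx)

/-- Integrals of the trace of a weight against a coefficient depend continuously on time. -/
theorem LineWeight.continuousOn_integral (hw : LineWeight I δ ε w) (hI : IsOpen I) (hδ : 0 < δ)
    (hε : Tendsto ε atTop (𝓝[>] 0)) {χ : ℝ → ℝ} (hχ : Continuous χ) (hc : HasCompactSupport χ)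
    (hs : tsupport χ ⊆ {0}ᶜ) {m : ℝ → ℝ → ℝ}
    (hm : ContinuousOn (fun q : ℝ × ℝ => m q.1 q.2) (I ×ˢ {0}ᶜ)) :
    (∀ t ∈ I, Integrable fun ξ => (χ ξ * m t ξ) • w t ξ 0) ∧
    ContinuousOn (fun t => ∫ ξ, (χ ξ * m t ξ) • w t ξ 0) I := by
  obtain ⟨R, G, hG, hχR, hχG⟩ := exists_bound_of_hasCompactSupport hχ hc
  have hχm : ContinuousOn (fun q : ℝ × ℝ => χ q.2 * m q.1 q.2) (I ×ˢ univ) :=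
    continuousOn_univ_of_support hs ((hχ.comp continuous_snd).continuousOn.mul hm)
      fun q hq => by simp [hq]
  have hbd : ∀ K ⊆ I, IsCompact K → ∃ M : ℝ, 0 ≤ M ∧ ∀ t ∈ K, ∀ x, |χ x * m t x| ≤ M := by
    intro K hKI hK
    obtain ⟨M, hM⟩ := (hK.prod hc.isCompact).exists_bound_of_continuousOn
      (hχm.mono (prod_mono hKI (subset_univ _)))
    refine ⟨max M 0, le_max_right _ _, fun t ht x => ?_⟩
    by_cases hx : x ∈ tsupport χ
    · exact (hM (t, x) ⟨ht, hx⟩).trans (le_max_left _ _)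
    · simp [image_eq_zero_of_notMem_tsupport hx]
  have hint : ∀ t ∈ I, Integrable fun ξ => (χ ξ * m t ξ) • w t ξ 0 := by
    intro t ht
    obtain ⟨M, -, hM⟩ := hbd {t} (singleton_subset_iff.2 ht) isCompact_singleton
    rw [← integrableOn_univ]
    refine hw.integrable_smul ht (R := R) (M := M) ?_ (fun x _ hx => by simp [hχR x hx])
      MeasurableSet.univ fun x _ => hM t rfl x
    refine Continuous.aestronglyMeasurable ?_
    rw [← continuousOn_univ]
    exact hχm.comp (f := fun x => (t, x)) (by fun_prop) fun x hx => ⟨ht, hx⟩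
  refine ⟨hint, ?_⟩
  have hFn : ∀ n, ContinuousOn (fun q : ℝ × ℝ => (χ q.2 * m q.1 q.2) • w q.1 q.2 (ε n))
      (I ×ˢ {0}ᶜ) := fun n => ((hχ.comp continuous_snd).continuousOn.mul hm).smul (hw.cont n).1
  have hloc : ∀ K ⊆ I, IsCompact K → ContinuousOn (fun t => ∫ ξ, (χ ξ * m t ξ) • w t ξ 0) K := by
    intro K hKI hK
    obtain ⟨M, hM0, hM⟩ := hbd K hKI hK
    obtain ⟨C, hC, -, hC'⟩ := hw.conv K hKI hK R
    -- The trace itself need not depend continuously on time. Its integrals do, as uniform limits of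
    -- integrals along `η = ε_n`, where the weight is continuous.
    have hlim : TendstoUniformlyOn (fun n t => ∫ ξ, (χ ξ * m t ξ) • w t ξ (ε n))
        (fun t => ∫ ξ, (χ ξ * m t ξ) • w t ξ 0) atTop K := by
      rw [Metric.tendstoUniformlyOn_iff]
      intro e he
      have hl : Tendsto (fun n => M * (C * ε n ^ δ)) atTop (𝓝 0) := by
        have l0 : Tendsto (fun s : ℝ => s ^ δ) (𝓝[>] 0) (𝓝 0) := by
          have := (Real.continuousAt_rpow_const (0 : ℝ) δ (Or.inr hδ.le)).tendsto
          rw [Real.zero_rpow hδ.ne'] at this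
          exact this.mono_left nhdsWithin_le_nhds
        simpa using ((l0.comp hε).const_mul C).const_mul M
      filter_upwards [hC', hl.eventually_lt_const he, hε.eventually self_mem_nhdsWithin]
        with n hn hne hpos t ht
      rw [dist_comm, dist_eq_norm, ← integral_sub
        (integrable_of_test (F := fun t ξ => (χ ξ * m t ξ) • w t ξ (ε n)) hc hs (hFn n)
          (fun t x hx => by simp [hx]) (hKI ht)) (hint t (hKI ht))]
      refine lt_of_le_of_lt ?_ hne
      have hpos' : 0 ≤ C * ε n ^ δ := mul_nonneg hC (Real.rpow_nonneg (le_of_lt hpos) δ)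
      rw [← ENNReal.ofReal_le_ofReal_iff (by positivity), ofReal_norm]
      refine (enorm_integral_le_lintegral_enorm _).trans ?_
      calc ∫⁻ ξ, ‖(χ ξ * m t ξ) • w t ξ (ε n) - (χ ξ * m t ξ) • w t ξ 0‖ₑ
          ≤ ∫⁻ ξ, (Ioo (-R) R).indicator
            (fun ξ => ENNReal.ofReal M * ‖w t ξ (ε n) - w t ξ 0‖ₑ) ξ := by
            refine lintegral_mono fun ξ => ?_
            by_cases hξ : ξ ∈ Ioo (-R) R
            · rw [indicator_of_mem hξ, ← smul_sub, enorm_smul, ← ofReal_norm (χ ξ * m t ξ)]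
              gcongr
              exact hM t ht ξ
            · rw [indicator_of_notMem hξ, hχR ξ]
              · simp
              · by_contra h
                exact hξ (abs_lt.1 (not_le.1 h))
        _ = ENNReal.ofReal M * ∫⁻ ξ in Ioo (-R) R, ‖w t ξ (ε n) - w t ξ 0‖ₑ := by
            rw [lintegral_indicator measurableSet_Ioo, lintegral_const_mul'']
            exact (((hw.meas t (hKI ht) _).sub (hw.meas t (hKI ht) 0)).enorm).restrict
        _ ≤ ENNReal.ofReal M * ENNReal.ofReal (C * ε n ^ δ) := by
            gcongr
            exact (hn t ht).1
        _ = _ := (ENNReal.ofReal_mul hM0).symm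
    refine hlim.continuousOn (Eventually.frequently (Eventually.of_forall fun n => ?_))
    exact (continuousOn_integral_of_test (F := fun t ξ => (χ ξ * m t ξ) • w t ξ (ε n)) hc hs
      (hFn n) (fun t x hx => by simp [hx])).mono hKI
  intro t ht
  obtain ⟨K, hK, htK, hKI⟩ := exists_compact_subset hI ht
  exact ((hloc K hKI hK).continuousAt (mem_interior_iff_mem_nhds.1 htK)).continuousWithinAt

theorem integral_sub_smul_add {f g k : ℝ → E} (hf : Integrable f) (hg : Integrable g)
    (hk : Integrable k) (c : ℝ) :
    ∫ x, (f x - (c • g x + k x)) = (∫ x, f x) - (c • (∫ x, g x) + ∫ x, k x) := by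
  rw [integral_sub (g := fun x => c • g x + k x) hf ((hg.smul c).add hk),
    integral_add (f := fun x => c • g x) (hg.smul c) hk, integral_smul]

/-- Division by `l n` leaves `A → 0`, so `A = 0`, and then the sequence is the constant `B`. This
separates the divergent part of a boundary term from its finite part. -/
theorem eq_zero_of_tendsto_log {l : ℕ → ℝ} (hl : Tendsto l atTop atBot) {A B : E}
    (h : Tendsto (fun n => l n • A + B) atTop (𝓝 0)) : A = 0 ∧ B = 0 := by
  have hinv : Tendsto (fun n => (l n)⁻¹) atTop (𝓝 0) := tendsto_inv_atBot_zero.comp hl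
  have h1 : Tendsto (fun n => (l n)⁻¹ • (l n • A + B)) atTop (𝓝 ((0 : ℝ) • (0 : E))) :=
    hinv.smul h
  have h2 : Tendsto (fun n => A + (l n)⁻¹ • B) atTop (𝓝 (A + (0 : ℝ) • B)) :=
    tendsto_const_nhds.add (hinv.smul_const B)
  have h3 : Tendsto (fun n => (l n)⁻¹ • (l n • A + B)) atTop (𝓝 (A + (0 : ℝ) • B)) := by
    refine h2.congr' ?_
    filter_upwards [hl.eventually_lt_atBot 0] with n hn
    rw [smul_add, inv_smul_smul₀ hn.ne]
  have hA : A = 0 := by simpa using tendsto_nhds_unique h3 h1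
  refine ⟨hA, ?_⟩
  simpa [hA] using h

/-- The integral over time of a uniformly small family is small. -/
theorem tendsto_integral_smul_of_tendstoUniformlyOn {K : Set ℝ} {θ : ℝ → ℝ} (hθ : Integrable θ)
    (hK : ∀ t, t ∉ K → θ t = 0) {F : ℕ → ℝ → E} (hF : TendstoUniformlyOn F 0 atTop K) :
    Tendsto (fun n => ∫ t, θ t • F n t) atTop (𝓝 0) := by
  rw [Metric.tendsto_nhds]
  intro e he
  rw [Metric.tendstoUniformlyOn_iff] at hF
  have hpos : 0 ≤ ∫ t, ‖θ t‖ := integral_nonneg fun _ => norm_nonneg _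
  filter_upwards [hF (e / ((∫ t, ‖θ t‖) + 1)) (by positivity)] with n hn
  rw [dist_zero_right]
  have h1 : ‖∫ t, θ t • F n t‖ ≤ ∫ t, ‖θ t‖ * (e / ((∫ t, ‖θ t‖) + 1)) := by
    refine norm_integral_le_of_norm_le (hθ.norm.mul_const _) (Eventually.of_forall fun t => ?_)
    rw [norm_smul]
    by_cases ht : t ∈ K
    · have := hn t ht
      simp only [Pi.zero_apply, dist_zero_left] at this
      gcongr
    · simp [hK t ht]
  refine h1.trans_lt ?_
  rw [integral_mul_const, mul_div_assoc', div_lt_iff₀ (by positivity)]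
  nlinarith

/-- If the boundary integrals along the axis `η = 0` vanish in the limit when tested in time, then
the leading coefficients of the jump vanish at all times. -/
theorem FieldData.line_vanish [CompleteSpace E] {φ : ST → ℝ} {φ₁ φ₂ : Cone → ℝ → ℝ → ℝ}
    {φ₃ : Cone → ℝ → ℝ → ℝ → ℝ} (h : FieldData I φ φ₁ φ₂ φ₃ δ) (hw : LineWeight I δ ε w)
    (hε : Tendsto ε atTop (𝓝[>] 0)) {χ : ℝ → ℝ} (hχ : Continuous χ) (hc : HasCompactSupport χ)
    (hs : tsupport χ ⊆ {0}ᶜ)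
    (H : ∀ θ, IsTest₁ I θ → Tendsto (fun n => ∫ t, θ t • ∫ ξ in outer (ε n),
      ((χ ξ * φ (charPt t ξ (ε n))) • w t ξ (ε n)
        - (χ ξ * φ (charPt t ξ (-ε n))) • w t ξ (-ε n))) atTop (𝓝 0)) :
    ∀ t ∈ I, ∫ ξ, (χ ξ * jump1 φ₁ t ξ) • w t ξ 0 = 0 ∧
      ∫ ξ, (χ ξ * (axisJump2 φ₂ t ξ * Real.log |ξ| + axisJump3 φ₃ t ξ)) • w t ξ 0 = 0 := by
  obtain ⟨R, G, hG, hχR, hχG⟩ := exists_bound_of_hasCompactSupport hχ hc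
  obtain ⟨r, hr, hr0⟩ := exists_pos_le_abs_of_tsupport hs
  have hlogc : ContinuousOn (fun q : ℝ × ℝ => Real.log |q.2|) (I ×ˢ {0}ᶜ) :=
    ContinuousOn.log (by fun_prop) fun q hq => (abs_pos.2 hq.2).ne'
  obtain ⟨ia, ca⟩ := hw.continuousOn_integral h.isOpen h.pos hε hχ hc hs h.continuousOn_jump1
  obtain ⟨ib, cb⟩ := hw.continuousOn_integral h.isOpen h.pos hε hχ hc hs
    (m := fun t ξ => axisJump2 φ₂ t ξ * Real.log |ξ| + axisJump3 φ₃ t ξ)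
    ((h.continuousOn_axisJump2.mul hlogc).add h.continuousOn_axisJump3)
  set a : ℝ → E := fun t => ∫ ξ, (χ ξ * jump1 φ₁ t ξ) • w t ξ 0 with ha
  set b : ℝ → E := fun t =>
    ∫ ξ, (χ ξ * (axisJump2 φ₂ t ξ * Real.log |ξ| + axisJump3 φ₃ t ξ)) • w t ξ 0 with hb
  set D : ℕ → ℝ → ℝ → E := fun n t ξ => (χ ξ * φ (charPt t ξ (ε n))) • w t ξ (ε n)
        - (χ ξ * φ (charPt t ξ (-ε n))) • w t ξ (-ε n) with hD
  have hDz : ∀ n t x, χ x = 0 → D n t x = 0 := fun n t x hx => by simp [hD, hx]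
  have hDc : ∀ᶠ n in atTop, ContinuousOn (fun q : ℝ × ℝ => D n q.1 q.2) (I ×ˢ {0}ᶜ) := by
    filter_upwards [hε.eventually self_mem_nhdsWithin] with n hn
    have hφc : ∀ s ≠ 0, ContinuousOn (fun q : ℝ × ℝ => φ (charPt q.1 q.2 s)) (I ×ˢ {0}ᶜ) := by
      intro s hs
      refine h.cont.comp (f := fun q : ℝ × ℝ => charPt q.1 q.2 s) ?_
        fun q hq => charPt_mem_offCross hq.1 hq.2 hs
      refine Continuous.continuousOn ?_
      unfold charPt
      fun_prop
    have hχ' : ContinuousOn (fun q : ℝ × ℝ => χ q.2) (I ×ˢ {0}ᶜ) :=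
      (hχ.comp continuous_snd).continuousOn
    exact ((hχ'.mul (hφc _ (ne_of_gt hn))).smul (hw.cont n).1).sub
      ((hχ'.mul (hφc _ (neg_ne_zero.2 (ne_of_gt hn)))).smul (hw.cont n).2)
  -- For large `n` the removed interval lies where `χ` vanishes, so integrals over `outer (ε n)` are
  -- integrals over the whole line.
  have hout : ∀ᶠ n in atTop, ∀ x, x ∉ outer (ε n) → χ x = 0 := by
    filter_upwards [hε.eventually (eventually_mem_Ioo hr)] with n hn x hx
    exact hr0 x ((not_lt.1 hx).trans hn.2.le)
  -- The hypothesis gives a limit only after testing in time, so divergent and finite parts are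
  -- separated for the time integrals. Continuity of `a` and `b` then yields their vanishing at each
  -- time.
  have key : ∀ θ, IsTest₁ I θ → ∫ t, θ t • a t = 0 ∧ ∫ t, θ t • b t = 0 := by
    intro θ hθ
    have hθi : Integrable θ := hθ.1.continuous.integrable_of_hasCompactSupport hθ.2.1
    have iθ : ∀ {c : ℝ → E}, ContinuousOn c I → Integrable fun t => θ t • c t := fun {c} hc' =>
      integrable_smul_of_continuousOn h.isOpen hθ.1.continuous.continuousOn hθ.2.1 hθ.2.2 hc'
    have hline := h.log.tendsto_line h.pos hε hw hθ.2.2 hθ.2.1.isCompact (R := R) (G := G)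
      (g := fun _ ξ _ => χ ξ) ⟨fun _ _ ξ => hχG ξ, fun _ _ ξ η => by
        rw [sub_self, abs_zero]; positivity, fun _ _ ξ hξ _ => hχR ξ hξ⟩
    have hlim := tendsto_integral_smul_of_tendstoUniformlyOn hθi
      (fun t ht => image_eq_zero_of_notMem_tsupport ht) hline
    refine eq_zero_of_tendsto_log
      (Real.tendsto_log_nhdsGT_zero.comp hε) (A := ∫ t, θ t • a t) (B := ∫ t, θ t • b t) ?_
    have h0 := (H θ hθ).sub hlim
    rw [sub_zero] at h0
    refine h0.congr' ?_
    filter_upwards [hDc, hout] with n hDn hn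
    have hcut : ∀ {F : ℝ → E}, (∀ x, χ x = 0 → F x = 0) → ∫ ξ in outer (ε n), F ξ = ∫ ξ, F ξ :=
      fun hF => setIntegral_eq_integral_of_forall_compl_eq_zero fun x hx => hF x (hn x hx)
    have hDi : ∀ t ∈ I, Integrable (D n t) := fun t ht =>
      integrable_of_test hc hs hDn (hDz n) ht
    have hDint : ContinuousOn (fun t => ∫ ξ, D n t ξ) I :=
      continuousOn_integral_of_test hc hs hDn (hDz n)
    have e1 : ∀ t, ∫ ξ in outer (ε n), D n t ξ = ∫ ξ, D n t ξ := fun t => hcut (hDz n t)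
    have e2 : ∀ t ∈ I, ∫ ξ in outer (ε n), (D n t ξ -
        (χ ξ * jumpCoeff φ₁ φ₂ φ₃ (ε n) t ξ) • w t ξ 0) =
        (∫ ξ, D n t ξ) - (Real.log (ε n) • a t + b t) := by
      intro t ht
      rw [hcut fun x hx => by simp [hDz n t x hx, hx], ha, hb]
      simp only
      rw [← integral_sub_smul_add (hDi t ht) (ia t ht) (ib t ht)]
      refine integral_congr_ae (Eventually.of_forall fun ξ => ?_)
      simp only [jumpCoeff]
      module
    have e3 : ∀ t, θ t • ∫ ξ in outer (ε n), (D n t ξ -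
        (χ ξ * jumpCoeff φ₁ φ₂ φ₃ (ε n) t ξ) • w t ξ 0) =
        θ t • (∫ ξ, D n t ξ) - (Real.log (ε n) • θ t • a t + θ t • b t) := by
      intro t
      by_cases ht : t ∈ I
      · rw [e2 t ht]; module
      · have : θ t = 0 := image_eq_zero_of_notMem_tsupport fun h' => ht (hθ.2.2 h')
        simp [this]
    have e4 : ∫ t, θ t • ∫ ξ in outer (ε n), (D n t ξ -
        (χ ξ * jumpCoeff φ₁ φ₂ φ₃ (ε n) t ξ) • w t ξ 0) =
        (∫ t, θ t • ∫ ξ, D n t ξ) -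
          (Real.log (ε n) • (∫ t, θ t • a t) + ∫ t, θ t • b t) := by
      rw [integral_congr_ae (Eventually.of_forall e3), integral_sub_smul_add (iθ hDint) (iθ ca)
        (iθ cb)]
    simp only [Function.comp_apply]
    change (∫ t, θ t • ∫ ξ in outer (ε n), D n t ξ) - (∫ t, θ t • ∫ ξ in outer (ε n),
      (D n t ξ - (χ ξ * jumpCoeff φ₁ φ₂ φ₃ (ε n) t ξ) • w t ξ 0)) = _
    rw [e4]
    simp only [e1]
    abel
  intro t ht
  exact ⟨eq_zero_of_forall_isTest₁ h.isOpen ca (fun θ hθ => (key θ hθ).1) t ht,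
    eq_zero_of_forall_isTest₁ h.isOpen cb (fun θ hθ => (key θ hθ).2) t ht⟩

end

/-! ### The two weights in use: `1` for the wave equation and `u_ξ` for the spin equation. -/

/-- The constant weight. -/
theorem lineWeight_one (I : Set ℝ) (δ : ℝ) {ε : ℕ → ℝ} :
    LineWeight I δ ε fun _ _ _ => (1 : ℝ) where
  meas _ _ _ := aestronglyMeasurable_const
  conv K _ _ R := by
    refine ⟨|R| + |R|, by positivity, fun t _ => ?_, Eventually.of_forall fun n t _ => ?_⟩
    · simp only [enorm_one, lintegral_const, MeasurableSet.univ, Measure.restrict_apply,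
        univ_inter, Real.volume_Ioo, one_mul]
      exact ENNReal.ofReal_le_ofReal (by linarith [le_abs_self R])
    · simp
  cont _ := ⟨continuousOn_const, continuousOn_const⟩

theorem dXi_eq_pd {u : ST → V3} {t ξ η : ℝ} (h : DifferentiableAt ℝ (u ∘ charMap) (t, ξ, η)) :
    dXi u t ξ η = pd eX (u ∘ charMap) (t, ξ, η) := by
  have h2 : HasDerivAt (fun ξ : ℝ => ((t, ξ, η) : ST)) eX ξ :=
    (hasDerivAt_const ξ t).prodMk ((hasDerivAt_id ξ).prodMk (hasDerivAt_const ξ η))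
  exact (h.hasFDerivAt.comp_hasDerivAt ξ h2).deriv

theorem dEta_eq_pd {u : ST → V3} {t ξ η : ℝ} (h : DifferentiableAt ℝ (u ∘ charMap) (t, ξ, η)) :
    dEta u t ξ η = pd eY (u ∘ charMap) (t, ξ, η) := by
  have h2 : HasDerivAt (fun η : ℝ => ((t, ξ, η) : ST)) eY η :=
    (hasDerivAt_const η t).prodMk ((hasDerivAt_const η ξ).prodMk (hasDerivAt_id η))
  exact (h.hasFDerivAt.comp_hasDerivAt η h2).deriv

theorem lintegral_le_lpOn {p : ℝ≥0∞} (hp : 1 ≤ p) (R : ℝ) {f : ℝ → V3}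
    (hf : AEStronglyMeasurable f) : ∫⁻ x in Ioo (-R) R, ‖f x‖ₑ ≤
      lpOn p R f * volume (Ioo (-R) R) ^ (1 / (1 : ℝ≥0∞).toReal - 1 / p.toReal) := by
  rw [← eLpNorm_one_eq_lintegral_enorm]
  have := eLpNorm_le_eLpNorm_mul_rpow_measure_univ (μ := volume.restrict (Ioo (-R) R)) hp
    hf.restrict
  rwa [Measure.restrict_apply_univ] at this

/-- The tangential derivative of `u` is a weight on the axis `η = 0`. -/
theorem TraceConvergence.lineWeight_dXi {I : Set ℝ} (hI : IsOpen I) {u : ST → V3} {δ : ℝ}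
    {p : ℝ≥0∞} (hp : 1 ≤ p) {ε : ℕ → ℝ} (hε : ∀ n, 0 < ε n)
    (h : TraceConvergence I u δ p ε) (hu : ContDiffOn ℝ ∞ u (offCross I)) :
    LineWeight I δ ε (dXi u) where
  -- `deriv` is measurable for an arbitrary function, so the trace of `u` may fail to be
  -- differentiable at some points.
  meas t _ η := (measurable_deriv _).aestronglyMeasurable
  conv K hKI hK R := by
    obtain ⟨C, h0, h1⟩ := h.xi K hKI hK R
    set V : ℝ≥0∞ := volume (Ioo (-R) R) ^ (1 / (1 : ℝ≥0∞).toReal - 1 / p.toReal) with hV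
    have hVt : V ≠ ⊤ := by
      refine ENNReal.rpow_ne_top_of_nonneg ?_ (by simp)
      rw [sub_nonneg, ENNReal.toReal_one, div_one]
      -- At `p = ∞` the default values `(⊤ : ℝ≥0∞).toReal = 0` and `1 / 0 = 0` give the Hölder
      -- exponent `1`, as they should.
      rcases eq_or_ne p ⊤ with rfl | hp'
      · simp
      · have : 1 ≤ p.toReal := by
          rw [← ENNReal.toReal_one]; exact ENNReal.toReal_mono hp' hp
        exact div_le_one_of_le₀ this (by positivity)
    have hb : ∀ {f : ℝ → V3} {B s : ℝ}, 0 ≤ s → AEStronglyMeasurable f →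
        lpOn p R f ≤ ENNReal.ofReal (B * s) →
        ∫⁻ x in Ioo (-R) R, ‖f x‖ₑ ≤ ENNReal.ofReal (|B| * V.toReal * s) := by
      intro f B s hs hf hB
      refine (lintegral_le_lpOn hp R hf).trans ?_
      rw [mul_right_comm, ENNReal.ofReal_mul (by positivity), ENNReal.ofReal_toReal hVt]
      refine mul_le_mul_left (hB.trans (ENNReal.ofReal_le_ofReal ?_)) _
      exact mul_le_mul_of_nonneg_right (le_abs_self B) hs
    refine ⟨|C| * V.toReal, by positivity, fun t ht => ?_, ?_⟩
    · have := hb (s := 1) zero_le_one (measurable_deriv _).aestronglyMeasurable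
        (by rw [mul_one]; exact h0 t ht)
      rwa [mul_one] at this
    · filter_upwards [h1] with n hn t ht
      have hs : 0 ≤ ε n ^ δ := Real.rpow_nonneg (hε n).le δ
      exact ⟨hb hs ((measurable_deriv _).sub (measurable_deriv _)).aestronglyMeasurable (hn t ht).1,
        hb hs ((measurable_deriv _).sub (measurable_deriv _)).aestronglyMeasurable (hn t ht).2⟩
  cont n := by
    have ho := isOpen_offCross hI
    have hs : ∀ q ∈ slab I ∩ offAxes, ContDiffAt ℝ 1 (u ∘ charMap) q := fun q hq =>
      ((hu.contDiffAt (ho.mem_nhds (charMap_mem_offCross.2 hq))).comp q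
        charMap.contDiff.contDiffAt).of_le (by simp)
    have hc := ContDiffAt.continuousOn_pd hs eX
    have aux : ∀ s ≠ 0, ContinuousOn (fun q : ℝ × ℝ => dXi u q.1 q.2 s) (I ×ˢ {0}ᶜ) := by
      intro s hs0
      have h1 : ContinuousOn (fun q : ℝ × ℝ => pd eX (u ∘ charMap) (q.1, q.2, s)) (I ×ˢ {0}ᶜ) :=
        hc.comp (by fun_prop) fun q hq => ⟨hq.1, hq.2, hs0⟩
      exact h1.congr fun q hq =>
        dXi_eq_pd ((hs (q.1, q.2, s) ⟨hq.1, hq.2, hs0⟩).differentiableAt (by simp))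
    exact ⟨aux _ (hε n).ne', aux _ (neg_ne_zero.2 (hε n).ne')⟩

theorem dXi_reflectY (u : ST → V3) (t ξ η : ℝ) :
    dXi (fun q => u (reflectY q)) t ξ η = dEta u t η ξ := by
  simp only [dXi, dEta, reflectY_charPt]

theorem dEta_reflectY (u : ST → V3) (t ξ η : ℝ) :
    dEta (fun q => u (reflectY q)) t ξ η = dXi u t η ξ := by
  simp only [dXi, dEta, reflectY_charPt]

theorem TraceConvergence.swap {I : Set ℝ} {u : ST → V3} {δ : ℝ} {p : ℝ≥0∞} {ε : ℕ → ℝ}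
    (h : TraceConvergence I u δ p ε) :
    TraceConvergence I (fun q => u (reflectY q)) δ p ε where
  xi K hKI hK R := by
    simp only [dXi_reflectY]
    exact h.eta K hKI hK R
  eta K hKI hK R := by
    simp only [dEta_reflectY]
    exact h.xi K hKI hK R

/-! ### Product test functions -/

/-- The test function `θ(t) χ(ξ) β(η)`. -/
def tensorTest (θ χ β : ℝ → ℝ) (q : ST) : ℝ := θ q.1 * χ q.2.1 * β q.2.2

theorem IsTest₁.deriv {J : Set ℝ} {χ : ℝ → ℝ} (h : IsTest₁ J χ) : IsTest₁ J (deriv χ) :=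
  ⟨(contDiff_infty_iff_deriv.1 h.1).2, h.2.1.deriv, tsupport_deriv_subset.trans h.2.2⟩

theorem IsTest₁.mono {J J' : Set ℝ} {χ : ℝ → ℝ} (h : IsTest₁ J χ) (hJ : J ⊆ J') : IsTest₁ J' χ :=
  ⟨h.1, h.2.1, h.2.2.trans hJ⟩

theorem isTest_tensorTest {I : Set ℝ} {θ χ β : ℝ → ℝ} (hθ : IsTest₁ I θ) (hχ : IsTest₁ univ χ)
    (hβ : IsTest₁ univ β) : IsTest (slab I) (tensorTest θ χ β) := by
  refine ⟨?_, ?_, ?_⟩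
  · have h1 := hθ.1
    have h2 := hχ.1
    have h3 := hβ.1
    unfold tensorTest
    fun_prop
  · refine HasCompactSupport.intro
      (hθ.2.1.isCompact.prod (hχ.2.1.isCompact.prod hβ.2.1.isCompact)) fun q hq => ?_
    by_contra h
    simp only [tensorTest, mul_eq_zero, not_or] at h
    exact hq ⟨subset_tsupport _ h.1.1, subset_tsupport _ h.1.2, subset_tsupport _ h.2⟩
  · have : tsupport (tensorTest θ χ β) ⊆ Prod.fst ⁻¹' tsupport θ := by
      refine closure_minimal (fun q hq => subset_tsupport θ ?_)
        ((isClosed_tsupport θ).preimage continuous_fst)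
      intro h
      exact hq (by simp [tensorTest, h])
    exact fun q hq => hθ.2.2 (this hq)

theorem pd_eX_eq_deriv {f : ST → ℝ} {q : ST} (hf : DifferentiableAt ℝ f q) :
    pd eX f q = deriv (fun s => f (q.1, s, q.2.2)) q.2.1 := by
  have h2 : HasDerivAt (fun ξ : ℝ => ((q.1, ξ, q.2.2) : ST)) eX q.2.1 :=
    (hasDerivAt_const _ q.1).prodMk ((hasDerivAt_id _).prodMk (hasDerivAt_const _ q.2.2))
  exact (HasFDerivAt.comp_hasDerivAt q.2.1 (l := f) (f := fun ξ : ℝ => ((q.1, ξ, q.2.2) : ST))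
    hf.hasFDerivAt h2).deriv.symm

theorem pd_eY_eq_deriv {f : ST → ℝ} {q : ST} (hf : DifferentiableAt ℝ f q) :
    pd eY f q = deriv (fun s => f (q.1, q.2.1, s)) q.2.2 := by
  have h2 : HasDerivAt (fun η : ℝ => ((q.1, q.2.1, η) : ST)) eY q.2.2 :=
    (hasDerivAt_const _ q.1).prodMk ((hasDerivAt_const _ q.2.1).prodMk (hasDerivAt_id _))
  exact (HasFDerivAt.comp_hasDerivAt q.2.2 (l := f) (f := fun η : ℝ => ((q.1, q.2.1, η) : ST))
    hf.hasFDerivAt h2).deriv.symm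

theorem pd_eX_tensorTest {I : Set ℝ} {θ χ β : ℝ → ℝ} (h : IsTest (slab I) (tensorTest θ χ β))
    (q : ST) : pd eX (tensorTest θ χ β) q = tensorTest θ (deriv χ) β q := by
  rw [pd_eX_eq_deriv (h.1.contDiffAt.differentiableAt (by simp))]
  simp [tensorTest]

theorem pd_eY_tensorTest {I : Set ℝ} {θ χ β : ℝ → ℝ} (h : IsTest (slab I) (tensorTest θ χ β))
    (q : ST) : pd eY (tensorTest θ χ β) q = tensorTest θ χ (deriv β) q := by
  rw [pd_eY_eq_deriv (h.1.contDiffAt.differentiableAt (by simp))]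
  simp [tensorTest]

theorem exists_isTest₁_eventually_eq_one :
    ∃ β : ℝ → ℝ, IsTest₁ univ β ∧ ∀ᶠ s in 𝓝 0, β s = 1 := by
  let f : ContDiffBump (0 : ℝ) := ⟨1, 2, one_pos, one_lt_two⟩
  exact ⟨f, ⟨f.contDiff, f.hasCompactSupport, subset_univ _⟩, f.eventuallyEq_one⟩

/-- The regions exhaust space up to the axes, a null set; integrability, which is part of the
assumptions on `(u, φ)`, does the rest. -/
theorem tendsto_integral_farAxes {E : Type*} [NormedAddCommGroup E] [NormedSpace ℝ E]
    {ε : ℕ → ℝ} (hε : Tendsto ε atTop (𝓝[>] 0)) {F : ST → E} (hF : Integrable F) :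
    Tendsto (fun n => ∫ q in farAxes (ε n), F q) atTop (𝓝 (∫ q, F q)) := by
  have hcov : AECover volume atTop fun n => farAxes (ε n) := by
    refine ⟨?_, fun n => measurableSet_farAxes _⟩
    filter_upwards [ae_mem_offAxes] with q hq
    have h0 := tendsto_nhds_of_tendsto_nhdsWithin hε
    filter_upwards [h0.eventually_lt_const (abs_pos.2 hq.1),
      h0.eventually_lt_const (abs_pos.2 hq.2)] with n h1 h2
    exact mem_farAxes.2 ⟨h1, h2⟩
  exact hcov.integral_tendsto_of_countably_generated hF

section

variable {κ : Target} {I : Set ℝ} {u : ST → V3} {φ : ST → ℝ} {ε : ℕ → ℝ}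

/-- For a test function `θ(t) χ(ξ) β(η)` the vanishing of `χ` near `0` removes the boundary terms on
`ξ = ±ε_n` and at the corners, and `β = 1` near `0` leaves those on `η = ±ε_n` unweighted. This
isolates one axis. -/
theorem eventually_vanish_and_one (hε : Tendsto ε atTop (𝓝[>] 0)) {χ β : ℝ → ℝ}
    (hχ : tsupport χ ⊆ {0}ᶜ) (hβ : ∀ᶠ s in 𝓝 0, β s = 1) :
    ∀ᶠ n in atTop, 0 < ε n ∧ χ (ε n) = 0 ∧ χ (-ε n) = 0 ∧ β (ε n) = 1 ∧ β (-ε n) = 1 := by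
  obtain ⟨r, hr, hr0⟩ := exists_pos_le_abs_of_tsupport hχ
  have h0 := tendsto_nhds_of_tendsto_nhdsWithin hε
  have h0' : Tendsto (fun n => -ε n) atTop (𝓝 0) := by simpa using h0.neg
  filter_upwards [hε.eventually (eventually_mem_Ioo hr), h0.eventually hβ, h0'.eventually hβ]
    with n hn h1 h2
  have : |ε n| ≤ r := by rw [abs_of_pos hn.1]; exact hn.2.le
  exact ⟨hn.1, hr0 _ this, hr0 _ (by rwa [abs_neg]), h1, h2⟩

/-- The weak wave equation, tested near the axis `η = 0`. -/
theorem tendsto_wave_axis_eta (S : CharSolution κ I (u ∘ charMap) (φ ∘ charMap))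
    (hw : WeakClass κ I u φ (pd eX u) (pd eY u)) (hε : Tendsto ε atTop (𝓝[>] 0))
    (hwave : ∀ ρ, IsTest (slab I) ρ → ∫ q, waveIntegrand κ (u ∘ charMap) (φ ∘ charMap) ρ q = 0)
    {χ : ℝ → ℝ} (hχ : IsTest₁ {0}ᶜ χ) {θ : ℝ → ℝ} (hθ : IsTest₁ I θ) :
    Tendsto (fun n => ∫ t, θ t • ∫ ξ in outer (ε n),
      ((deriv χ ξ * φ (charPt t ξ (ε n))) • (1 : ℝ)
        - (deriv χ ξ * φ (charPt t ξ (-ε n))) • (1 : ℝ))) atTop (𝓝 0) := by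
  obtain ⟨β, hβ, hβ1⟩ := exists_isTest₁_eventually_eq_one
  have hρ := isTest_tensorTest hθ (hχ.mono (subset_univ _)) hβ
  have hlim := (tendsto_integral_farAxes hε (integrable_waveIntegrand hw hρ)).neg
  rw [hwave _ hρ, neg_zero] at hlim
  refine hlim.congr' ?_
  filter_upwards [eventually_vanish_and_one hε hχ.2.2 hβ1] with n hn
  obtain ⟨hpos, c1, c2, b1, b2⟩ := hn
  rw [S.integral_waveIntegrand hρ hpos]
  simp only [pd_eX_tensorTest hρ, pd_eY_tensorTest hρ]
  simp only [tensorTest, c1, c2, b1, b2, mul_zero, zero_mul, sub_zero, add_zero, integral_zero,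
    neg_neg, mul_one, smul_eq_mul, Function.comp_apply, charMap_mk]
  refine integral_congr_ae (Eventually.of_forall fun t => ?_)
  simp only
  rw [← integral_const_mul]
  refine integral_congr_ae (Eventually.of_forall fun ξ => ?_)
  simp only
  ring

/-- The weak wave equation, tested near the axis `ξ = 0`. -/
theorem tendsto_wave_axis_xi (S : CharSolution κ I (u ∘ charMap) (φ ∘ charMap))
    (hw : WeakClass κ I u φ (pd eX u) (pd eY u)) (hε : Tendsto ε atTop (𝓝[>] 0))
    (hwave : ∀ ρ, IsTest (slab I) ρ → ∫ q, waveIntegrand κ (u ∘ charMap) (φ ∘ charMap) ρ q = 0)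
    {χ : ℝ → ℝ} (hχ : IsTest₁ {0}ᶜ χ) {θ : ℝ → ℝ} (hθ : IsTest₁ I θ) :
    Tendsto (fun n => ∫ t, θ t • ∫ ξ in outer (ε n),
      ((deriv χ ξ * -φ (reflectY (charPt t ξ (ε n)))) • (1 : ℝ)
        - (deriv χ ξ * -φ (reflectY (charPt t ξ (-ε n)))) • (1 : ℝ))) atTop (𝓝 0) := by
  obtain ⟨β, hβ, hβ1⟩ := exists_isTest₁_eventually_eq_one
  have hρ := isTest_tensorTest hθ hβ (hχ.mono (subset_univ _))
  have hlim := (tendsto_integral_farAxes hε (integrable_waveIntegrand hw hρ))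
  rw [hwave _ hρ] at hlim
  refine hlim.congr' ?_
  filter_upwards [eventually_vanish_and_one hε hχ.2.2 hβ1] with n hn
  obtain ⟨hpos, c1, c2, b1, b2⟩ := hn
  rw [S.integral_waveIntegrand hρ hpos]
  simp only [pd_eX_tensorTest hρ, pd_eY_tensorTest hρ]
  simp only [tensorTest, c1, c2, b1, b2, mul_zero, zero_mul, sub_zero, add_zero, integral_zero,
    neg_zero, zero_sub, mul_one, smul_eq_mul, Function.comp_apply, charMap_mk, reflectY_charPt]
  rw [← integral_neg]
  refine integral_congr_ae (Eventually.of_forall fun t => ?_)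
  simp only
  rw [← integral_const_mul, ← integral_neg]
  refine integral_congr_ae (Eventually.of_forall fun ξ => ?_)
  simp only
  ring

end

/-! ### Functions with vanishing distributional derivative -/

/-- A continuous function on the half line whose distributional derivative vanishes is constant. -/
theorem eq_of_forall_integral_deriv_mul_eq_zero {g : ℝ → ℝ} (hg : ContinuousOn g (Ioi 0))
    (h : ∀ χ, IsTest₁ (Ioi 0) χ → ∫ x, deriv χ x * g x = 0) :
    ∀ x > 0, ∀ y > 0, g x = g y := by
  -- Constancy is shown as invariance under every translation by `d`, since `ψ - ψ(· - d)` is the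
  -- derivative of a test function for every test function `ψ`.
  have key : ∀ d > 0, ∀ x > 0, g x - g (x + d) = 0 := by
    intro d hd
    have hgd : ContinuousOn (fun x => g (x + d)) (Ioi 0) :=
      hg.comp (by fun_prop) fun x hx => by
        have : (0 : ℝ) < x := hx
        exact add_pos this hd
    refine eq_zero_of_forall_isTest₁ isOpen_Ioi (hg.sub hgd) fun ψ hψ => ?_
    have hψc := hψ.1.continuous
    set Ψ : ℝ → ℝ := fun x => ∫ s in (0 : ℝ)..x, ψ s with hΨ
    have hd1 : ∀ x, HasDerivAt Ψ (ψ x) x := fun x => hψc.integral_hasStrictDerivAt 0 x |>.hasDerivAt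
    have hΨ' : deriv Ψ = ψ := funext fun x => (hd1 x).deriv
    have hΨs : ContDiff ℝ ∞ Ψ := contDiff_infty_iff_deriv.2
      ⟨fun x => (hd1 x).differentiableAt, by rw [hΨ']; exact hψ.1⟩
    obtain ⟨r, hr, hr0⟩ := exists_pos_le_abs_of_tsupport (χ := ψ)
      (hψ.2.2.trans fun x hx => ne_of_gt hx)
    obtain ⟨R, -, -, hR, -⟩ := exists_bound_of_hasCompactSupport hψc hψ.2.1
    have hneg : ∀ x ≤ r, ψ x = 0 := by
      intro x hx
      by_cases hx0 : 0 < x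
      · exact hr0 x (by rwa [abs_of_pos hx0])
      · exact image_eq_zero_of_notMem_tsupport fun h' => hx0 (hψ.2.2 h')
    have hΨ0 : ∀ x ≤ r, Ψ x = 0 := fun x hx => by
      rw [hΨ]
      simp only
      rw [intervalIntegral.integral_congr (g := fun _ => (0 : ℝ)), intervalIntegral.integral_zero]
      intro s hs
      exact hneg s (hs.2.trans (max_le hr.le hx))
    have hΨR : ∀ x ≥ |R|, Ψ x = Ψ |R| := fun x hx => by
      have := intervalIntegral.integral_interval_sub_left (hψc.intervalIntegrable 0 x)
        (hψc.intervalIntegrable (μ := volume) 0 |R|)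
      have h0 : ∫ s in |R|..x, ψ s = 0 := by
        rw [intervalIntegral.integral_congr (g := fun _ => (0 : ℝ)), intervalIntegral.integral_zero]
        intro s hs
        rw [uIcc_of_le hx] at hs
        exact hR s ((le_abs_self R).trans (hs.1.trans (le_abs_self s)))
      rw [h0] at this
      exact sub_eq_zero.1 this
    -- The primitive `Ψ` of `ψ` is zero near the origin and constant far out, so its difference with
    -- a translate to the right has compact support in the open half line.
    set χ : ℝ → ℝ := fun x => Ψ x - Ψ (x - d) with hχ
    have hχ0 : ∀ x, x ∉ Icc r (|R| + d) → χ x = 0 := by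
      intro x hx
      simp only [mem_Icc, not_and_or, not_le] at hx
      rcases hx with hx | hx
      · simp only [hχ]
        rw [hΨ0 x hx.le, hΨ0 (x - d) (by linarith), sub_zero]
      · simp only [hχ]
        rw [hΨR x (by linarith), hΨR (x - d) (by linarith), sub_self]
    have hts : tsupport χ ⊆ Icc r (|R| + d) :=
      closure_minimal (fun x hx => by by_contra h'; exact hx (hχ0 x h')) isClosed_Icc
    have hχt : IsTest₁ (Ioi 0) χ := by
      refine ⟨?_, HasCompactSupport.intro isCompact_Icc hχ0, hts.trans fun x hx => hr.trans_le hx.1⟩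
      exact hΨs.sub (hΨs.comp (contDiff_id.sub contDiff_const))
    have hderiv : deriv χ = fun x => ψ x - ψ (x - d) := by
      ext x
      exact ((hd1 x).sub ((hd1 (x - d)).comp_sub_const x d)).deriv
    have h0 := h χ hχt
    rw [hderiv] at h0
    have i1 : Integrable fun x => ψ x * g x :=
      integrable_smul_of_continuousOn isOpen_Ioi hψc.continuousOn hψ.2.1 hψ.2.2 hg
    have i2 : Integrable fun x => ψ x * g (x + d) :=
      integrable_smul_of_continuousOn isOpen_Ioi hψc.continuousOn hψ.2.1 hψ.2.2 hgd
    have i3 : Integrable fun x => ψ (x - d) * g x := by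
      simpa using i2.comp_sub_right d
    have e3 : ∫ x, ψ (x - d) * g x = ∫ x, ψ x * g (x + d) := by
      have := integral_sub_right_eq_self (μ := volume) (fun x => ψ x * g (x + d)) d
      simpa using this
    simp only [sub_mul, smul_eq_mul, mul_sub] at h0 ⊢
    rw [integral_sub i1 i3, e3] at h0
    rw [integral_sub i1 i2, h0]
  intro x hx y hy
  rcases lt_trichotomy x y with hxy | rfl | hxy
  · have := key (y - x) (sub_pos.2 hxy) x hx
    rw [add_sub_cancel] at this
    linarith
  · rfl
  · have := key (x - y) (sub_pos.2 hxy) y hy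
    rw [add_sub_cancel] at this
    linarith

theorem eq_of_forall_integral_deriv_mul_eq_zero_neg {g : ℝ → ℝ} (hg : ContinuousOn g (Iio 0))
    (h : ∀ χ, IsTest₁ (Iio 0) χ → ∫ x, deriv χ x * g x = 0) :
    ∀ x < 0, ∀ y < 0, g x = g y := by
  have h1 : ∀ x > 0, ∀ y > 0, g (-x) = g (-y) := by
    refine eq_of_forall_integral_deriv_mul_eq_zero (g := fun x => g (-x))
      (hg.comp (by fun_prop) fun x hx => neg_lt_zero.2 (mem_Ioi.1 hx)) fun χ hχ => ?_
    have ht : IsTest₁ (Iio 0) fun x => χ (-x) := by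
      refine ⟨hχ.1.comp contDiff_neg, hχ.2.1.comp_homeomorph (Homeomorph.neg ℝ), ?_⟩
      have : tsupport (fun x => χ (-x)) ⊆ Neg.neg ⁻¹' tsupport χ :=
        closure_minimal (fun q hq => subset_tsupport χ hq)
          ((isClosed_tsupport χ).preimage continuous_neg)
      exact fun x hx => mem_Iio.2 (neg_pos.1 (mem_Ioi.1 (hχ.2.2 (this hx))))
    have := h _ ht
    simp only [deriv_comp_neg] at this
    rw [← integral_neg_eq_self]
    simp only [neg_neg]
    simp only [neg_mul, integral_neg, neg_eq_zero] at this
    exact this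
  intro x hx y hy
  simpa using h1 (-x) (neg_pos.2 hx) (-y) (neg_pos.2 hy)


/-! ### The wave equation determines the coefficients on the axes -/

/-- The compatibility conditions on the field along the axis `η = 0`. -/
structure AxisCompat (φ₁ φ₂ : Cone → ℝ → ℝ → ℝ) (φ₃ : Cone → ℝ → ℝ → ℝ → ℝ) (t : ℝ) : Prop where
  jump_pos : ∀ x > 0, ∀ y > 0, jump1 φ₁ t x = jump1 φ₁ t y
  jump_neg : ∀ x < 0, ∀ y < 0, jump1 φ₁ t x = jump1 φ₁ t y
  phi2_pos : φ₂ .hPlus t 0 = φ₂ .vPlus t 0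
  phi2_neg : φ₂ .vMinus t 0 = φ₂ .hMinus t 0
  c1_const : ∀ x ≥ 0, ∀ y ≥ 0, c1 φ₃ t x = c1 φ₃ t y
  c3_const : ∀ x ≤ 0, ∀ y ≤ 0, c3 φ₃ t x = c3 φ₃ t y

/-- A logarithm does not extend continuously to the origin. -/
theorem eq_zero_and_eq_of_log_add {A k : ℝ} {f : ℝ → ℝ} (hf : ContinuousWithinAt f (Ici 0) 0)
    (h : ∀ x > 0, A * Real.log x + f x = k) : A = 0 ∧ ∀ x ≥ 0, f x = k := by
  have hf' : Tendsto f (𝓝[>] 0) (𝓝 (f 0)) := hf.mono_left (nhdsWithin_mono _ Ioi_subset_Ici_self)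
  have hs : Tendsto (fun n : ℕ => 1 / ((n : ℝ) + 1)) atTop (𝓝[>] 0) :=
    tendsto_nhdsWithin_iff.2 ⟨tendsto_one_div_add_atTop_nhds_zero_nat,
      Eventually.of_forall fun n => mem_Ioi.2 (by positivity)⟩
  have h1 : Tendsto (fun n : ℕ => Real.log (1 / ((n : ℝ) + 1)) • A + (f 0 - k)) atTop (𝓝 0) := by
    have h2 : Tendsto (fun n : ℕ => f 0 - f (1 / ((n : ℝ) + 1))) atTop (𝓝 (f 0 - f 0)) :=
      tendsto_const_nhds.sub (hf'.comp hs)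
    rw [sub_self] at h2
    refine h2.congr fun n => ?_
    rw [smul_eq_mul, ← h (1 / ((n : ℝ) + 1)) (by positivity)]
    ring
  have hA := eq_zero_of_tendsto_log (Real.tendsto_log_nhdsGT_zero.comp hs) h1
  refine ⟨hA.1, fun x hx => ?_⟩
  rcases eq_or_lt_of_le (show (0 : ℝ) ≤ x from hx) with rfl | hx
  · linarith [hA.2]
  · simpa [hA.1] using h x hx

section

variable {I : Set ℝ} {φ : ST → ℝ} {φ₁ φ₂ : Cone → ℝ → ℝ → ℝ} {φ₃ : Cone → ℝ → ℝ → ℝ → ℝ} {δ : ℝ}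
  {ε : ℕ → ℝ}

theorem FieldData.continuousOn_slice (h : FieldData I φ φ₁ φ₂ φ₃ δ) (c : Cone) {t : ℝ}
    (ht : t ∈ I) : ContinuousOn (φ₁ c t) {ξ | 0 ≤ c.sXi * ξ} :=
  (h.continuousOn_coeff₁ c).comp (f := fun ξ => (t, ξ)) (by fun_prop) fun _ hξ => ⟨ht, hξ⟩

theorem LogForm.continuousOn_slice₃ (h : LogForm I φ φ₁ φ₂ φ₃ δ) (c : Cone) {t : ℝ}
    (ht : t ∈ I) : ContinuousOn (fun ξ => φ₃ c t ξ 0) {ξ | 0 ≤ c.sXi * ξ} :=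
  (h.continuousOn_trace₃ c).comp (f := fun ξ => (t, ξ)) (by fun_prop) fun _ hξ => ⟨ht, hξ⟩

theorem LogForm.continuousOn_c1 (h : LogForm I φ φ₁ φ₂ φ₃ δ) {t : ℝ} (ht : t ∈ I) :
    ContinuousOn (c1 φ₃ t) (Ici 0) :=
  ((h.continuousOn_slice₃ .vPlus ht).mono fun ξ hξ => by simpa [Cone.sXi] using hξ).sub
    ((h.continuousOn_slice₃ .hPlus ht).mono fun ξ hξ => by simpa [Cone.sXi] using hξ)

theorem LogForm.continuousOn_c3 (h : LogForm I φ φ₁ φ₂ φ₃ δ) {t : ℝ} (ht : t ∈ I) :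
    ContinuousOn (c3 φ₃ t) (Iic 0) :=
  ((h.continuousOn_slice₃ .vMinus ht).mono fun ξ hξ => by simpa [Cone.sXi] using hξ).sub
    ((h.continuousOn_slice₃ .hMinus ht).mono fun ξ hξ => by simpa [Cone.sXi] using hξ)

/-- If the weak wave equation holds near the axis `η = 0`, the coefficients satisfy the
compatibility conditions there. -/
theorem FieldData.axisCompat (h : FieldData I φ φ₁ φ₂ φ₃ δ) (hε : Tendsto ε atTop (𝓝[>] 0))
    (H : ∀ χ, IsTest₁ {0}ᶜ χ → ∀ θ, IsTest₁ I θ →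
      Tendsto (fun n => ∫ t, θ t • ∫ ξ in outer (ε n),
      ((deriv χ ξ * φ (charPt t ξ (ε n))) • (1 : ℝ)
        - (deriv χ ξ * φ (charPt t ξ (-ε n))) • (1 : ℝ))) atTop (𝓝 0)) :
    ∀ t ∈ I, AxisCompat φ₁ φ₂ φ₃ t := by
  intro t ht
  -- `line_vanish` is applied with the coefficient `deriv χ` and the weight `1`. Both conclusions
  -- say that a distributional derivative in `ξ` vanishes away from the corner.
  have hv : ∀ χ, IsTest₁ {0}ᶜ χ → ∫ ξ, deriv χ ξ * jump1 φ₁ t ξ = 0 ∧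
      ∫ ξ, deriv χ ξ * (axisJump2 φ₂ t ξ * Real.log |ξ| + axisJump3 φ₃ t ξ) = 0 := by
    intro χ hχ
    have := h.line_vanish (lineWeight_one I δ) hε hχ.deriv.1.continuous hχ.deriv.2.1
      hχ.deriv.2.2 (H χ hχ) t ht
    simpa only [smul_eq_mul, mul_one] using this
  have hcut : ∀ {f : ℝ × ℝ → ℝ}, ContinuousOn f (I ×ˢ {0}ᶜ) →
      ContinuousOn (fun ξ => f (t, ξ)) {0}ᶜ := fun hf =>
    hf.comp (f := fun ξ => (t, ξ)) (by fun_prop) fun _ hξ => ⟨ht, hξ⟩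
  have hp : Ioi (0 : ℝ) ⊆ {0}ᶜ := fun x hx => ne_of_gt hx
  have hm : Iio (0 : ℝ) ⊆ {0}ᶜ := fun x hx => ne_of_lt hx
  have cj := hcut h.continuousOn_jump1
  have cl : ContinuousOn
      (fun ξ => axisJump2 φ₂ t ξ * Real.log |ξ| + axisJump3 φ₃ t ξ) {0}ᶜ :=
    ((hcut h.continuousOn_axisJump2).mul (ContinuousOn.log (by fun_prop)
      fun q hq => (abs_pos.2 hq).ne')).add (hcut h.continuousOn_axisJump3)
  have lp := eq_of_forall_integral_deriv_mul_eq_zero (cl.mono hp) fun χ hχ => (hv χ (hχ.mono hp)).2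
  have lm := eq_of_forall_integral_deriv_mul_eq_zero_neg (cl.mono hm)
    fun χ hχ => (hv χ (hχ.mono hm)).2
  -- On `ξ > 0` the constant is `(φ₂ .hPlus - φ₂ .vPlus)(t, 0) · log ξ - c₁(t, ξ)`, named by its
  -- value at `1`. As `c₁` is continuous up to the corner, the logarithm must drop out; so matching
  -- of `φ₂` at the origin is detected on the axis `η = 0`.
  have ap := eq_zero_and_eq_of_log_add (A := φ₂ .hPlus t 0 - φ₂ .vPlus t 0)
    (k := (fun ξ => axisJump2 φ₂ t ξ * Real.log |ξ| + axisJump3 φ₃ t ξ) 1)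
    (((h.log.continuousOn_c1 ht).neg) 0 self_mem_Ici) fun x hx => by
      refine Eq.trans ?_ (lp x hx 1 one_pos)
      simp [axisJump2, axisJump3, not_le.2 hx]
  have am := eq_zero_and_eq_of_log_add (A := φ₂ .vMinus t 0 - φ₂ .hMinus t 0)
    (f := fun x => c3 φ₃ t (-x))
    (k := (fun ξ => axisJump2 φ₂ t ξ * Real.log |ξ| + axisJump3 φ₃ t ξ) (-1))
    (((h.log.continuousOn_c3 ht).comp (f := fun x => -x) (s := Ici 0) (by fun_prop)
      fun x hx => neg_nonpos.2 (mem_Ici.1 hx)) 0 self_mem_Ici) fun x hx => by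
      refine Eq.trans ?_ (lm (-x) (neg_lt_zero.2 hx) (-1) (by norm_num))
      simp [axisJump2, axisJump3, le_of_lt hx]
  refine ⟨eq_of_forall_integral_deriv_mul_eq_zero (cj.mono hp) fun χ hχ => (hv χ (hχ.mono hp)).1,
    eq_of_forall_integral_deriv_mul_eq_zero_neg (cj.mono hm) fun χ hχ => (hv χ (hχ.mono hm)).1,
    sub_eq_zero.1 ap.1, sub_eq_zero.1 am.1, fun x hx y hy => ?_, fun x hx y hy => ?_⟩
  · exact neg_injective ((ap.2 x hx).trans (ap.2 y hy).symm)
  · have := (am.2 (-x) (neg_nonneg.2 hx)).trans (am.2 (-y) (neg_nonneg.2 hy)).symm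
    simpa using this

/-- The conditions on the field: continuity of the coefficients of the logarithms, and jumps that
depend only on time. -/
structure FieldCompat (φ₁ φ₂ : Cone → ℝ → ℝ → ℝ) (φ₃ : Cone → ℝ → ℝ → ℝ → ℝ) (t : ℝ) : Prop where
  phi1_minus : φ₁ .hMinus t 0 = φ₁ .vPlus t 0
  phi1_plus : φ₁ .vMinus t 0 = φ₁ .hPlus t 0
  phi2_minus : φ₂ .hMinus t 0 = φ₂ .vMinus t 0
  phi2_plus : φ₂ .vPlus t 0 = φ₂ .hPlus t 0
  jump1_const : ∀ x y, jump1 φ₁ t x = jump1 φ₁ t y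
  jump2_const : ∀ x y, jump2 φ₂ t x = jump2 φ₂ t y
  c1_const : ∀ x ≥ 0, ∀ y ≥ 0, c1 φ₃ t x = c1 φ₃ t y
  c2_const : ∀ x ≤ 0, ∀ y ≤ 0, c2 φ₃ t x = c2 φ₃ t y
  c3_const : ∀ x ≤ 0, ∀ y ≤ 0, c3 φ₃ t x = c3 φ₃ t y
  c4_const : ∀ x ≥ 0, ∀ y ≥ 0, c4 φ₃ t x = c4 φ₃ t y

theorem continuousAt_ite_zero {f g : ℝ → ℝ} (hf : ContinuousWithinAt f (Iic 0) 0)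
    (hg : ContinuousWithinAt g (Ici 0) 0) (h : f 0 = g 0) :
    ContinuousAt (fun x => if x ≤ 0 then f x else g x) 0 := by
  rw [continuousAt_iff_continuous_left_right]
  refine ⟨hf.congr (fun x hx => if_pos hx) (if_pos le_rfl), hg.congr (fun x hx => ?_) ?_⟩
  · rcases eq_or_lt_of_le (mem_Ici.1 hx) with rfl | hx
    · simpa using h
    · exact if_neg (not_le.2 hx)
  · simpa using h

theorem eq_of_continuousAt_ite_zero {f g : ℝ → ℝ} (hg : ContinuousWithinAt g (Ici 0) 0)
    (h : ContinuousAt (fun x => if x ≤ 0 then f x else g x) 0) : f 0 = g 0 := by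
  have h1 : Tendsto (fun x => if x ≤ 0 then f x else g x) (𝓝[>] 0) (𝓝 (f 0)) := by
    simpa using h.tendsto.mono_left nhdsWithin_le_nhds
  have h2 : Tendsto g (𝓝[>] 0) (𝓝 (g 0)) :=
    hg.mono_left (nhdsWithin_mono _ Ioi_subset_Ici_self)
  refine tendsto_nhds_unique (h1.congr' ?_) h2
  filter_upwards [self_mem_nhdsWithin] with x hx
  exact if_neg (not_le.2 hx)

theorem eq_of_const_half_lines {f : ℝ → ℝ} (hf : ContinuousAt f 0)
    (hp : ∀ x > 0, ∀ y > 0, f x = f y) (hm : ∀ x < 0, ∀ y < 0, f x = f y) : ∀ x y, f x = f y := by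
  have h0 : ∀ x, f x = f 0 := by
    intro x
    rcases lt_trichotomy x 0 with hx | rfl | hx
    · refine tendsto_nhds_unique (f := f) (l := 𝓝[<] 0) ?_
        (hf.tendsto.mono_left nhdsWithin_le_nhds)
      refine (tendsto_const_nhds (x := f x)).congr' ?_
      filter_upwards [self_mem_nhdsWithin] with y hy using hm x hx y hy
    · rfl
    · refine tendsto_nhds_unique (f := f) (l := 𝓝[>] 0) ?_
        (hf.tendsto.mono_left nhdsWithin_le_nhds)
      refine (tendsto_const_nhds (x := f x)).congr' ?_
      filter_upwards [self_mem_nhdsWithin] with y hy using hp x hx y hy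
  exact fun x y => (h0 x).trans (h0 y).symm

/-- Both branches are continuous up to the corner, so continuity of the glued function is equality
of two corner values. -/
theorem FieldData.continuousAt_phi1Minus (h : FieldData I φ φ₁ φ₂ φ₃ δ) {t : ℝ} (ht : t ∈ I)
    : ContinuousAt (phi1Minus φ₁ t) 0 ↔ φ₁ .hMinus t 0 = φ₁ .vPlus t 0 := by
  have h1 : ContinuousWithinAt (φ₁ .vPlus t) (Ici 0) 0 :=
    ((h.continuousOn_slice .vPlus ht).mono fun ξ hξ => by simpa [Cone.sXi] using hξ) 0 self_mem_Ici
  have h2 : ContinuousWithinAt (φ₁ .hMinus t) (Iic 0) 0 :=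
    ((h.continuousOn_slice .hMinus ht).mono fun ξ hξ => by simpa [Cone.sXi] using hξ) 0 self_mem_Iic
  exact ⟨eq_of_continuousAt_ite_zero h1, continuousAt_ite_zero h2 h1⟩

theorem FieldData.continuousAt_phi1Plus (h : FieldData I φ φ₁ φ₂ φ₃ δ) {t : ℝ} (ht : t ∈ I)
    : ContinuousAt (phi1Plus φ₁ t) 0 ↔ φ₁ .vMinus t 0 = φ₁ .hPlus t 0 := by
  have h1 : ContinuousWithinAt (φ₁ .hPlus t) (Ici 0) 0 :=
    ((h.continuousOn_slice .hPlus ht).mono fun ξ hξ => by simpa [Cone.sXi] using hξ) 0 self_mem_Ici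
  have h2 : ContinuousWithinAt (φ₁ .vMinus t) (Iic 0) 0 :=
    ((h.continuousOn_slice .vMinus ht).mono fun ξ hξ => by simpa [Cone.sXi] using hξ) 0 self_mem_Iic
  exact ⟨eq_of_continuousAt_ite_zero h1, continuousAt_ite_zero h2 h1⟩

theorem phi1Minus_swap (t : ℝ) : phi1Minus (swapCoeff φ₂) t = -phi2Minus φ₂ t := by
  ext ξ
  simp only [phi1Minus, phi2Minus, swapCoeff, Cone.swap, Pi.neg_apply]
  split_ifs <;> rfl

theorem phi1Plus_swap (t : ℝ) : phi1Plus (swapCoeff φ₂) t = -phi2Plus φ₂ t := by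
  ext ξ
  simp only [phi1Plus, phi2Plus, swapCoeff, Cone.swap, Pi.neg_apply]
  split_ifs <;> rfl

theorem continuousAt_neg_iff {f : ℝ → ℝ} {x : ℝ} : ContinuousAt (-f) x ↔ ContinuousAt f x :=
  ⟨fun h => by simpa using h.neg, fun h => h.neg⟩

theorem FieldData.continuousAt_phi2Minus (h : FieldData I φ φ₁ φ₂ φ₃ δ) {t : ℝ} (ht : t ∈ I)
    : ContinuousAt (phi2Minus φ₂ t) 0 ↔ φ₂ .hMinus t 0 = φ₂ .vMinus t 0 := by
  have := h.swap.continuousAt_phi1Minus ht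
  rw [phi1Minus_swap, continuousAt_neg_iff] at this
  simpa [swapCoeff, Cone.swap] using this

theorem FieldData.continuousAt_phi2Plus (h : FieldData I φ φ₁ φ₂ φ₃ δ) {t : ℝ} (ht : t ∈ I)
    : ContinuousAt (phi2Plus φ₂ t) 0 ↔ φ₂ .vPlus t 0 = φ₂ .hPlus t 0 := by
  have := h.swap.continuousAt_phi1Plus ht
  rw [phi1Plus_swap, continuousAt_neg_iff] at this
  simpa [swapCoeff, Cone.swap] using this

/-- The two axes need each other: along `η = 0` the jump `[φ₁]` is constant only on each half line,
while the matching of `φ₁` at the corner, which glues the two constants, comes from the axis `ξ =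
0`. The same holds with the roles exchanged. -/
theorem FieldData.fieldCompat (h : FieldData I φ φ₁ φ₂ φ₃ δ) {t : ℝ} (ht : t ∈ I)
    (h1 : AxisCompat φ₁ φ₂ φ₃ t) (h2 : AxisCompat (swapCoeff φ₂) (swapCoeff φ₁) (swapCoeff₃ φ₃) t) :
    FieldCompat φ₁ φ₂ φ₃ t := by
  have e1 : φ₁ .hMinus t 0 = φ₁ .vPlus t 0 := by
    simpa [swapCoeff, Cone.swap] using h2.phi2_neg.symm
  have e2 : φ₁ .vMinus t 0 = φ₁ .hPlus t 0 := by
    simpa [swapCoeff, Cone.swap] using h2.phi2_pos.symm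
  have e3 := h1.phi2_neg.symm
  have e4 := h1.phi2_pos.symm
  have c1 := h2.c1_const
  have c3 := h2.c3_const
  have jp := h2.jump_pos
  have jm := h2.jump_neg
  simp only [c1_swap, c3_swap, jump1_swap, neg_inj] at c1 c3 jp jm
  exact ⟨e1, e2, e3, e4, eq_of_const_half_lines
    (((h.continuousAt_phi1Plus ht).2 e2).sub ((h.continuousAt_phi1Minus ht).2 e1))
    h1.jump_pos h1.jump_neg, eq_of_const_half_lines
    (((h.continuousAt_phi2Plus ht).2 e4).sub ((h.continuousAt_phi2Minus ht).2 e3))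
    jp jm, h1.c1_const, c3, h1.c3_const, c1⟩

theorem FieldCompat.swap {t : ℝ} (h : FieldCompat φ₁ φ₂ φ₃ t) :
    FieldCompat (swapCoeff φ₂) (swapCoeff φ₁) (swapCoeff₃ φ₃) t := by
  have e : ∀ x, jump2 (swapCoeff φ₁) t x = -jump1 φ₁ t x := fun x => by
    simp only [jump1, jump2, phi1Plus, phi1Minus, phi2Plus, phi2Minus, swapCoeff, Cone.swap]
    split_ifs <;> ring
  have e2 : ∀ x, c2 (swapCoeff₃ φ₃) t x = c3 φ₃ t x := fun x => by
    simp only [c2, c3, swapCoeff₃, Cone.swap]; ring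
  have e4 : ∀ x, c4 (swapCoeff₃ φ₃) t x = c1 φ₃ t x := fun x => by
    simp only [c4, c1, swapCoeff₃, Cone.swap]; ring
  refine ⟨?_, ?_, ?_, ?_, ?_, ?_, ?_, ?_, ?_, ?_⟩
  · simpa [swapCoeff, Cone.swap] using h.phi2_minus
  · simpa [swapCoeff, Cone.swap] using h.phi2_plus
  · simpa [swapCoeff, Cone.swap] using h.phi1_minus
  · simpa [swapCoeff, Cone.swap] using h.phi1_plus
  · simpa [jump1_swap] using h.jump2_const
  · simpa [e] using h.jump1_const
  · simpa only [c1_swap] using h.c4_const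
  · simpa only [e2] using h.c3_const
  · simpa only [c3_swap] using h.c2_const
  · simpa only [e4] using h.c1_const

end


/-! ### The wave equation at the corner -/

/-- Exchange of the two characteristic coordinates. -/
def charSwap : ST ≃L[ℝ] ST :=
  (ContinuousLinearEquiv.refl ℝ ℝ).prodCongr (ContinuousLinearEquiv.prodComm ℝ ℝ ℝ)

theorem charSwap_mk (t ξ η : ℝ) : charSwap (t, ξ, η) = (t, η, ξ) := rfl

theorem pd_eX_charSwap (ρ : ST → ℝ) (t ξ η : ℝ) : pd eX (ρ ∘ charSwap) (t, ξ, η) = pd eY ρ (t, η, ξ) := by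
  rw [pd_comp]; rfl

theorem IsTest.charSwap {I : Set ℝ} {ρ : ST → ℝ} (hρ : IsTest (slab I) ρ) :
    IsTest (slab I) (ρ ∘ charSwap) := hρ.comp fun _ => rfl

/-- The times at which a test function does not vanish. -/
def timeSupport (ρ : ST → ℝ) : Set ℝ := Prod.fst '' tsupport ρ

section

variable {I : Set ℝ} {ρ : ST → ℝ}

theorem IsTest.isCompact_timeSupport (hρ : IsTest (slab I) ρ) : IsCompact (timeSupport ρ) :=
  hρ.2.1.isCompact.image continuous_fst

theorem IsTest.timeSupport_subset (hρ : IsTest (slab I) ρ) : timeSupport ρ ⊆ I := by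
  rintro _ ⟨q, hq, rfl⟩
  exact hρ.2.2 hq

theorem eq_zero_of_notMem_timeSupport {q : ST} (hq : q.1 ∉ timeSupport ρ) : ρ q = 0 :=
  image_eq_zero_of_notMem_tsupport fun h => hq ⟨q, h, rfl⟩

theorem pd_eq_zero_of_notMem_timeSupport {q : ST} (hq : q.1 ∉ timeSupport ρ) (e : ST) :
    pd e ρ q = 0 :=
  image_eq_zero_of_notMem_tsupport fun h => hq ⟨q, tsupport_pd_subset _ _ h, rfl⟩

theorem IsTest.exists_lineTest (hρ : IsTest (slab I) ρ) :
    ∃ R G : ℝ, ∀ K, LineTest K R G fun t ξ η => ρ (t, ξ, η) := by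
  obtain ⟨C, hC⟩ := ContDiff.lipschitzWith_of_hasCompactSupport hρ.2.1 hρ.1 (by simp)
  obtain ⟨G, hG⟩ := hρ.2.1.exists_bound_of_continuous hρ.1.continuous
  obtain ⟨R, hR⟩ := hρ.2.1.isCompact.isBounded.subset_closedBall 0
  refine ⟨R + 1, max G C, fun K => ⟨fun t _ ξ => (hG _).trans (le_max_left _ _),
    fun t _ ξ η => ?_, fun t _ ξ hξ η => ?_⟩⟩
  · have := hC.dist_le_mul (t, ξ, η) (t, ξ, 0)
    simp only [Prod.dist_eq, dist_self, Real.dist_eq, sub_zero, abs_nonneg, sup_of_le_right] at this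
    exact this.trans (mul_le_mul_of_nonneg_right (le_max_right _ _) (abs_nonneg _))
  · refine image_eq_zero_of_notMem_tsupport fun h => ?_
    have := hR h
    simp only [Metric.mem_closedBall, dist_zero_right, Prod.norm_def, Real.norm_eq_abs,
      sup_le_iff] at this
    linarith [this.2.1]

theorem IsTest.isTest₁_corner (hρ : IsTest (slab I) ρ) : IsTest₁ I fun t => ρ (t, 0, 0) := by
  have hs : tsupport (fun t => ρ (t, 0, 0)) ⊆ (fun t : ℝ => ((t, 0, 0) : ST)) ⁻¹' tsupport ρ :=
    closure_minimal (fun t ht => subset_tsupport ρ ht)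
      ((isClosed_tsupport ρ).preimage (by fun_prop))
  refine ⟨hρ.1.comp (by fun_prop), hasCompactSupport_slice hρ.2.1 Prod.fst continuous_fst
    fun _ => rfl, fun t ht => hρ.2.2 (hs ht)⟩

end

/-- Dominated convergence with the bound `‖G‖ + 1` on the compact set `K`. Measurability is asked
only eventually, so that lines which do not avoid the axes may be disregarded. -/
theorem tendsto_integral_of_tendstoUniformlyOn {E : Type*} [NormedAddCommGroup E] [NormedSpace ℝ E]
    {K : Set ℝ} (hK : IsCompact K) {F : ℕ → ℝ → E} {G : ℝ → E}
    (hm : ∀ᶠ n in atTop, AEStronglyMeasurable (F n)) (hz : ∀ n, ∀ t ∉ K, F n t = 0)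
    (hGz : ∀ t ∉ K, G t = 0) (hG : Integrable G) (hu : TendstoUniformlyOn F G atTop K) :
    Tendsto (fun n => ∫ t, F n t) atTop (𝓝 (∫ t, G t)) := by
  refine tendsto_integral_filter_of_dominated_convergence (K.indicator fun t => ‖G t‖ + 1) hm ?_ ?_ ?_
  · filter_upwards [Metric.tendstoUniformlyOn_iff.1 hu 1 one_pos] with n hn
    refine Eventually.of_forall fun t => ?_
    by_cases ht : t ∈ K
    · rw [indicator_of_mem ht]
      have := hn t ht
      rw [dist_eq_norm_sub'] at this
      linarith [norm_le_norm_add_norm_sub' (F n t) (G t)]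
    · rw [indicator_of_notMem ht, hz n t ht, norm_zero]
  · rw [integrable_indicator_iff hK.measurableSet]
    exact hG.norm.integrableOn.add (integrableOn_const hK.measure_lt_top.ne)
  · refine Eventually.of_forall fun t => ?_
    by_cases ht : t ∈ K
    · exact hu.tendsto_at ht
    · simp only [hz _ t ht, hGz t ht]
      exact tendsto_const_nhds

theorem aestronglyMeasurable_integral_outer {F : ℝ → ℝ → ℝ} {r : ℝ} (hr : 0 ≤ r)
    (hF : ContinuousOn (fun q : ℝ × ℝ => F q.1 q.2) (univ ×ˢ {0}ᶜ)) :
    AEStronglyMeasurable fun t => ∫ ξ in outer r, F t ξ := by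
  have h1 : AEStronglyMeasurable (fun q : ℝ × ℝ => F q.1 q.2)
      ((volume : Measure ℝ).prod (volume.restrict (outer r))) := by
    have h2 : (volume : Measure ℝ).prod (volume.restrict (outer r)) =
        (volume : Measure (ℝ × ℝ)).restrict (univ ×ˢ outer r) := by
      rw [Measure.volume_eq_prod, ← Measure.prod_restrict, Measure.restrict_univ]
    rw [h2]
    exact (hF.mono (prod_mono_right fun x hx => ne_zero_of_mem_outer hr hx)).aestronglyMeasurable
      (MeasurableSet.univ.prod (measurableSet_outer r))
  exact h1.integral_prod_right'

section

variable {I : Set ℝ} {φ : ST → ℝ} {φ₁ φ₂ : Cone → ℝ → ℝ → ℝ} {φ₃ : Cone → ℝ → ℝ → ℝ → ℝ} {δ : ℝ}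
  {ε : ℕ → ℝ} {ρ : ST → ℝ}

theorem FieldData.continuousOn_test_mul (h : FieldData I φ φ₁ φ₂ φ₃ δ) (hρ : IsTest (slab I) ρ) :
    ContinuousOn (fun q : ST => ρ q * φ (charPt q.1 q.2.1 q.2.2)) offAxes := by
  intro q hq
  by_cases hs : q ∈ slab I
  · have h1 : ContinuousAt φ (charMap q) :=
      h.cont.continuousAt ((isOpen_offCross h.isOpen).mem_nhds (charMap_mem_offCross.2 ⟨hs, hq⟩))
    exact (hρ.1.continuous.continuousAt.mul
      (h1.comp (f := charMap) charMap.continuous.continuousAt)).continuousWithinAt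
  · have h0 : ρ =ᶠ[𝓝 q] 0 := notMem_tsupport_iff_eventuallyEq.1 fun h => hs (hρ.2.2 h)
    refine (continuousAt_const (y := (0 : ℝ))).congr ?_ |>.continuousWithinAt
    filter_upwards [h0] with y hy
    simp [hy]

theorem FieldData.continuousOn_line (h : FieldData I φ φ₁ φ₂ φ₃ δ) (hρ : IsTest (slab I) ρ) {s : ℝ}
    (hs : s ≠ 0) :
    ContinuousOn (fun q : ℝ × ℝ => ρ (q.1, q.2, s) * φ (charPt q.1 q.2 s)) (univ ×ˢ {0}ᶜ) :=
  (h.continuousOn_test_mul hρ).comp (f := fun q : ℝ × ℝ => ((q.1, q.2, s) : ST)) (by fun_prop)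
    fun _ hq => ⟨hq.2, hs⟩

/-- For a compatible field these values at one point stand for the functions along the axis. The
jump is taken at `1`, since `continuousOn_jump1` gives its continuity in time only off the corner.
-/
theorem FieldData.exists_bound_jump (h : FieldData I φ φ₁ φ₂ φ₃ δ) {K : Set ℝ} (hKI : K ⊆ I)
    (hK : IsCompact K) : ∃ C : ℝ, 0 ≤ C ∧ ∀ t ∈ K, |jump1 φ₁ t 1| ≤ C ∧ |c1 φ₃ t 0| ≤ C ∧
      |c3 φ₃ t 0| ≤ C := by
  have hcut : ∀ {f : ℝ × ℝ → ℝ} {s : Set ℝ} {x : ℝ}, x ∈ s → ContinuousOn f (I ×ˢ s) →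
      ContinuousOn (fun t => f (t, x)) K := fun hx hf =>
    hf.comp (f := fun t => (t, _)) (by fun_prop) fun t ht => ⟨hKI ht, hx⟩
  have tr := fun c => hcut (x := 0) (by simp) (h.log.continuousOn_trace₃ c)
  obtain ⟨A, hA⟩ := hK.exists_bound_of_continuousOn
    (hcut (x := 1) (by simp) h.continuousOn_jump1)
  obtain ⟨B, hB⟩ := hK.exists_bound_of_continuousOn (f := fun t => c1 φ₃ t 0)
    ((tr .vPlus).sub (tr .hPlus))
  obtain ⟨D, hD⟩ := hK.exists_bound_of_continuousOn (f := fun t => c3 φ₃ t 0)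
    ((tr .vMinus).sub (tr .hMinus))
  simp only [Real.norm_eq_abs] at hA hB hD
  refine ⟨|A| + |B| + |D|, by positivity, fun t ht => ⟨?_, ?_, ?_⟩⟩
  · linarith [hA t ht, le_abs_self A, abs_nonneg B, abs_nonneg D]
  · linarith [hB t ht, le_abs_self B, abs_nonneg A, abs_nonneg D]
  · linarith [hD t ht, le_abs_self D, abs_nonneg A, abs_nonneg B]

theorem tendsto_mul_abs_log_add (hε : Tendsto ε atTop (𝓝[>] 0)) (a b : ℝ) :
    Tendsto (fun n => a * (ε n * |Real.log (ε n)|) + b * ε n) atTop (𝓝 0) := by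
  have l1 := (tendsto_rpow_mul_abs_log one_pos).comp hε
  have l3 := tendsto_nhds_of_tendsto_nhdsWithin hε
  have := (l1.const_mul a).add (l3.const_mul b)
  simp only [mul_zero, add_zero] at this
  exact this.congr fun n => by simp

/-- The coefficient of the jump is piecewise constant along the axis. -/
theorem FieldCompat.jumpCoeff_eq {t : ℝ} (h : FieldCompat φ₁ φ₂ φ₃ t) (s ξ : ℝ) :
    jumpCoeff φ₁ φ₂ φ₃ s t ξ = Real.log s * jump1 φ₁ t 1 +
      if ξ ≤ 0 then c3 φ₃ t 0 else -c1 φ₃ t 0 := by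
  simp only [jumpCoeff, axisJump2, axisJump3, h.phi2_minus, h.phi2_plus, sub_self, ite_self,
    zero_mul, add_zero]
  rw [h.jump1_const ξ 1]
  split_ifs with hξ
  · rw [h.c3_const ξ hξ 0 le_rfl]
  · rw [h.c1_const ξ (not_le.1 hξ).le 0 le_rfl]

theorem integral_outer_pd_mul_ite (hρ : IsTest (slab I) ρ) (t a b : ℝ) {r : ℝ} (hr : 0 < r) :
    IntegrableOn (fun ξ => pd eX ρ (t, ξ, 0) * if ξ ≤ 0 then a else b) (outer r) ∧
    ∫ ξ in outer r, (pd eX ρ (t, ξ, 0) * if ξ ≤ 0 then a else b) =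
      ρ (t, -r, 0) * a - ρ (t, r, 0) * b := by
  have hsl : ∀ {f : ST → ℝ}, HasCompactSupport f → HasCompactSupport fun ξ => f (t, ξ, 0) :=
    fun hf => hasCompactSupport_slice hf (fun q => q.2.1) (by fun_prop) fun _ => rfl
  have hd : ∀ x, HasDerivAt (fun ξ => ρ (t, ξ, 0)) (pd eX ρ (t, x, 0)) x := by
    intro x
    rw [pd_eX_eq_deriv (hρ.1.contDiffAt.differentiableAt (by simp))]
    refine DifferentiableAt.hasDerivAt ?_
    have : ContDiff ℝ ∞ fun ξ => ρ (t, ξ, 0) := hρ.1.comp (by fun_prop)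
    exact this.contDiffAt.differentiableAt (by simp)
  have hc : Continuous fun ξ => pd eX ρ (t, ξ, 0) := (hρ.pd eX).1.continuous.comp (by fun_prop)
  have hite : ∀ x : ℝ, x ≠ 0 → (fun ξ : ℝ => if ξ ≤ 0 then a else b) =ᶠ[𝓝 x] fun _ => if x ≤ 0 then a else b := by
    intro x hx
    rcases lt_or_gt_of_ne hx with h | h
    · filter_upwards [Iio_mem_nhds h] with y hy
      simp [h.le, (mem_Iio.1 hy).le]
    · filter_upwards [Ioi_mem_nhds h] with y hy
      simp [h.not_ge, (mem_Ioi.1 hy).not_ge]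
  have hcont : ContinuousOn (fun ξ => pd eX ρ (t, ξ, 0) * if ξ ≤ 0 then a else b) {0}ᶜ :=
    hc.continuousOn.mul fun x hx =>
      (continuousAt_const.congr (hite x hx).symm).continuousWithinAt
  have hcs : HasCompactSupport fun ξ => pd eX ρ (t, ξ, 0) * if ξ ≤ 0 then a else b :=
    (hsl (hρ.pd eX).2.1).mul_right
  refine ⟨integrableOn_outer hcont hcs hr, ?_⟩
  rw [integral_outer_deriv (f := fun ξ => ρ (t, ξ, 0) * if ξ ≤ 0 then a else b) ?_ hcont
    (hsl hρ.2.1).mul_right hcs hr]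
  · simp [hr.le, hr.not_ge]
  · intro x hx
    exact ((hd x).mul_const _).congr_of_eventuallyEq ((hite x hx).mono fun y hy => by
      simp only at hy ⊢; rw [hy])

/-- Boundary terms of the wave equation along the axis `η = 0`. -/
theorem FieldData.tendsto_wave_line (h : FieldData I φ φ₁ φ₂ φ₃ δ) (hε : Tendsto ε atTop (𝓝[>] 0))
    (hc : ∀ t ∈ I, FieldCompat φ₁ φ₂ φ₃ t) (hρ : IsTest (slab I) ρ) {K : Set ℝ} (hKI : K ⊆ I)
    (hK : IsCompact K) :
    TendstoUniformlyOn (fun n t => ∫ ξ in outer (ε n),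
      (pd eX ρ (t, ξ, ε n) * φ (charPt t ξ (ε n)) - pd eX ρ (t, ξ, -ε n) * φ (charPt t ξ (-ε n))))
      (fun t => (c1 φ₃ t 0 + c3 φ₃ t 0) * ρ (t, 0, 0)) atTop K := by
  obtain ⟨R, G, hg⟩ := (hρ.pd eX).exists_lineTest
  have h1 := h.log.tendsto_line h.pos hε (lineWeight_one I δ) hKI hK (hg K)
  simp only [smul_eq_mul, mul_one] at h1
  -- `LineTest` controls the variation in its last variable; exchanging the coordinates gives the
  -- Lipschitz bound in `ξ` at `η = 0`.
  obtain ⟨R', G', hg'⟩ := hρ.charSwap.exists_lineTest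
  have hg' := hg' K
  simp only [Function.comp_apply, charSwap_mk] at hg'
  obtain ⟨C, hC, hCb⟩ := h.exists_bound_jump hKI hK
  -- As `jumpCoeff` is constant on each half line, integrating `ρ_ξ` against it leaves the values at
  -- `ξ = ±ε_n`. The logarithms combine to `log ε_n · [φ₁] · (ρ(t, -ε_n, 0) - ρ(t, ε_n, 0)) = O(ε_n
  -- |log ε_n|)`, and the finite parts give the limit.
  have h2 : TendstoUniformlyOn (fun n t =>
      ρ (t, -ε n, 0) * (Real.log (ε n) * jump1 φ₁ t 1 + c3 φ₃ t 0)
        - ρ (t, ε n, 0) * (Real.log (ε n) * jump1 φ₁ t 1 + -c1 φ₃ t 0))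
      (fun t => (c1 φ₃ t 0 + c3 φ₃ t 0) * ρ (t, 0, 0)) atTop K := by
    rw [Metric.tendstoUniformlyOn_iff]
    intro e he
    filter_upwards [(tendsto_mul_abs_log_add hε (2 * C * G') (2 * C * G')).eventually_lt_const he,
      hε.eventually self_mem_nhdsWithin] with n hn hpos t ht
    refine lt_of_le_of_lt ?_ hn
    have hpos : 0 < ε n := hpos
    obtain ⟨b1, b2, b3⟩ := hCb t ht
    have l1 := hg'.lip t ht 0 (ε n)
    have l2 := hg'.lip t ht 0 (-ε n)
    rw [abs_neg] at l2
    rw [abs_of_pos hpos] at l1 l2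
    rw [dist_comm, Real.dist_eq]
    have : ρ (t, -ε n, 0) * (Real.log (ε n) * jump1 φ₁ t 1 + c3 φ₃ t 0)
        - ρ (t, ε n, 0) * (Real.log (ε n) * jump1 φ₁ t 1 + -c1 φ₃ t 0)
        - (c1 φ₃ t 0 + c3 φ₃ t 0) * ρ (t, 0, 0) =
        (ρ (t, -ε n, 0) - ρ (t, 0, 0)) * (Real.log (ε n) * jump1 φ₁ t 1 + c3 φ₃ t 0)
        - (ρ (t, ε n, 0) - ρ (t, 0, 0)) * (Real.log (ε n) * jump1 φ₁ t 1 + -c1 φ₃ t 0) := by ring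
    rw [this]
    have aux : ∀ c, |c| ≤ C → |Real.log (ε n) * jump1 φ₁ t 1 + c| ≤ |Real.log (ε n)| * C + C := by
      intro c hc'
      refine (abs_add_le _ _).trans (add_le_add ?_ hc')
      rw [abs_mul]
      exact mul_le_mul_of_nonneg_left b1 (abs_nonneg _)
    have hG' : 0 ≤ G' * ε n := (abs_nonneg _).trans l1
    calc _ ≤ G' * ε n * (|Real.log (ε n)| * C + C) + G' * ε n * (|Real.log (ε n)| * C + C) := by
          refine (abs_sub _ _).trans (add_le_add ?_ ?_)
          · rw [abs_mul]
            exact mul_le_mul l2 (aux _ b3) (abs_nonneg _) hG'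
          · rw [abs_mul]
            exact mul_le_mul l1 (aux _ (by rwa [abs_neg])) (abs_nonneg _) hG'
      _ = _ := by ring
  have h3 := h1.add h2
  refine (h3.congr ?_).congr_right fun t _ => by simp
  filter_upwards [hε.eventually self_mem_nhdsWithin] with n hpos t ht
  have hpos : 0 < ε n := hpos
  have hi : ∀ s ≠ 0, IntegrableOn (fun ξ => pd eX ρ (t, ξ, s) * φ (charPt t ξ s)) (outer (ε n)) := by
    intro s hs
    refine integrableOn_outer ?_ ?_ hpos
    · exact (h.continuousOn_line (hρ.pd eX) hs).comp (f := fun ξ => (t, ξ)) (by fun_prop)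
        fun _ hξ => ⟨mem_univ _, hξ⟩
    · exact HasCompactSupport.mul_right
        (hasCompactSupport_slice (hρ.pd eX).2.1 (fun q => q.2.1) (by fun_prop) fun _ => rfl)
  have hj := integral_outer_pd_mul_ite hρ t (Real.log (ε n) * jump1 φ₁ t 1 + c3 φ₃ t 0)
    (Real.log (ε n) * jump1 φ₁ t 1 + -c1 φ₃ t 0) hpos
  have he : ∀ ξ, jumpCoeff φ₁ φ₂ φ₃ (ε n) t ξ = if ξ ≤ 0 then
      Real.log (ε n) * jump1 φ₁ t 1 + c3 φ₃ t 0 else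
      Real.log (ε n) * jump1 φ₁ t 1 + -c1 φ₃ t 0 := fun ξ => by
    rw [(hc t (hKI ht)).jumpCoeff_eq]; split_ifs <;> rfl
  simp only [Pi.add_apply, he]
  rw [integral_sub (f := fun ξ => pd eX ρ (t, ξ, ε n) * φ (charPt t ξ (ε n))
    - pd eX ρ (t, ξ, -ε n) * φ (charPt t ξ (-ε n))) ((hi _ hpos.ne').sub (hi _ (neg_ne_zero.2 hpos.ne'))) hj.1, hj.2]
  ring

/-- Corner terms of the wave equation. -/
theorem FieldData.tendsto_wave_corner (h : FieldData I φ φ₁ φ₂ φ₃ δ)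
    (hε : Tendsto ε atTop (𝓝[>] 0)) (hc : ∀ t ∈ I, FieldCompat φ₁ φ₂ φ₃ t)
    (hρ : IsTest (slab I) ρ) {K : Set ℝ} (hKI : K ⊆ I) (hK : IsCompact K) :
    TendstoUniformlyOn (fun n t =>
      ρ (t, ε n, ε n) * φ (charPt t (ε n) (ε n)) + ρ (t, -ε n, -ε n) * φ (charPt t (-ε n) (-ε n))
        - ρ (t, ε n, -ε n) * φ (charPt t (ε n) (-ε n))
        - ρ (t, -ε n, ε n) * φ (charPt t (-ε n) (ε n)))
      (fun t => -(c1 φ₃ t 0 + c3 φ₃ t 0) * ρ (t, 0, 0)) atTop K := by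
  obtain ⟨L, hL⟩ := ContDiff.lipschitzWith_of_hasCompactSupport hρ.2.1 hρ.1 (by simp)
  obtain ⟨G, hG⟩ := hρ.2.1.exists_bound_of_continuous hρ.1.continuous
  simp only [Real.norm_eq_abs] at hG
  have hG0 : 0 ≤ G := (abs_nonneg _).trans (hG 0)
  obtain ⟨C, hC, hCb⟩ := h.log.line_bound hKI hK 1
  rw [Metric.tendstoUniformlyOn_iff]
  intro e he
  have he' : 0 < e / (4 * (G + 1)) := by positivity
  -- Each of the four corner values costs `L ε_n · C |log ε_n|` when `ρ` is moved to the corner. The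
  -- bounds and expansions of the field are used at `|ξ| = ε_n`, the extreme case of `s ≤ |ξ|`.
  filter_upwards [(tendsto_mul_abs_log_add hε (4 * L * C) 0).eventually_lt_const (half_pos he),
    hε.eventually (eventually_mem_Ioo one_pos), hε.eventually hCb,
    hε.eventually (h.log.line_expansion h.pos hKI hK 1 he')] with n hn hpos hb hx t ht
  have habs : |ε n| = ε n := abs_of_pos hpos.1
  obtain ⟨p1, p2⟩ := hb t ht (ε n) habs.ge (habs.trans_le hpos.2.le)
  obtain ⟨p3, p4⟩ := hb t ht (-ε n) (by rw [abs_neg, habs]) (by rw [abs_neg, habs]; exact hpos.2.le)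
  have q1 := hx t ht (ε n) habs.ge (habs.trans_le hpos.2.le)
  have q2 := hx t ht (-ε n) (by rw [abs_neg, habs]) (by rw [abs_neg, habs]; exact hpos.2.le)
  rw [(hc t (hKI ht)).jumpCoeff_eq, if_neg hpos.1.not_ge] at q1
  rw [(hc t (hKI ht)).jumpCoeff_eq, if_pos (by linarith [hpos.1])] at q2
  have hl : ∀ a b : ℝ, |a| = ε n → |b| = ε n → |ρ (t, a, b) - ρ (t, 0, 0)| ≤ L * ε n := by
    intro a b ha hb'
    have := hL.dist_le_mul (t, a, b) (t, 0, 0)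
    simpa [Prod.dist_eq, Real.dist_eq, ha, hb', hpos.1.le] using this
  have hm : ∀ {a b : ℝ}, |a| = ε n → |b| = ε n → |φ (charPt t a b)| ≤ C * |Real.log (ε n)| →
      |(ρ (t, a, b) - ρ (t, 0, 0)) * φ (charPt t a b)| ≤ L * ε n * (C * |Real.log (ε n)|) := by
    intro a b ha hb' hp
    rw [abs_mul]
    exact mul_le_mul (hl a b ha hb') hp (abs_nonneg _) ((abs_nonneg _).trans (hl a b ha hb'))
  have habs' : |-ε n| = ε n := by rw [abs_neg, habs]
  have m1 := hm habs habs p1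
  have m2 := hm habs habs' p2
  have m3 := hm habs' habs p3
  have m4 := hm habs' habs' p4
  set P1 := φ (charPt t (ε n) (ε n))
  set P2 := φ (charPt t (ε n) (-ε n))
  set P3 := φ (charPt t (-ε n) (ε n))
  set P4 := φ (charPt t (-ε n) (-ε n))
  -- The corner sum is the jump of `φ` at `ξ = ε_n` minus the jump at `ξ = -ε_n`. Since `[φ₁]` is
  -- the same on both half lines the logarithms cancel, and `-c₁ - c₃` remains.
  have hsum : |ρ (t, 0, 0) * ((P1 - P2 - (Real.log (ε n) * jump1 φ₁ t 1 + -c1 φ₃ t 0))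
      - (P3 - P4 - (Real.log (ε n) * jump1 φ₁ t 1 + c3 φ₃ t 0)))| ≤ e / 2 := by
    rw [abs_mul]
    have : |(P1 - P2 - (Real.log (ε n) * jump1 φ₁ t 1 + -c1 φ₃ t 0))
      - (P3 - P4 - (Real.log (ε n) * jump1 φ₁ t 1 + c3 φ₃ t 0))| ≤
        2 * (e / (4 * (G + 1))) := (abs_sub _ _).trans (by linarith)
    refine (mul_le_mul (hG _) this (abs_nonneg _) hG0).trans ?_
    have e1 : G * (2 * (e / (4 * (G + 1)))) = (e / 2) * (G / (G + 1)) := by field_simp; ring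
    rw [e1]
    exact mul_le_of_le_one_right (by positivity) (div_le_one_of_le₀ (by linarith) (by linarith))
  rw [dist_comm, Real.dist_eq, abs_lt]
  rw [abs_le] at m1 m2 m3 m4 hsum
  constructor <;> linarith [m1.1, m1.2, m2.1, m2.2, m3.1, m3.2, m4.1, m4.2, hsum.1, hsum.2]

end


section

variable {κ : Target} {I : Set ℝ} {u : ST → V3} {φ : ST → ℝ} {φ₁ φ₂ : Cone → ℝ → ℝ → ℝ}
  {φ₃ : Cone → ℝ → ℝ → ℝ → ℝ} {δ : ℝ} {ε : ℕ → ℝ}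

/-- If the field is compatible along the axes, the wave equation holds up to a source on the line
`ξ = η = 0`. -/
theorem FieldData.integral_waveIntegrand (h : FieldData I φ φ₁ φ₂ φ₃ δ)
    (S : CharSolution κ I (u ∘ charMap) (φ ∘ charMap))
    (hw : WeakClass κ I u φ (pd eX u) (pd eY u)) (hε : Tendsto ε atTop (𝓝[>] 0))
    (hc : ∀ t ∈ I, FieldCompat φ₁ φ₂ φ₃ t) {ρ : ST → ℝ} (hρ : IsTest (slab I) ρ) :
    ∫ q, waveIntegrand κ (u ∘ charMap) (φ ∘ charMap) ρ q =
      ∫ t, -(c1 φ₃ t 0 + c3 φ₃ t 0) * ρ (t, 0, 0) := by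
  have hKI := hρ.timeSupport_subset
  have hK := hρ.isCompact_timeSupport
  have hcont : ContinuousOn (fun t => c1 φ₃ t 0 + c3 φ₃ t 0) I := by
    have tr : ∀ c, ContinuousOn (fun t => φ₃ c t 0 0) I := fun c =>
      (h.log.continuousOn_trace₃ c).comp (f := fun t => (t, 0)) (by fun_prop)
        fun t ht => ⟨ht, by simp⟩
    exact ((tr .vPlus).sub (tr .hPlus)).add ((tr .vMinus).sub (tr .hMinus))
  have hρ₁ := hρ.isTest₁_corner
  have hint : Integrable fun t => (c1 φ₃ t 0 + c3 φ₃ t 0) * ρ (t, 0, 0) := by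
    have := integrable_smul_of_continuousOn h.isOpen hρ₁.1.continuous.continuousOn hρ₁.2.1 hρ₁.2.2
      hcont
    exact this.congr (Eventually.of_forall fun t => by simp [mul_comm])
  have hz : ∀ {t : ℝ}, t ∉ timeSupport ρ → ∀ ξ η, ρ (t, ξ, η) = 0 := fun ht ξ η =>
    eq_zero_of_notMem_timeSupport ht
  have hzp : ∀ {t : ℝ}, t ∉ timeSupport ρ → ∀ e ξ η, pd e ρ (t, ξ, η) = 0 := fun ht e ξ η =>
    pd_eq_zero_of_notMem_timeSupport ht e
  -- At the corner `c₁ + c₂ + c₃ + c₄ = 0`, because each `φ₃(t, 0, 0)` occurs once with each sign.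
  have hsum : ∀ t, c1 (swapCoeff₃ φ₃) t 0 + c3 (swapCoeff₃ φ₃) t 0 =
      -(c1 φ₃ t 0 + c3 φ₃ t 0) := fun t => by
    rw [c1_swap, c3_swap]; simp only [c1, c2, c3, c4]; ring
  have hint' : Integrable fun t => -(c1 φ₃ t 0 + c3 φ₃ t 0) * ρ (t, 0, 0) :=
    hint.neg.congr (Eventually.of_forall fun t => (neg_mul _ _).symm)
  have m1 : ∀ᶠ n in atTop, AEStronglyMeasurable fun t => ∫ ξ in outer (ε n),
      (pd eX ρ (t, ξ, ε n) * φ (charPt t ξ (ε n))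
        - pd eX ρ (t, ξ, -ε n) * φ (charPt t ξ (-ε n))) := by
    filter_upwards [hε.eventually self_mem_nhdsWithin] with n hpos
    have hpos : 0 < ε n := hpos
    exact aestronglyMeasurable_integral_outer (F := fun t ξ =>
      (pd eX ρ (t, ξ, ε n) * φ (charPt t ξ (ε n))
        - pd eX ρ (t, ξ, -ε n) * φ (charPt t ξ (-ε n)))) hpos.le
      ((h.continuousOn_line (hρ.pd eX) hpos.ne').sub
        (h.continuousOn_line (hρ.pd eX) (neg_ne_zero.2 hpos.ne')))
  have m2 : ∀ᶠ n in atTop, AEStronglyMeasurable fun t => ∫ ξ in outer (ε n),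
      (pd eX (ρ ∘ charSwap) (t, ξ, ε n) * -φ (reflectY (charPt t ξ (ε n)))
        - pd eX (ρ ∘ charSwap) (t, ξ, -ε n) * -φ (reflectY (charPt t ξ (-ε n)))) := by
    filter_upwards [hε.eventually self_mem_nhdsWithin] with n hpos
    have hpos : 0 < ε n := hpos
    exact aestronglyMeasurable_integral_outer (F := fun t ξ =>
      (pd eX (ρ ∘ charSwap) (t, ξ, ε n) * -φ (reflectY (charPt t ξ (ε n)))
        - pd eX (ρ ∘ charSwap) (t, ξ, -ε n) * -φ (reflectY (charPt t ξ (-ε n))))) hpos.le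
      ((h.swap.continuousOn_line (hρ.charSwap.pd eX) hpos.ne').sub
        (h.swap.continuousOn_line (hρ.charSwap.pd eX) (neg_ne_zero.2 hpos.ne')))
  have m3 : ∀ᶠ n in atTop, AEStronglyMeasurable fun t =>
      ρ (t, ε n, ε n) * φ (charPt t (ε n) (ε n)) + ρ (t, -ε n, -ε n) * φ (charPt t (-ε n) (-ε n))
        - ρ (t, ε n, -ε n) * φ (charPt t (ε n) (-ε n))
        - ρ (t, -ε n, ε n) * φ (charPt t (-ε n) (ε n)) := by
    filter_upwards [hε.eventually self_mem_nhdsWithin] with n hpos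
    have hpos : 0 < ε n := hpos
    have hcc : ∀ {a b : ℝ}, a ≠ 0 → b ≠ 0 →
        Continuous fun t : ℝ => ρ (t, a, b) * φ (charPt t a b) := fun {a b} ha hb => by
      rw [← continuousOn_univ]
      exact (h.continuousOn_test_mul hρ).comp (f := fun t : ℝ => ((t, a, b) : ST)) (by fun_prop)
        fun t _ => ⟨ha, hb⟩
    have hn := neg_ne_zero.2 hpos.ne'
    exact ((((hcc hpos.ne' hpos.ne').add (hcc hn hn)).sub (hcc hpos.ne' hn)).sub
      (hcc hn hpos.ne')).aestronglyMeasurable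
  have l1 := tendsto_integral_of_tendstoUniformlyOn hK m1 (fun n t ht => by simp [hzp ht])
    (fun t ht => by simp [hz ht]) hint (h.tendsto_wave_line hε hc hρ hKI hK)
  have l2 := tendsto_integral_of_tendstoUniformlyOn hK m2
    (fun n t ht => by simp [pd_eX_charSwap, hzp ht]) (fun t ht => by simp [charSwap_mk, hz ht])
    (by simpa only [hsum, Function.comp_apply, charSwap_mk] using hint')
    (h.swap.tendsto_wave_line hε (fun t ht => (hc t ht).swap) hρ.charSwap hKI hK)
  have l3 := tendsto_integral_of_tendstoUniformlyOn hK m3 (fun n t ht => by simp [hz ht])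
    (fun t ht => by simp [hz ht]) hint' (h.tendsto_wave_corner hε hc hρ hKI hK)
  -- With `D = c₁ + c₃` the limits of the two lines and of the corner are integrals of `Dρ`, `-Dρ`
  -- and `-Dρ`, with `ρ` taken at the corner. The second line enters with a plus sign, as it was
  -- computed for `-φ`. The total is the integral of `-Dρ`.
  have l4 := ((l1.neg).add l2).sub l3
  refine tendsto_nhds_unique (tendsto_integral_farAxes hε (integrable_waveIntegrand hw hρ)) ?_
  have e : -(∫ t, (c1 φ₃ t 0 + c3 φ₃ t 0) * ρ (t, 0, 0)) +
      (∫ t, (c1 (swapCoeff₃ φ₃) t 0 + c3 (swapCoeff₃ φ₃) t 0) * (ρ ∘ charSwap) (t, 0, 0)) -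
      (∫ t, -(c1 φ₃ t 0 + c3 φ₃ t 0) * ρ (t, 0, 0)) =
      ∫ t, -(c1 φ₃ t 0 + c3 φ₃ t 0) * ρ (t, 0, 0) := by
    simp only [hsum, Function.comp_apply, charSwap_mk, neg_mul, integral_neg]
    ring
  rw [e] at l4
  refine l4.congr' ?_
  filter_upwards [hε.eventually self_mem_nhdsWithin] with n hpos
  rw [S.integral_waveIntegrand hρ hpos]
  simp only [Function.comp_apply, charMap_mk, pd_eX_charSwap, reflectY_charPt]
  congr 1
  rw [sub_eq_add_neg]
  congr 1
  rw [← integral_neg]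
  refine integral_congr_ae (Eventually.of_forall fun t => ?_)
  simp only
  rw [← integral_neg]
  refine integral_congr_ae (Eventually.of_forall fun η => ?_)
  simp only
  ring

/-- The weak wave equation in terms of the coefficients of the field. -/
theorem FieldData.weak_wave_iff (h : FieldData I φ φ₁ φ₂ φ₃ δ)
    (S : CharSolution κ I (u ∘ charMap) (φ ∘ charMap))
    (hw : WeakClass κ I u φ (pd eX u) (pd eY u)) (hε : Tendsto ε atTop (𝓝[>] 0)) :
    (∀ ρ, IsTest (slab I) ρ → ∫ q, waveIntegrand κ (u ∘ charMap) (φ ∘ charMap) ρ q = 0) ↔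
      ∀ t ∈ I, FieldCompat φ₁ φ₂ φ₃ t ∧ c1 φ₃ t 0 + c3 φ₃ t 0 = 0 := by
  constructor
  · intro H
    have hc : ∀ t ∈ I, FieldCompat φ₁ φ₂ φ₃ t := fun t ht => h.fieldCompat ht
      (h.axisCompat hε (fun χ hχ θ hθ => tendsto_wave_axis_eta S hw hε H hχ hθ) t ht)
      (h.swap.axisCompat hε (fun χ hχ θ hθ => tendsto_wave_axis_xi S hw hε H hχ hθ) t ht)
    have hcont : ContinuousOn (fun t => c1 φ₃ t 0 + c3 φ₃ t 0) I := by
      have tr : ∀ c, ContinuousOn (fun t => φ₃ c t 0 0) I := fun c =>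
        (h.log.continuousOn_trace₃ c).comp (f := fun t => (t, 0)) (by fun_prop)
          fun t ht => ⟨ht, by simp⟩
      exact ((tr .vPlus).sub (tr .hPlus)).add ((tr .vMinus).sub (tr .hMinus))
    have h0 := eq_zero_of_forall_isTest₁ h.isOpen hcont fun θ hθ => by
      obtain ⟨β, hβ, hβ1⟩ := exists_isTest₁_eventually_eq_one
      have hρ := isTest_tensorTest hθ hβ hβ
      have := h.integral_waveIntegrand S hw hε hc hρ
      rw [H _ hρ] at this
      simp only [tensorTest, hβ1.self_of_nhds, mul_one, neg_mul, integral_neg] at this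
      rw [eq_comm, neg_eq_zero] at this
      simpa only [smul_eq_mul, mul_comm] using this
    exact fun t ht => ⟨hc t ht, h0 t ht⟩
  · intro H ρ hρ
    rw [h.integral_waveIntegrand S hw hε (fun t ht => (H t ht).1) hρ]
    rw [integral_congr_ae (g := fun _ => (0 : ℝ)), integral_zero]
    refine Eventually.of_forall fun t => ?_
    by_cases ht : t ∈ I
    · simp [(H t ht).2]
    · have : ρ (t, 0, 0) = 0 := eq_zero_of_notMem_timeSupport
        fun h' => ht (hρ.timeSupport_subset h')
      simp [this]

end


/-! ### The spin equation along the axes -/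

/-- The flux of the spin equation in the direction `η`. -/
def axisFlux (κ : Target) (u : ST → V3) (φ : ST → ℝ) (t ξ η : ℝ) : V3 :=
  wedge κ (u (charPt t ξ η)) (dXi u t ξ η) + φ (charPt t ξ η) • dXi u t ξ η

/-- A field of logarithmic form and a continuous spin with a tangential derivative that converges
along the axis `η = 0`. -/
structure SpinData (I : Set ℝ) (u : ST → V3) (φ : ST → ℝ) (φ₁ φ₂ : Cone → ℝ → ℝ → ℝ)
    (φ₃ : Cone → ℝ → ℝ → ℝ → ℝ) (δ : ℝ) (ε : ℕ → ℝ) : Prop where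
  field : FieldData I φ φ₁ φ₂ φ₃ δ
  eps : Tendsto ε atTop (𝓝[>] 0)
  cont : ContinuousOn u (slab I)
  weight : LineWeight I δ ε (dXi u)

section

variable {κ : Target} {I : Set ℝ} {u : ST → V3} {φ : ST → ℝ} {φ₁ φ₂ : Cone → ℝ → ℝ → ℝ}
  {φ₃ : Cone → ℝ → ℝ → ℝ → ℝ} {δ : ℝ} {ε : ℕ → ℝ}

theorem norm_wedge_le (κ : Target) (v w : V3) : ‖wedge κ v w‖ ≤ ‖wedgeL κ‖ * ‖v‖ * ‖w‖ :=
  (wedgeL κ).le_opNorm₂ v w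

/-- The factors are exchanged one at a time, and `‖w‖ ≤ ‖w₀‖ + ‖w - w₀‖`: only the trace and the
distance from it are controlled in `L¹`. -/
theorem norm_smul_wedge_sub_le (κ : Target) {g g₀ e e' M : ℝ} {v v₀ w w₀ : V3}
    (hg : |g - g₀| ≤ e) (hv : ‖v - v₀‖ ≤ e') (hM : ‖v‖ ≤ M) (hM' : ‖v₀‖ ≤ M) :
    ‖g • wedge κ v w - g₀ • wedge κ v₀ w₀‖ ≤
      ‖wedgeL κ‖ * (e * M + |g₀| * e') * ‖w₀‖ +
      ‖wedgeL κ‖ * (e * M + |g₀| * e' + |g₀| * M) * ‖w - w₀‖ := by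
  have h0 : g • wedge κ v w - g₀ • wedge κ v₀ w₀ = (g - g₀) • wedge κ v w +
      g₀ • wedge κ (v - v₀) w + g₀ • wedge κ v₀ (w - w₀) := by
    simp only [← wedgeL_apply, map_sub, _root_.sub_apply]
    module
  have he : 0 ≤ e := (abs_nonneg _).trans hg
  have hM0 : 0 ≤ M := (norm_nonneg _).trans hM
  have hw : ‖w‖ ≤ ‖w₀‖ + ‖w - w₀‖ := norm_le_norm_add_norm_sub' w w₀
  have hL := norm_nonneg (wedgeL κ)
  have he' : 0 ≤ e' := (norm_nonneg _).trans hv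
  rw [h0]
  calc _ ≤ e * (‖wedgeL κ‖ * M * (‖w₀‖ + ‖w - w₀‖)) +
        |g₀| * (‖wedgeL κ‖ * e' * (‖w₀‖ + ‖w - w₀‖)) + |g₀| * (‖wedgeL κ‖ * M * ‖w - w₀‖) := by
        refine (norm_add₃_le).trans ?_
        simp only [norm_smul, Real.norm_eq_abs]
        gcongr
        · exact (norm_wedge_le κ v w).trans (by gcongr)
        · exact (norm_wedge_le κ _ w).trans (by gcongr)
        · exact (norm_wedge_le κ _ _).trans (by gcongr)
    _ = _ := by ring

/-- The exterior part of the flux does not contribute to the boundary terms. -/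
theorem SpinData.tendsto_wedge (h : SpinData I u φ φ₁ φ₂ φ₃ δ ε) (κ : Target) {K : Set ℝ}
    (hKI : K ⊆ I) (hK : IsCompact K) {R G : ℝ} {g : ℝ → ℝ → ℝ → ℝ} (hg : LineTest K R G g) :
    TendstoUniformlyOn (fun n t => ∫ ξ in outer (ε n),
      (g t ξ (ε n) • wedge κ (u (charPt t ξ (ε n))) (dXi u t ξ (ε n))
        - g t ξ (-ε n) • wedge κ (u (charPt t ξ (-ε n))) (dXi u t ξ (-ε n)))) 0 atTop K := by
  obtain ⟨D, hD, hw0, hw1⟩ := h.weight.conv K hKI hK R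
  rcases K.eq_empty_or_nonempty with rfl | ⟨t₀, ht₀⟩
  · exact tendstoUniformlyOn_empty
  have hG : 0 ≤ G := (abs_nonneg _).trans (hg.bound t₀ ht₀ 0)
  set Q : Set ST := K ×ˢ Icc (-R) R ×ˢ Icc (-1) 1
  have hQ : IsCompact Q := hK.prod (isCompact_Icc.prod isCompact_Icc)
  have huQ : ContinuousOn (fun q => u (charMap q)) Q :=
    h.cont.comp charMap.continuous.continuousOn fun q hq => hKI hq.1
  obtain ⟨M, hM⟩ := hQ.exists_bound_of_continuousOn huQ
  have huc := hQ.uniformContinuousOn_of_continuous huQ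
  rw [Metric.uniformContinuousOn_iff] at huc
  set W := ‖wedgeL κ‖ with hW
  have hW0 : 0 ≤ W := norm_nonneg (wedgeL κ)
  rw [Metric.tendstoUniformlyOn_iff]
  intro e he
  -- The part of the error that does not tend to zero with `s` is `2 W G e' D`, and this choice
  -- keeps it below `e / 2`.
  set e' : ℝ := e / (4 * (W * G * D + 1)) with he'
  have he'0 : 0 < e' := by positivity
  have hGe : 2 * (W * (G * e')) * D ≤ e / 2 := by
    have : e' * (4 * (W * G * D + 1)) = e := by rw [he']; field_simp
    nlinarith [he'0]
  -- Uniform continuity of `u` without any rate suffices, because no logarithm multiplies this part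
  -- of the flux.
  obtain ⟨d, hd, hd'⟩ := huc e' he'0
  set A : ℝ → ℝ := fun s => W * (G * s * |M| + G * e') with hA
  have hlim : Tendsto (fun s => 2 * (W * (G * s * |M|)) * D +
      (A s + W * (G * |M|)) * (2 * (D * s ^ δ))) (𝓝[>] 0) (𝓝 0) := by
    have l3 : Tendsto (fun s : ℝ => s) (𝓝[>] 0) (𝓝 0) := tendsto_nhdsWithin_of_tendsto_nhds tendsto_id
    have l0 : Tendsto (fun s : ℝ => s ^ δ) (𝓝[>] 0) (𝓝 0) := by
      have := (Real.continuousAt_rpow_const (0 : ℝ) δ (Or.inr h.field.pos.le)).tendsto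
      rw [Real.zero_rpow h.field.pos.ne'] at this
      exact this.mono_left nhdsWithin_le_nhds
    have := (l3.const_mul (2 * (W * (G * |M|)) * D)).add
      (((l3.const_mul (W * (G * |M|))).add_const (W * (G * e') + W * (G * |M|))).mul
        (l0.const_mul (2 * D)))
    simp only [mul_zero, add_zero] at this
    refine this.congr fun s => ?_
    simp only [A]
    ring
  filter_upwards [hw1, h.eps.eventually (hlim.eventually_lt_const (half_pos he)),
    h.eps.eventually (eventually_mem_Ioo one_pos), h.eps.eventually (eventually_mem_Ioo hd)]
    with n hw1 hl hs1 hsd t ht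
  set s := ε n with hsdef
  have hs0 : 0 < s := hs1.1
  have hDs : 0 ≤ D * s ^ δ := mul_nonneg hD (Real.rpow_nonneg hs0.le δ)
  have hA0 : 0 ≤ A s := by positivity
  obtain ⟨hw1p, hw1m⟩ := hw1 t ht
  simp only [Pi.zero_apply, dist_zero_left]
  refine lt_of_le_of_lt (norm_integral_outer_le (a := 2 * A s) (b := A s + W * (G * |M|))
    (by positivity) (by positivity) hD hDs (h.weight.meas t (hKI ht) 0) (h.weight.meas t (hKI ht) s)
    (h.weight.meas t (hKI ht) (-s)) (hw0 t ht) hw1p hw1m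
    (fun ξ hξ hξR => ?_) fun ξ hξ => by simp [hg.supp t ht ξ hξ]) ?_
  · have g0 := hg.bound t ht ξ
    have key : ∀ a, |a| = s → ‖g t ξ a • wedge κ (u (charPt t ξ a)) (dXi u t ξ a) -
        g t ξ 0 • wedge κ (u (charPt t ξ 0)) (dXi u t ξ 0)‖ ≤
        A s * ‖dXi u t ξ 0‖ + (A s + W * (G * |M|)) * ‖dXi u t ξ a - dXi u t ξ 0‖ := by
      intro a ha
      have hq : ((t, ξ, a) : ST) ∈ Q := ⟨ht, abs_le.1 hξR.le, abs_le.1 (ha.trans_le hs1.2.le)⟩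
      have hq0 : ((t, ξ, 0) : ST) ∈ Q := ⟨ht, abs_le.1 hξR.le, by simp⟩
      have g1 := hg.lip t ht ξ a
      rw [ha] at g1
      have hv := hd' _ hq _ hq0 (by
        simp only [Prod.dist_eq, dist_self, Real.dist_eq, sub_zero, ha]
        simpa [hs0.le] using hsd.2)
      rw [dist_eq_norm] at hv
      refine (norm_smul_wedge_sub_le κ g1 hv.le ((hM _ hq).trans (le_abs_self M))
        ((hM _ hq0).trans (le_abs_self M))).trans ?_
      rw [← hW]
      have i1 : G * s * |M| + |g t ξ 0| * e' ≤ G * s * |M| + G * e' := by gcongr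
      refine add_le_add ?_ ?_
      · simp only [hA]; gcongr
      · rw [hA]
        simp only
        rw [← mul_add]
        gcongr
    have kp := key s (abs_of_pos hs0)
    have km := key (-s) (by rw [abs_neg, abs_of_pos hs0])
    have := norm_sub_le (g t ξ s • wedge κ (u (charPt t ξ s)) (dXi u t ξ s) -
      g t ξ 0 • wedge κ (u (charPt t ξ 0)) (dXi u t ξ 0))
      (g t ξ (-s) • wedge κ (u (charPt t ξ (-s))) (dXi u t ξ (-s)) -
      g t ξ 0 • wedge κ (u (charPt t ξ 0)) (dXi u t ξ 0))
    rw [sub_sub_sub_cancel_right] at this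
    linarith
  · have : 2 * A s * D = 2 * (W * (G * s * |M|)) * D + 2 * (W * (G * e')) * D := by
      simp only [hA]; ring
    linarith

theorem SpinData.continuousOn_u (h : SpinData I u φ φ₁ φ₂ φ₃ δ ε) (s : ℝ) :
    ContinuousOn (fun q : ℝ × ℝ => u (charPt q.1 q.2 s)) (I ×ˢ {0}ᶜ) := by
  refine h.cont.comp (f := fun q : ℝ × ℝ => charPt q.1 q.2 s) ?_ fun q hq => hq.1
  unfold charPt
  fun_prop

theorem FieldData.continuousOn_phi (h : FieldData I φ φ₁ φ₂ φ₃ δ) {s : ℝ} (hs : s ≠ 0) :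
    ContinuousOn (fun q : ℝ × ℝ => φ (charPt q.1 q.2 s)) (I ×ˢ {0}ᶜ) := by
  refine h.cont.comp (f := fun q : ℝ × ℝ => charPt q.1 q.2 s) ?_
    fun q hq => charPt_mem_offCross hq.1 hq.2 hs
  unfold charPt
  fun_prop

theorem continuousOn_wedge {X : Type*} [TopologicalSpace X] {s : Set X} {f g : X → V3}
    (hf : ContinuousOn f s) (hg : ContinuousOn g s) :
    ContinuousOn (fun x => wedge κ (f x) (g x)) s :=
  (wedgeL κ).isBoundedBilinearMap.continuous.comp_continuousOn (hf.prodMk hg)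

/-- Continuity of the two parts of the flux on the lines `η = ±ε_n`. -/
theorem SpinData.continuousOn_parts (h : SpinData I u φ φ₁ φ₂ φ₃ δ ε) (κ : Target) {n : ℕ}
    (hpos : 0 < ε n) {s : ℝ} (hs : s = ε n ∨ s = -ε n) :
    ContinuousOn (fun q : ℝ × ℝ => wedge κ (u (charPt q.1 q.2 s)) (dXi u q.1 q.2 s)) (I ×ˢ {0}ᶜ) ∧
    ContinuousOn (fun q : ℝ × ℝ => φ (charPt q.1 q.2 s) • dXi u q.1 q.2 s) (I ×ˢ {0}ᶜ) := by
  have hs0 : s ≠ 0 := by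
    rcases hs with rfl | rfl
    · exact hpos.ne'
    · exact neg_ne_zero.2 hpos.ne'
  have hw : ContinuousOn (fun q : ℝ × ℝ => dXi u q.1 q.2 s) (I ×ˢ {0}ᶜ) := by
    rcases hs with rfl | rfl
    · exact (h.weight.cont n).1
    · exact (h.weight.cont n).2
  exact ⟨continuousOn_wedge (h.continuousOn_u s) hw, (h.field.continuousOn_phi hs0).smul hw⟩

theorem SpinData.locallyIntegrable (h : SpinData I u φ φ₁ φ₂ φ₃ δ ε) {t : ℝ} (ht : t ∈ I) :
    LocallyIntegrable fun ξ => dXi u t ξ 0 := by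
  intro x
  obtain ⟨C, -, hC, -⟩ := h.weight.conv {t} (singleton_subset_iff.2 ht) isCompact_singleton (|x| + 1)
  exact ⟨Ioo (-(|x| + 1)) (|x| + 1), Ioo_mem_nhds (by linarith [neg_abs_le x])
    (by linarith [le_abs_self x]), (h.weight.meas t ht 0).restrict,
    (hC t rfl).trans_lt ENNReal.ofReal_lt_top⟩

theorem SpinData.ae_smul_eq_zero (h : SpinData I u φ φ₁ φ₂ φ₃ δ ε) {t : ℝ} (ht : t ∈ I) {O : Set ℝ}
    (hO : IsOpen O) {c : ℝ} (H : ∀ χ, IsTest₁ O χ → ∫ ξ, χ ξ • (c • dXi u t ξ 0) = 0) :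
    ∀ᵐ ξ, ξ ∈ O → c • dXi u t ξ 0 = 0 :=
  hO.ae_eq_zero_of_integral_contDiff_smul_eq_zero (μ := volume)
    (((h.locallyIntegrable ht).smul c).locallyIntegrableOn O) fun g h1 h2 h3 => H g ⟨h1, h2, h3⟩

/-- If the boundary terms of the spin equation along the axis `η = 0` vanish in the limit, the jumps
of the field annihilate the tangential derivative of the spin. -/
theorem SpinData.jump_smul_eq_zero (h : SpinData I u φ φ₁ φ₂ φ₃ δ ε) (κ : Target)
    (hc : ∀ t ∈ I, FieldCompat φ₁ φ₂ φ₃ t)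
    (H : ∀ χ, IsTest₁ {0}ᶜ χ → ∀ θ, IsTest₁ I θ → Tendsto (fun n => ∫ t, θ t • ∫ ξ in outer (ε n),
      (χ ξ • axisFlux κ u φ t ξ (ε n) - χ ξ • axisFlux κ u φ t ξ (-ε n))) atTop (𝓝 0)) :
    ∀ t ∈ I, (∀ᵐ ξ, jump1 φ₁ t ξ • dXi u t ξ 0 = 0) ∧
      (∀ᵐ ξ, 0 < ξ → c1 φ₃ t ξ • dXi u t ξ 0 = 0) ∧
      (∀ᵐ ξ, ξ < 0 → c3 φ₃ t ξ • dXi u t ξ 0 = 0) := by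
  intro t ht
  have hv : ∀ χ, IsTest₁ {0}ᶜ χ → ∫ ξ, (χ ξ * jump1 φ₁ t ξ) • dXi u t ξ 0 = 0 ∧
      ∫ ξ, (χ ξ * (axisJump2 φ₂ t ξ * Real.log |ξ| + axisJump3 φ₃ t ξ)) • dXi u t ξ 0 = 0 := by
    intro χ hχ
    refine h.field.line_vanish h.weight h.eps hχ.1.continuous hχ.2.1 hχ.2.2 (fun θ hθ => ?_) t ht
    obtain ⟨R, G, hG, hχR, hχG⟩ := exists_bound_of_hasCompactSupport hχ.1.continuous hχ.2.1
    -- Subtracting the exterior part, which tends to zero by itself, leaves the terms `φ u_ξ` to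
    -- which `line_vanish` applies.
    have hW := tendsto_integral_smul_of_tendstoUniformlyOn
      (hθ.1.continuous.integrable_of_hasCompactSupport hθ.2.1)
      (fun t ht => image_eq_zero_of_notMem_tsupport ht)
      (h.tendsto_wedge κ hθ.2.2 hθ.2.1.isCompact (R := R) (G := G) (g := fun _ ξ _ => χ ξ)
        ⟨fun _ _ ξ => hχG ξ, fun _ _ ξ η => by rw [sub_self, abs_zero]; positivity,
          fun _ _ ξ hξ _ => hχR ξ hξ⟩)
    have h0 := (H χ hχ θ hθ).sub hW
    rw [sub_zero] at h0
    refine h0.congr' ?_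
    obtain ⟨r, hr, hr0⟩ := exists_pos_le_abs_of_tsupport hχ.2.2
    filter_upwards [h.eps.eventually (eventually_mem_Ioo hr)] with n hn
    have hout : ∀ x, x ∉ outer (ε n) → χ x = 0 := fun x hx =>
      hr0 x ((not_lt.1 hx).trans hn.2.le)
    set Wn : ℝ → ℝ → V3 := fun t ξ =>
      χ ξ • wedge κ (u (charPt t ξ (ε n))) (dXi u t ξ (ε n))
        - χ ξ • wedge κ (u (charPt t ξ (-ε n))) (dXi u t ξ (-ε n)) with hWn
    set Pn : ℝ → ℝ → V3 := fun t ξ =>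
      (χ ξ * φ (charPt t ξ (ε n))) • dXi u t ξ (ε n)
        - (χ ξ * φ (charPt t ξ (-ε n))) • dXi u t ξ (-ε n) with hPn
    have hχc : ContinuousOn (fun q : ℝ × ℝ => χ q.2) (I ×ˢ {0}ᶜ) :=
      (hχ.1.continuous.comp continuous_snd).continuousOn
    obtain ⟨p1, p2⟩ := h.continuousOn_parts κ hn.1 (Or.inl rfl)
    obtain ⟨p3, p4⟩ := h.continuousOn_parts κ hn.1 (Or.inr rfl)
    have cW : ContinuousOn (fun q : ℝ × ℝ => Wn q.1 q.2) (I ×ˢ {0}ᶜ) :=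
      (hχc.smul p1).sub (hχc.smul p3)
    have cP : ContinuousOn (fun q : ℝ × ℝ => Pn q.1 q.2) (I ×ˢ {0}ᶜ) := by
      simp only [hPn, mul_smul]
      exact (hχc.smul p2).sub (hχc.smul p4)
    have zW : ∀ t x, χ x = 0 → Wn t x = 0 := fun t x hx => by simp [hWn, hx]
    have zP : ∀ t x, χ x = 0 → Pn t x = 0 := fun t x hx => by simp [hPn, hx]
    have hcut : ∀ {F : ℝ → V3}, (∀ x, χ x = 0 → F x = 0) → ∫ ξ in outer (ε n), F ξ = ∫ ξ, F ξ :=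
      fun hF => setIntegral_eq_integral_of_forall_compl_eq_zero fun x hx => hF x (hout x hx)
    have iθ : ∀ {c : ℝ → V3}, ContinuousOn c I → Integrable fun t => θ t • c t := fun {c} hc' =>
      integrable_smul_of_continuousOn h.field.isOpen hθ.1.continuous.continuousOn hθ.2.1 hθ.2.2 hc'
    have e1 : ∀ t, θ t • ∫ ξ in outer (ε n),
        (χ ξ • axisFlux κ u φ t ξ (ε n) - χ ξ • axisFlux κ u φ t ξ (-ε n)) =
        θ t • (∫ ξ, Wn t ξ) + θ t • (∫ ξ, Pn t ξ) := by
      intro t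
      by_cases ht : t ∈ I
      · rw [← smul_add, hcut fun x hx => by simp [hx], ← integral_add
          (integrable_of_test hχ.2.1 hχ.2.2 cW zW ht) (integrable_of_test hχ.2.1 hχ.2.2 cP zP ht)]
        congr 1
        refine integral_congr_ae (Eventually.of_forall fun ξ => ?_)
        simp only [hWn, hPn, axisFlux]
        module
      · have : θ t = 0 := image_eq_zero_of_notMem_tsupport fun h' => ht (hθ.2.2 h')
        simp [this]
    have e2 : ∀ t, ∫ ξ in outer (ε n), Wn t ξ = ∫ ξ, Wn t ξ := fun t => hcut (zW t)
    have e3 : ∀ t, ∫ ξ in outer (ε n), Pn t ξ = ∫ ξ, Pn t ξ := fun t => hcut (zP t)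
    change _ - (∫ t, θ t • ∫ ξ in outer (ε n), Wn t ξ) = ∫ t, θ t • ∫ ξ in outer (ε n), Pn t ξ
    simp only [e1, e2, e3]
    rw [integral_add (iθ (continuousOn_integral_of_test hχ.2.1 hχ.2.2 cW zW))
      (iθ (continuousOn_integral_of_test hχ.2.1 hχ.2.2 cP zP)), add_sub_cancel_left]
  have hp : Ioi (0 : ℝ) ⊆ {0}ᶜ := fun x hx => ne_of_gt hx
  have hm : Iio (0 : ℝ) ⊆ {0}ᶜ := fun x hx => ne_of_lt hx
  have hct := hc t ht
  have hoff : ∀ {O : Set ℝ} {χ : ℝ → ℝ}, IsTest₁ O χ → ∀ ξ ∉ O, χ ξ = 0 := fun hχ ξ hξ =>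
    image_eq_zero_of_notMem_tsupport fun h' => hξ (hχ.2.2 h')
  refine ⟨?_, ?_, ?_⟩
  -- By compatibility the coefficient is constant along the axis, so its value at `0` serves as the
  -- fixed scalar; likewise for `c₁` and `c₃` below.
  · have := h.ae_smul_eq_zero ht (c := jump1 φ₁ t 0) isOpen_compl_singleton fun χ hχ => by
      rw [← (hv χ hχ).1]
      refine integral_congr_ae (Eventually.of_forall fun ξ => ?_)
      simp only [mul_smul, hct.jump1_const ξ 0]
    have h0 : ∀ᵐ ξ : ℝ, ξ ∈ ({0}ᶜ : Set ℝ) := by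
      rw [ae_iff]; simp
    filter_upwards [this, h0] with ξ h1 h2
    rw [hct.jump1_const ξ 0]
    exact h1 h2
  · have := h.ae_smul_eq_zero ht (c := -c1 φ₃ t 0) isOpen_Ioi fun χ hχ => by
      rw [← (hv χ (hχ.mono hp)).2]
      refine integral_congr_ae (Eventually.of_forall fun ξ => ?_)
      by_cases hξ : 0 < ξ
      · simp only [axisJump2, axisJump3, if_neg hξ.not_ge, hct.phi2_plus,
          hct.c1_const ξ hξ.le 0 le_rfl, mul_smul, sub_self, zero_mul, zero_add]
      · simp [hoff hχ ξ hξ]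
    filter_upwards [this] with ξ h1 h2
    rw [hct.c1_const ξ h2.le 0 le_rfl]
    simpa using h1 h2
  · have := h.ae_smul_eq_zero ht (c := c3 φ₃ t 0) isOpen_Iio fun χ hχ => by
      rw [← (hv χ (hχ.mono hm)).2]
      refine integral_congr_ae (Eventually.of_forall fun ξ => ?_)
      by_cases hξ : ξ < 0
      · simp only [axisJump2, axisJump3, if_pos hξ.le, hct.phi2_minus,
          hct.c3_const ξ hξ.le 0 le_rfl, mul_smul, sub_self, zero_mul, zero_add]
      · simp [hoff hχ ξ hξ]
    filter_upwards [this] with ξ h1 h2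
    rw [hct.c3_const ξ h2.le 0 le_rfl]
    exact h1 h2

/-- If the jumps of the field annihilate the tangential derivative of the spin, the boundary terms
of the spin equation along the axis `η = 0` vanish in the limit. -/
theorem SpinData.tendsto_flux (h : SpinData I u φ φ₁ φ₂ φ₃ δ ε) (κ : Target)
    (hc : ∀ t ∈ I, FieldCompat φ₁ φ₂ φ₃ t)
    (H : ∀ t ∈ I, (∀ᵐ ξ, jump1 φ₁ t ξ • dXi u t ξ 0 = 0) ∧
      (∀ᵐ ξ, 0 < ξ → c1 φ₃ t ξ • dXi u t ξ 0 = 0) ∧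
      (∀ᵐ ξ, ξ < 0 → c3 φ₃ t ξ • dXi u t ξ 0 = 0))
    {ρ : ST → ℝ} (hρ : IsTest (slab I) ρ) :
    Tendsto (fun n => ∫ t, ∫ ξ in outer (ε n), (ρ (t, ξ, ε n) • axisFlux κ u φ t ξ (ε n)
      - ρ (t, ξ, -ε n) • axisFlux κ u φ t ξ (-ε n))) atTop (𝓝 0) := by
  have hKI := hρ.timeSupport_subset
  have hK := hρ.isCompact_timeSupport
  obtain ⟨R, G, hg⟩ := hρ.exists_lineTest
  have h1 := h.field.log.tendsto_line h.field.pos h.eps h.weight hKI hK (hg _)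
  have h2 := (h.tendsto_wedge κ hKI hK (hg _)).add h1
  rw [add_zero] at h2
  have h3 : TendstoUniformlyOn (fun n t => ∫ ξ in outer (ε n),
      (ρ (t, ξ, ε n) • axisFlux κ u φ t ξ (ε n)
      - ρ (t, ξ, -ε n) • axisFlux κ u φ t ξ (-ε n))) 0 atTop (timeSupport ρ) := by
    refine h2.congr ?_
    filter_upwards [h.eps.eventually self_mem_nhdsWithin] with n hpos t ht
    have hpos : 0 < ε n := hpos
    have htI := hKI ht
    -- The whole comparison coefficient annihilates the trace of `u_ξ`, the divergent factor `log
    -- ε_n` included. The comparison term is therefore zero for every such `n`, not only in the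
    -- limit.
    have hz : ∀ᵐ ξ, jumpCoeff φ₁ φ₂ φ₃ (ε n) t ξ • dXi u t ξ 0 = 0 := by
      obtain ⟨a, b, c⟩ := H t htI
      have h0 : ∀ᵐ ξ : ℝ, ξ ≠ 0 := by rw [ae_iff]; simp
      filter_upwards [a, b, c, h0] with ξ a b c h0
      have hct := hc t htI
      rcases lt_or_gt_of_ne h0 with hξ | hξ
      · simp only [jumpCoeff, axisJump2, axisJump3, if_pos hξ.le, hct.phi2_minus, sub_self,
          zero_mul, add_zero, add_smul, c hξ, mul_smul, a, smul_zero]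
      · simp only [jumpCoeff, axisJump2, axisJump3, if_neg hξ.not_ge, hct.phi2_plus, sub_self,
          zero_mul, add_zero, add_smul, neg_smul, b hξ, mul_smul, a, smul_zero, neg_zero]
    have hsl : ∀ s, HasCompactSupport fun ξ => ρ (t, ξ, s) := fun s =>
      hasCompactSupport_slice hρ.2.1 (fun q => q.2.1) (by fun_prop) fun _ => rfl
    have hcs : ∀ s, Continuous fun ξ => ρ (t, ξ, s) := fun s => hρ.1.continuous.comp (by fun_prop)
    have hi : ∀ {s : ℝ} {f : ℝ × ℝ → V3}, ContinuousOn f (I ×ˢ {0}ᶜ) →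
        IntegrableOn (fun ξ => ρ (t, ξ, s) • f (t, ξ)) (outer (ε n)) := fun {s f} hf =>
      integrableOn_outer ((hcs s).continuousOn.smul
        (hf.comp (f := fun ξ => (t, ξ)) (by fun_prop) fun _ hξ => ⟨htI, hξ⟩)) (hsl s).smul_right hpos
    obtain ⟨p1, p2⟩ := h.continuousOn_parts κ hpos (Or.inl rfl)
    obtain ⟨p3, p4⟩ := h.continuousOn_parts κ hpos (Or.inr rfl)
    have e : ∫ ξ in outer (ε n), ((ρ (t, ξ, ε n) * φ (charPt t ξ (ε n))) • dXi u t ξ (ε n)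
        - (ρ (t, ξ, -ε n) * φ (charPt t ξ (-ε n))) • dXi u t ξ (-ε n)
        - (ρ (t, ξ, 0) * jumpCoeff φ₁ φ₂ φ₃ (ε n) t ξ) • dXi u t ξ 0) =
        ∫ ξ in outer (ε n), (ρ (t, ξ, ε n) • φ (charPt t ξ (ε n)) • dXi u t ξ (ε n)
        - ρ (t, ξ, -ε n) • φ (charPt t ξ (-ε n)) • dXi u t ξ (-ε n)) := by
      refine integral_congr_ae ?_
      filter_upwards [ae_restrict_of_ae hz] with ξ hξ
      rw [mul_smul _ (jumpCoeff _ _ _ _ _ _), hξ, smul_zero, sub_zero, mul_smul, mul_smul]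
    simp only [Pi.add_apply]
    rw [e, ← integral_add
      (f := fun ξ => ρ (t, ξ, ε n) • wedge κ (u (charPt t ξ (ε n))) (dXi u t ξ (ε n))
        - ρ (t, ξ, -ε n) • wedge κ (u (charPt t ξ (-ε n))) (dXi u t ξ (-ε n)))
      (g := fun ξ => ρ (t, ξ, ε n) • φ (charPt t ξ (ε n)) • dXi u t ξ (ε n)
        - ρ (t, ξ, -ε n) • φ (charPt t ξ (-ε n)) • dXi u t ξ (-ε n))
      ((hi p1).sub (hi p3)) ((hi p2).sub (hi p4))]
    refine integral_congr_ae (Eventually.of_forall fun ξ => ?_)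
    simp only [axisFlux, smul_add]
    abel
  -- The time dependence is already contained in `ρ`, so the indicator of its compact time support
  -- takes the place of `θ`.
  have h4 := tendsto_integral_smul_of_tendstoUniformlyOn (θ := (timeSupport ρ).indicator 1)
    ((integrable_indicator_iff hK.measurableSet).2 (integrableOn_const hK.measure_lt_top.ne))
    (fun t ht => indicator_of_notMem ht _) h3
  refine h4.congr fun n => integral_congr_ae (Eventually.of_forall fun t => ?_)
  by_cases ht : t ∈ timeSupport ρ
  · simp [indicator_of_mem ht]
  · have hz : ∀ s x, ρ (t, s, x) = 0 := fun s x => eq_zero_of_notMem_timeSupport ht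
    simp [hz]

end


/-! ### The equivalence -/

section

variable {κ : Target} {I : Set ℝ} {u : ST → V3} {φ : ST → ℝ} {φ₁ φ₂ : Cone → ℝ → ℝ → ℝ}
  {φ₃ : Cone → ℝ → ℝ → ℝ → ℝ} {δ : ℝ} {ε : ℕ → ℝ}

theorem CharSolution.fluxEta_eq (S : CharSolution κ I (u ∘ charMap) (φ ∘ charMap)) {t ξ η : ℝ}
    (ht : t ∈ I) (hξ : ξ ≠ 0) (hη : η ≠ 0) :
    fluxEta κ (u ∘ charMap) (φ ∘ charMap) (t, ξ, η) = axisFlux κ u φ t ξ η := by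
  have hd := (S.smooth_U (t, ξ, η) ⟨ht, hξ, hη⟩).differentiableAt (by simp)
  simp only [fluxEta, axisFlux, dXi_eq_pd hd, Function.comp_apply, charMap_mk]

theorem CharSolution.fluxXi_eq (S : CharSolution κ I (u ∘ charMap) (φ ∘ charMap)) {t ξ η : ℝ}
    (ht : t ∈ I) (hξ : ξ ≠ 0) (hη : η ≠ 0) :
    fluxXi κ (u ∘ charMap) (φ ∘ charMap) (t, ξ, η) =
      axisFlux κ (fun q => u (reflectY q)) (fun q => -φ (reflectY q)) t η ξ := by
  have hd := (S.smooth_U (t, ξ, η) ⟨ht, hξ, hη⟩).differentiableAt (by simp)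
  simp only [fluxXi, axisFlux, dXi_reflectY, dEta_eq_pd hd, Function.comp_apply, charMap_mk,
    reflectY_charPt, neg_smul, sub_eq_add_neg]

/-- The boundary terms of the spin equation. -/
theorem CharSolution.integral_farAxes_spin (S : CharSolution κ I (u ∘ charMap) (φ ∘ charMap))
    {ρ : ST → ℝ} (hρ : IsTest (slab I) ρ) {r : ℝ} (hr : 0 < r) :
    ∫ q in farAxes r, spinIntegrand κ (u ∘ charMap) (φ ∘ charMap) ρ q =
      (2 : ℝ) • (∫ t, ∫ ξ in outer r,
        (ρ (t, ξ, r) • axisFlux κ u φ t ξ r - ρ (t, ξ, -r) • axisFlux κ u φ t ξ (-r))) +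
      (2 : ℝ) • (∫ t, ∫ ξ in outer r, ((ρ ∘ charSwap) (t, ξ, r) •
          axisFlux κ (fun q => u (reflectY q)) (fun q => -φ (reflectY q)) t ξ r
        - (ρ ∘ charSwap) (t, ξ, -r) •
          axisFlux κ (fun q => u (reflectY q)) (fun q => -φ (reflectY q)) t ξ (-r))) := by
  rw [S.integral_spinIntegrand hρ hr]
  have hz : ∀ t ∉ I, ∀ ξ η, ρ (t, ξ, η) = 0 := fun t ht ξ η =>
    eq_zero_of_notMem_timeSupport fun h => ht (hρ.timeSupport_subset h)
  have hn := neg_ne_zero.2 hr.ne'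
  congr 2
  · refine integral_congr_ae (Eventually.of_forall fun t => ?_)
    refine setIntegral_congr_fun (measurableSet_outer r) fun ξ hξ => ?_
    have hξ0 := ne_zero_of_mem_outer hr.le hξ
    by_cases ht : t ∈ I
    · simp only [S.fluxEta_eq ht hξ0 hr.ne', S.fluxEta_eq ht hξ0 hn]
    · simp only [hz t ht, zero_smul]
  · refine integral_congr_ae (Eventually.of_forall fun t => ?_)
    refine setIntegral_congr_fun (measurableSet_outer r) fun ξ hξ => ?_
    have hξ0 := ne_zero_of_mem_outer hr.le hξ
    by_cases ht : t ∈ I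
    · simp only [S.fluxXi_eq ht hr.ne' hξ0, S.fluxXi_eq ht hn hξ0, Function.comp_apply,
        charSwap_mk]
    · simp only [Function.comp_apply, charSwap_mk, hz t ht, zero_smul]

/-- The jumps of the field annihilate the tangential derivative of the spin along `η = 0`. -/
def JumpsVanish (u : ST → V3) (φ₁ : Cone → ℝ → ℝ → ℝ) (φ₃ : Cone → ℝ → ℝ → ℝ → ℝ) (t : ℝ) : Prop :=
  (∀ᵐ ξ, jump1 φ₁ t ξ • dXi u t ξ 0 = 0) ∧
    (∀ᵐ ξ, 0 < ξ → c1 φ₃ t ξ • dXi u t ξ 0 = 0) ∧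
    (∀ᵐ ξ, ξ < 0 → c3 φ₃ t ξ • dXi u t ξ 0 = 0)

theorem tendsto_zero_of_two_smul {E : Type*} [NormedAddCommGroup E] [NormedSpace ℝ E] {f : ℕ → E}
    (h : Tendsto (fun n => (2 : ℝ) • f n) atTop (𝓝 0)) : Tendsto f atTop (𝓝 0) := by
  have := h.const_smul (2⁻¹ : ℝ)
  simpa [smul_smul] using this

/-- The weak spin equation in terms of the jumps of the field. -/
theorem SpinData.weak_spin_iff (h : SpinData I u φ φ₁ φ₂ φ₃ δ ε)
    (h' : SpinData I (fun q => u (reflectY q)) (fun q => -φ (reflectY q)) (swapCoeff φ₂)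
      (swapCoeff φ₁) (swapCoeff₃ φ₃) δ ε)
    (S : CharSolution κ I (u ∘ charMap) (φ ∘ charMap))
    (hw : WeakClass κ I u φ (pd eX u) (pd eY u)) (hc : ∀ t ∈ I, FieldCompat φ₁ φ₂ φ₃ t) :
    (∀ ρ, IsTest (slab I) ρ → ∫ q, spinIntegrand κ (u ∘ charMap) (φ ∘ charMap) ρ q = 0) ↔
      ∀ t ∈ I, JumpsVanish u φ₁ φ₃ t ∧
        JumpsVanish (fun q => u (reflectY q)) (swapCoeff φ₂) (swapCoeff₃ φ₃) t := by
  have hε := h.eps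
  constructor
  · intro H t ht
    refine ⟨h.jump_smul_eq_zero κ hc (fun χ hχ θ hθ => ?_) t ht,
      h'.jump_smul_eq_zero κ (fun t ht => (hc t ht).swap) (fun χ hχ θ hθ => ?_) t ht⟩
    · obtain ⟨β, hβ, hβ1⟩ := exists_isTest₁_eventually_eq_one
      have hρ := isTest_tensorTest hθ (hχ.mono (subset_univ _)) hβ
      have hlim := tendsto_integral_farAxes hε (integrable_spinIntegrand hw hρ)
      rw [H _ hρ] at hlim
      refine tendsto_zero_of_two_smul (hlim.congr' ?_)
      filter_upwards [eventually_vanish_and_one hε hχ.2.2 hβ1] with n hn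
      obtain ⟨hpos, a1, a2, b1, b2⟩ := hn
      rw [S.integral_farAxes_spin hρ hpos]
      simp only [Function.comp_apply, charSwap_mk, tensorTest, a1, a2, b1, b2, mul_zero, zero_mul,
        mul_one, zero_smul, sub_zero, integral_zero, smul_zero, add_zero]
      congr 1
      refine integral_congr_ae (Eventually.of_forall fun t => ?_)
      simp only
      rw [← integral_smul]
      simp only [smul_sub, smul_smul]
    · obtain ⟨β, hβ, hβ1⟩ := exists_isTest₁_eventually_eq_one
      have hρ := isTest_tensorTest hθ hβ (hχ.mono (subset_univ _))
      have hlim := tendsto_integral_farAxes hε (integrable_spinIntegrand hw hρ)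
      rw [H _ hρ] at hlim
      refine tendsto_zero_of_two_smul (hlim.congr' ?_)
      filter_upwards [eventually_vanish_and_one hε hχ.2.2 hβ1] with n hn
      obtain ⟨hpos, a1, a2, b1, b2⟩ := hn
      rw [S.integral_farAxes_spin hρ hpos]
      simp only [Function.comp_apply, charSwap_mk, tensorTest, a1, a2, b1, b2, mul_zero,
        mul_one, zero_smul, sub_zero, integral_zero, smul_zero, zero_add]
      congr 1
      refine integral_congr_ae (Eventually.of_forall fun t => ?_)
      simp only
      rw [← integral_smul]
      simp only [smul_sub, smul_smul]
  · intro H ρ hρ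
    have l1 := h.tendsto_flux κ hc (fun t ht => (H t ht).1) hρ
    have l2 := h'.tendsto_flux κ (fun t ht => (hc t ht).swap) (fun t ht => (H t ht).2) hρ.charSwap
    have l3 := (l1.const_smul (2 : ℝ)).add (l2.const_smul (2 : ℝ))
    simp only [smul_zero, add_zero] at l3
    refine tendsto_nhds_unique (tendsto_integral_farAxes hε (integrable_spinIntegrand hw hρ))
      (l3.congr' ?_)
    filter_upwards [hε.eventually self_mem_nhdsWithin] with n hpos
    rw [S.integral_farAxes_spin hρ hpos]

/-- The compatibility conditions, with the conditions along the two axes in symmetric form. -/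
theorem FieldData.compatibleAt_iff (h : FieldData I φ φ₁ φ₂ φ₃ δ) {t : ℝ} (ht : t ∈ I) :
    CompatibleAt u φ₁ φ₂ φ₃ t ↔ (FieldCompat φ₁ φ₂ φ₃ t ∧ c1 φ₃ t 0 + c3 φ₃ t 0 = 0) ∧
      JumpsVanish u φ₁ φ₃ t ∧
        JumpsVanish (fun q => u (reflectY q)) (swapCoeff φ₂) (swapCoeff₃ φ₃) t := by
  simp only [JumpsVanish, jump1_swap, c1_swap, c3_swap, dXi_reflectY, neg_smul, neg_eq_zero]
  constructor
  · intro H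
    refine ⟨⟨⟨(h.continuousAt_phi1Minus ht).1 H.cont_phi1Minus,
      (h.continuousAt_phi1Plus ht).1 H.cont_phi1Plus,
      (h.continuousAt_phi2Minus ht).1 H.cont_phi2Minus,
      (h.continuousAt_phi2Plus ht).1 H.cont_phi2Plus, H.jump1_const, H.jump2_const, H.c1_const,
      H.c2_const, H.c3_const, H.c4_const⟩, ?_⟩, ⟨H.jump1_uXi, H.c1_uXi, H.c3_uXi⟩, H.jump2_uEta,
      H.c4_uEta, H.c2_uEta⟩
    -- Written out, `corner_phi` is `c₁ + c₃ = 0` at the corner. It implies the disjunction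
    -- `corner`, so it alone carries condition 2.
    have := H.corner_phi
    simp only [c1, c3]
    linarith
  · rintro ⟨⟨hc, hD⟩, ⟨a1, a2, a3⟩, b1, b2, b3⟩
    refine ⟨(h.continuousAt_phi1Minus ht).2 hc.phi1_minus,
      (h.continuousAt_phi1Plus ht).2 hc.phi1_plus, (h.continuousAt_phi2Minus ht).2 hc.phi2_minus,
      (h.continuousAt_phi2Plus ht).2 hc.phi2_plus, hc.jump1_const, hc.jump2_const, hc.c1_const,
      hc.c2_const, hc.c3_const, hc.c4_const, Or.inr hD, ?_, a1, a2, a3, b1, b3, b2⟩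
    simp only [c1, c3] at hD
    linarith

end


end

end Ishimori

/-! ### The proposition: wave equation and spin equation combined. -/

theorem proposition2p1 (κ : Target) (I : Set ℝ) (hI : IsOpen I) (hI' : I.OrdConnected)
    (u : ST → V3) (φ : ST → ℝ) (φ₁ φ₂ : Cone → ℝ → ℝ → ℝ) (φ₃ : Cone → ℝ → ℝ → ℝ → ℝ)
    (h : StandingAssumptions κ I u φ φ₁ φ₂ φ₃) :
    IsWeakSolution κ I u φ ↔ ∀ t ∈ I, CompatibleAt u φ₁ φ₂ φ₃ t := by
  obtain ⟨⟨ux, uy, hw⟩, hu, hus, hφs, hcl, δ, hδ, -, hlog, p, hp, ε, hpos, hε0, htr⟩ := h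
  have hw := hw.of_smooth hI hus
  have hε : Tendsto ε atTop (𝓝[>] 0) := tendsto_nhdsWithin_iff.2 ⟨hε0, Eventually.of_forall hpos⟩
  have S := CharSolution.of_classical hI hus hφs hcl
  have hF : FieldData I φ φ₁ φ₂ φ₃ δ := ⟨hI, hδ, hlog, hφs.continuousOn⟩
  have hD : SpinData I u φ φ₁ φ₂ φ₃ δ ε := ⟨hF, hε, hu, htr.lineWeight_dXi hI hp.le hpos hus⟩
  have hD' : SpinData I (fun q => u (reflectY q)) (fun q => -φ (reflectY q)) (swapCoeff φ₂)
      (swapCoeff φ₁) (swapCoeff₃ φ₃) δ ε :=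
    ⟨hF.swap, hε, hu.comp contDiff_reflectY.continuous.continuousOn fun _ hq => hq,
      htr.swap.lineWeight_dXi hI hp.le hpos
        (hus.comp contDiff_reflectY.contDiffOn fun _ hq => reflectY_mem_offCross hq)⟩
  -- The wave equation is settled before the spin equation: it supplies the compatibility of the
  -- field that `SpinData.weak_spin_iff` presupposes.
  rw [isWeakSolution_iff_char hI hus hw, hF.weak_wave_iff S hw hε]
  have hcomp := fun t (ht : t ∈ I) => hF.compatibleAt_iff (u := u) ht
  constructor
  · rintro ⟨hspin, hwave⟩ t ht
    exact (hcomp t ht).2 ⟨hwave t ht, (hD.weak_spin_iff hD' S hw fun t ht => (hwave t ht).1).1 hspin t ht⟩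
  · intro H'
    have H := fun t ht => (hcomp t ht).1 (H' t ht)
    exact ⟨(hD.weak_spin_iff hD' S hw fun t ht => (H t ht).1.1).2 fun t ht => (H t ht).2,
      fun t ht => (H t ht).1⟩
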